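/- **Theorem 1.2.** Let $\mathbb T=\mathbb R/2\pi\mathbb Z$. Consider the linearization of the 3D isentropic compressible Navier–Stokes equations around the Couette flow $(y,0,0)^\top$ on $\mathbb T\times\mathbb R\times\mathbb T\ni(x,y,z)$, for the density perturbation $b$ and the velocity perturbation $u=(u^1,u^2,u^3)^\top$: $$\begin{cases}\partial_t b+y\,\partial_x b+\operatorname{div}u=0,\\[1mm] \partial_t u+y\,\partial_x u+(u^2,0,0)^\top+\dfrac{\nabla b}{\varepsilon^2}-\mu\Delta u-(\lambda+\mu)\nabla\operatorname{div}u=0,\end{cases}\qquad (b,u)|_{t=0}=(b_{\rm in},u_{\rm in}).$$ For a function $f$ write $f_0(y,z)=\frac1{2\pi}\int_{\mathbb T}f(x,y,z)\,dx$ and $f_{\neq}=f-f_0$, and let $\nabla_{x,z}=(\partial_x,\partial_z)$, $\nabla_{x,y}=(\partial_x,\partial_y)$. For every Mach number $\varepsilon>0$ there is a constant $C_2>0$, depending only on $\varepsilon$ (in particular independent of $\lambda$ and $\mu$), such that the following holds. Let $\mu,\lambda\in\mathbb R$ satisfy $$\mu>0,\qquad 2\mu+3\lambda\ge0,\qquad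 \lambda+2\mu\le1,\qquad \mu^{1/3}\varepsilon\le\tfrac14,\qquad \mu^{1/3}(\lambda+2\mu)\varepsilon^2\le1,$$ let $(b_{\rm in},u_{\rm in})\in H^2(\mathbb T\times\mathbb R\times\mathbb T)$ be real-valued, and let $(b,u)$ be a solution of the system on $[0,\infty)$ with these data, i.e. $(b(t),u(t))\in H^2$ for every $t\ge0$, $(b,u)\in C([0,\infty);L^2)$, and the equations hold in the sense of distributions. Then for all $t\ge0$ $$\begin{aligned}&\mu\left(\left\|\frac{\nabla\nabla_{x,z}b_{\neq}(t)}{\varepsilon}\right\|_{L^2}^2+\|\nabla_{x,z}\operatorname{div}u_{\neq}(t)\|_{L^2}^2+\left\|\left(\Delta u^2_{\neq}-\partial_y\operatorname{div}u_{\neq}\right)(t)\right\|_{L^2}^2\right)+\mu^{4/3}\left\|\left(\Delta u^3_{\neq}-\partial_z\operatorname{div}u_{\neq}\right)(t)\right\|_{L^2}^2\\ &\quad\le C_2e^{-\frac{\mu^{1/3}t}{22}}\left(\left\|\frac{(\nabla\nabla_{x,z}b_{\rm in})_{\neq}}{\varepsilon}\right\|_{L^2}^2+\|(\nabla\operatorname{div}u_{\rm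 in})_{\neq}\|_{L^2}^2+\|(\Delta u^2_{\rm in})_{\neq}\|_{L^2}^2+\|(\Delta u^3_{\rm in})_{\neq}\|_{L^2}^2\right),\end{aligned}$$ and $$\begin{aligned}&\mu\left(\left\|\frac{\nabla\partial_yb_{\neq}(t)}{\varepsilon}\right\|_{L^2}^2+\|\partial_y\operatorname{div}u_{\neq}(t)\|_{L^2}^2\right)+\mu^{4/3}\left\|\left(\Delta u^1_{\neq}-\partial_x\operatorname{div}u\right)(t)\right\|_{L^2}^2\\ &\quad\le C_2e^{-\frac{\mu^{1/3}t}{44}}\Bigg\{\mu^{-2/3}\left(\left\|\frac{(\nabla\partial_xb_{\rm in})_{\neq}}{\varepsilon}\right\|_{L^2}^2+\|(\nabla_{x,y}\operatorname{div}u_{\rm in})_{\neq}\|_{L^2}^2+\|(\Delta u^2_{\rm in})_{\neq}\|_{L^2}^2\right)\\ &\qquad\qquad\qquad\quad+\left\|\frac{(\nabla\partial_yb_{\rm in})_{\neq}}{\varepsilon}\right\|_{L^2}^2+\|(\Delta u^1_{\rm in})_{\neq}\|_{L^2}^2\Bigg\}.\end{aligned}$$ -/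

import Mathlib

open MeasureTheory Set
open scoped ENNReal ContDiff

noncomputable section

namespace Couette

/-- The circle `ℝ / 2πℤ` has positive length. -/
instance factTwoPiPos : Fact ((0 : ℝ) < 2 * Real.pi) := ⟨Real.two_pi_pos⟩

/-- The torus `𝕋 = ℝ / 2πℤ`, with the Lebesgue measure of total mass `2π`. -/
abbrev Torus : Type := AddCircle (2 * Real.pi)

/-- The domain `𝕋 × ℝ × 𝕋`, with points `(x, y, z)` and the product (Lebesgue) measure. -/
abbrev Dom : Type := Torus × ℝ × Torus

/-- The real Hilbert space `L²(𝕋 × ℝ × 𝕋)`. -/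
abbrev L2 : Type := Lp ℝ 2 (volume : Measure Dom)

/-- The displacement by `s` in the coordinate direction `i`
(`i = 0, 1, 2` stands for `x, y, z`). -/
def shift (i : Fin 3) (s : ℝ) : Dom :=
  ![((s : Torus), (0 : ℝ), (0 : Torus)),
    ((0 : Torus), s, (0 : Torus)),
    ((0 : Torus), (0 : ℝ), (s : Torus))] i

/-- The classical partial derivative in the direction `i` of a function on `𝕋 × ℝ × 𝕋`. -/
def partialD (i : Fin 3) (φ : Dom → ℝ) (p : Dom) : ℝ :=
  deriv (fun s : ℝ => φ (p + shift i s)) 0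

/-- Test functions `φ ∈ C_c^∞(𝕋 × ℝ × 𝕋)`: the lift of `φ` to `ℝ³` is smooth and `φ` has compact
support. -/
structure IsTest (φ : Dom → ℝ) : Prop where
  smooth : ContDiff ℝ ∞ (fun q : ℝ × ℝ × ℝ => φ ((q.1 : Torus), q.2.1, (q.2.2 : Torus)))
  compact : HasCompactSupport φ

/-- `g ∈ L²` is the weak derivative `∂ᵢ f` of `f ∈ L²`. -/
def HasWeakDeriv (i : Fin 3) (f g : L2) : Prop :=
  ∀ φ : Dom → ℝ, IsTest φ →
    ∫ p : Dom, f p * partialD i φ p = -∫ p : Dom, g p * φ p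

open Classical in
/-- The weak derivative `∂ᵢ f ∈ L²`, which is unique in `L²` when it exists. It is only ever used
for functions that possess one (the value is `0` if there is none). -/
def weakD (i : Fin 3) (f : L2) : L2 :=
  if h : ∃ g : L2, HasWeakDeriv i f g then h.choose else 0

/-- `f ∈ H¹(𝕋 × ℝ × 𝕋)`. -/
def MemH1 (f : L2) : Prop := ∀ i : Fin 3, ∃ g : L2, HasWeakDeriv i f g

/-- `f ∈ H²(𝕋 × ℝ × 𝕋)`. -/
def MemH2 (f : L2) : Prop := MemH1 f ∧ ∀ i : Fin 3, MemH1 (weakD i f)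

/-- The divergence `div u = ∂ₓu¹ + ∂ᵧu² + ∂_z u³`. -/
def div (u : Fin 3 → L2) : L2 := ∑ i : Fin 3, weakD i (u i)

/-- The Laplacian `Δ f`. -/
def lap (f : L2) : L2 := ∑ i : Fin 3, weakD i (weakD i f)

/-- The average `(1/2π) ∫_𝕋 f(x, y, z) dx` as a function on `𝕋 × ℝ × 𝕋` that is constant
in `x`. -/
def avgFun (f : Dom → ℝ) (p : Dom) : ℝ := (2 * Real.pi)⁻¹ * ∫ x : Torus, f (x, p.2)

/-- The average of an `L²` function is in `L²`, by the Cauchy-Schwarz inequality on the circle. -/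
theorem memLp_avgFun (f : L2) : MemLp (avgFun f) 2 (volume : Measure Dom) := by
  have hpi : (0 : ℝ) < 2 * Real.pi := Real.two_pi_pos
  have hf : MemLp f 2 ((volume : Measure Torus).prod (volume : Measure (ℝ × Torus))) := Lp.memLp f
  have hf2 := hf.integrable_sq
  have hgm : AEStronglyMeasurable (fun q : ℝ × Torus => ∫ x : Torus, f (x, q)) volume :=
    hf.aestronglyMeasurable.prod_swap.integral_prod_right'
  have hG : Integrable (fun q : ℝ × Torus => ∫ x : Torus, f (x, q) ^ 2) volume :=
    hf2.integral_prod_right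
  have hvol : (volume : Measure Torus).real univ = 2 * Real.pi := by
    simp [measureReal_def, AddCircle.measure_univ, Real.pi_pos.le]
  have hle : ∀ᵐ q : ℝ × Torus,
      (∫ x : Torus, f (x, q)) ^ 2 ≤ 2 * Real.pi * ∫ x : Torus, f (x, q) ^ 2 := by
    have h1 := hf.aestronglyMeasurable.prod_swap.prodMk_left
    have h2 := hf2.prod_left_ae
    filter_upwards [h1, h2] with q hq1 hq2
    have hm : MemLp (fun x : Torus => f (x, q)) 2 volume :=
      (memLp_two_iff_integrable_sq hq1).2 hq2
    have hi : Integrable (fun x : Torus => f (x, q)) volume := hm.integrable (by norm_num)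
    set c : ℝ := (∫ x : Torus, f (x, q)) / (2 * Real.pi) with hc
    have h0 : 0 ≤ ∫ x : Torus, (f (x, q) - c) ^ 2 := integral_nonneg fun _ => sq_nonneg _
    have h3 : ∫ x : Torus, (f (x, q) - c) ^ 2
        = (∫ x : Torus, f (x, q) ^ 2) - 2 * c * (∫ x : Torus, f (x, q)) + 2 * Real.pi * c ^ 2 := by
      have he : (fun x : Torus => (f (x, q) - c) ^ 2)
          = fun x : Torus => (f (x, q) ^ 2 - 2 * c * f (x, q)) + c ^ 2 := by
        funext x; ring
      have hi2 : Integrable (fun x : Torus => f (x, q) ^ 2 - 2 * c * f (x, q)) volume :=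
        hq2.sub (hi.const_mul _)
      rw [he, integral_add hi2 (integrable_const _),
        integral_sub hq2 (hi.const_mul _), integral_const_mul, integral_const, hvol, smul_eq_mul]
    have hI : (∫ x : Torus, f (x, q)) = 2 * Real.pi * c := by
      rw [hc]; field_simp
    rw [h3, hI] at h0
    rw [hI]
    nlinarith
  have hg2 : Integrable (fun q : ℝ × Torus => (∫ x : Torus, f (x, q)) ^ 2) volume := by
    refine (hG.const_mul (2 * Real.pi)).mono' (hgm.pow 2) ?_
    filter_upwards [hle] with q hq
    rwa [Real.norm_of_nonneg (sq_nonneg _)]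
  have hg3 : Integrable (fun p : Torus × ℝ × Torus => (∫ x : Torus, f (x, p.2)) ^ 2)
      ((volume : Measure Torus).prod volume) := hg2.comp_snd _
  have hgm' : AEStronglyMeasurable (fun p : Torus × ℝ × Torus => ∫ x : Torus, f (x, p.2))
      ((volume : Measure Torus).prod volume) := hgm.comp_snd
  exact ((memLp_two_iff_integrable_sq hgm').2 hg3).const_mul _

/-- The zero mode in `x`: `f₀(y, z) = (1/2π) ∫_𝕋 f(x, y, z) dx`. -/
def zeroMode (f : L2) : L2 := (memLp_avgFun f).toLp (avgFun f)

/-- The projection onto the non-zero modes in `x`: `f_≠ = f - f₀`. -/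
def nz (f : L2) : L2 := f - zeroMode f

/-- The projection of a vector field onto the non-zero modes in `x`, componentwise. -/
def nzV (u : Fin 3 → L2) : Fin 3 → L2 := fun i => nz (u i)

/-- `(b, u)` is a solution on `[0, ∞)`, with initial data `(b_in, u_in)`, of the linearized
isentropic compressible Navier-Stokes equations around the Couette flow `(y, 0, 0)`,

`∂ₜ b + y ∂ₓ b + div u = 0`,
`∂ₜ u + y ∂ₓ u + (u², 0, 0) + ε⁻² ∇b - μ Δu - (lam + μ) ∇ div u = 0`.

The solution is a curve in `H²` that is continuous in `L²`, and the equations hold in the sense of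
distributions on `𝕋 × ℝ × 𝕋`, at every time. The components `u¹, u², u³` of the velocity are
`u t 0, u t 1, u t 2`. -/
structure IsSolution (ε μ lam : ℝ) (bin : L2) (uin : Fin 3 → L2)
    (b : ℝ → L2) (u : ℝ → Fin 3 → L2) : Prop where
  init_b : b 0 = bin
  init_u : u 0 = uin
  memH2_b : ∀ t, 0 ≤ t → MemH2 (b t)
  memH2_u : ∀ t, 0 ≤ t → ∀ i, MemH2 (u t i)
  continuous_b : ContinuousOn b (Ici 0)
  continuous_u : ContinuousOn u (Ici 0)
  mass : ∀ φ : Dom → ℝ, IsTest φ → ∀ t, 0 ≤ t →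
    HasDerivWithinAt (fun s => ∫ p : Dom, b s p * φ p)
      (-∫ p : Dom, (p.2.1 * weakD 0 (b t) p + div (u t) p) * φ p) (Ici 0) t
  momentum : ∀ i : Fin 3, ∀ φ : Dom → ℝ, IsTest φ → ∀ t, 0 ≤ t →
    HasDerivWithinAt (fun s => ∫ p : Dom, u s i p * φ p)
      (-∫ p : Dom, (p.2.1 * weakD 0 (u t i) p + (if i = 0 then u t 1 p else 0)
        + weakD i (b t) p / ε ^ 2 - μ * lap (u t i) p
        - (lam + μ) * weakD i (div (u t)) p) * φ p) (Ici 0) t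

end Couette

end

/-!
The system has constant coefficients in `x` and `z`, and in the frame that moves with the shear the
coefficient `y` disappears, so that every frequency `(k, η, l)` evolves by its own linear ordinary
differential equation, with `∂ᵧ` replaced by `i (η - k s)`. All norms in the theorem are sums of
squares of Fourier multipliers, so by Plancherel it is enough to estimate one frequency with
`k ≠ 0`, uniformly in the frequency and in the viscosities; `|k| ≥ 1` because `k` is an integer.

*Estimate of a frequency.* Write `p = k² + (η - k s)² + l²` for the symbol of `-Δ`, `d` for the
divergence and `σ = μ ^ (1 / 3)`. The unknown `w = Δ u² - ∂ᵧ d + ∂ₓ b` (`goodC`) solves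
`w' = -μ p w + μ p ∂ₓ b`: all terms without a factor `μ` cancel. The pair `(d, b)` is an oscillator
with damping `(lam + 2 μ) p` and with the frequency `√p / ε`, which changes in time. The oscillation
hides the damping of `b`; it becomes visible in the energy after the correction of `d` by
`(p' / (4 p) - σ / 4) b` (`corr`, `modDiv`). The energy `modeEnergy`,
`|d + h b|² + p |b|² / ε² + |w|² / m²`, then grows at most at the rate
`(3 / 2) (p' / p)₊ - σ / 4`, up to rates that are integrable in time, uniformly in all parameters
(`energy_core`, `IsModeSol.energy_deriv_le`): these are the multiples of `|k| m / p`, and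
`σ / (1 + (σ (s - c))²)`, which replaces the dissipation near the critical time `c = η / k`.
Integration (`gronwall_forced`) costs the factor `(1 + t)³ e^{-σ t / 4}`, and `σ³ (1 + t)³` is
absorbed by a part of the exponential. This explains the weights `μ = σ³` in the theorem.
The quantities `Δ u³ - ∂_z d` and `Δ u¹ - ∂ₓ d` carry the additional growth rate `p' / p`, hence
`(1 + t)⁴` in total and the weight `μ ^ (4 / 3) = σ⁴` (`exists_mode_estimate_xz`).

For the second inequality the energy with `m = |k|` is multiplied by `(η - k t)²`
(`IsModeSol.freqY_sq_mul_le`). If the critical time is at most of the order of `t`, the weight costs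
`k² t²`, which is `σ⁻²` up to powers of `σ t`: this is the loss `μ ^ (-2 / 3)`. If the critical time
is far away, `p` is comparable to its initial value on `[0, t]` and the weight can be moved to the
data (`IsModeSol.energy_far_le`). The forcing of `Δ u¹ - ∂ₓ d` by `∂ᵧ d` is removed by subtracting
`∂ᵧ b` (`vortX`), and the terms that remain are controlled by the energy with the weight `σ⁻²`
(`IsModeSol.vortX_deriv_le`, `exists_mode_estimate_y`).

*Reduction to a frequency.* The Fourier series in `x` and `z` is an isometry of `L²` onto square
summable families in `L²(ℝ)` (`hasSum_norm_coef`) and turns a distributional solution into weak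
solutions of systems on the line (`IsSolution.isLineSol`). Multiplication by `e^{i k s y}` passes to
the moving frame; restricted to a bounded set of frequencies, the Fourier transform in `y` turns
the system into a linear equation in `L²` with bounded multiplication operators as coefficients.
Its solutions are unique, hence given fibrewise by the fundamental matrix (`exists_fibre_solution`),
and almost every fibre is a classical solution (`IsLineSol.ae_exists_mode`). The inequality of a
single frequency is integrated and summed in `quadSum_nz_le`.
-/

noncomputable section

/-! ### The ordinary differential equation of a single frequency -/

namespace Couette

open Complex (I)

/-- The vertical frequency `η - k s` in the moving frame, with `η = k c`. -/
def freqY (k c s : ℝ) : ℝ := -(k * (s - c))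

/-- The symbol `k² + (η - k s)² + l²` of `-Δ` in the moving frame. -/
def symb (k l c s : ℝ) : ℝ := k ^ 2 + freqY k c s ^ 2 + l ^ 2

/-- The Fourier coefficient of the divergence. -/
def divC (k l c : ℝ) (u₁ u₂ u₃ : ℝ → ℂ) (s : ℝ) : ℂ :=
  I * (k * u₁ s + freqY k c s * u₂ s + l * u₃ s)

/-- The linearized system at the frequency `(k, k c, l)` of the moving frame, on `[0, T]`. -/
structure IsModeSol (ε μ lam k l c T : ℝ) (b u₁ u₂ u₃ : ℝ → ℂ) : Prop where
  hb : ∀ s ∈ Icc 0 T, HasDerivAt b (-divC k l c u₁ u₂ u₃ s) s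
  h1 : ∀ s ∈ Icc 0 T, HasDerivAt u₁ (-u₂ s - I * k * b s / ε ^ 2 - μ * symb k l c s * u₁ s
    + (lam + μ) * (I * k * divC k l c u₁ u₂ u₃ s)) s
  h2 : ∀ s ∈ Icc 0 T, HasDerivAt u₂ (-(I * freqY k c s * b s / ε ^ 2) - μ * symb k l c s * u₂ s
    + (lam + μ) * (I * freqY k c s * divC k l c u₁ u₂ u₃ s)) s
  h3 : ∀ s ∈ Icc 0 T, HasDerivAt u₃ (-(I * l * b s / ε ^ 2) - μ * symb k l c s * u₃ s
    + (lam + μ) * (I * l * divC k l c u₁ u₂ u₃ s)) s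

/-- The coefficient of `Δ u² - ∂ᵧ div u + ∂ₓ b`. -/
def goodC (k l c : ℝ) (b u₁ u₂ u₃ : ℝ → ℂ) (s : ℝ) : ℂ :=
  -(symb k l c s * u₂ s) - I * freqY k c s * divC k l c u₁ u₂ u₃ s + I * k * b s

/-- The coefficient of `Δ u³ - ∂_z div u`. -/
def vortZ (k l c : ℝ) (u₁ u₂ u₃ : ℝ → ℂ) (s : ℝ) : ℂ :=
  -(symb k l c s * u₃ s) - I * l * divC k l c u₁ u₂ u₃ s

/-- The coefficient of `Δ u¹ - ∂ₓ div u - ∂ᵧ b`. Subtracting `∂ᵧ b` removes the forcing of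
`Δ u¹ - ∂ₓ div u` by `∂ᵧ div u`. -/
def vortX (k l c : ℝ) (b u₁ u₂ u₃ : ℝ → ℂ) (s : ℝ) : ℂ :=
  -(symb k l c s * u₁ s) - I * k * divC k l c u₁ u₂ u₃ s - I * freqY k c s * b s

/-- The logarithmic derivative of the symbol. -/
def logD (k l c s : ℝ) : ℝ := -(2 * k * freqY k c s) / symb k l c s

/-- The correction `h` that makes `|d + h b|² + p |b|² / ε²` grow at the rate `(3 / 2) p' / p`; the
constant part `-γ / 2` provides the damping of `b`. -/
def corr (γ k l c s : ℝ) : ℝ := logD k l c s / 4 - γ / 2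

/-- The corrected divergence `d + h b`. -/
def modDiv (γ k l c : ℝ) (b u₁ u₂ u₃ : ℝ → ℂ) (s : ℝ) : ℂ :=
  divC k l c u₁ u₂ u₃ s + corr γ k l c s * b s

variable {ε μ lam k l c T γ : ℝ} {b u₁ u₂ u₃ : ℝ → ℂ}

theorem symb_ge (k l c s : ℝ) : k ^ 2 ≤ symb k l c s := by
  unfold symb; nlinarith [sq_nonneg (freqY k c s), sq_nonneg l]

theorem symb_pos (hk : 1 ≤ k ^ 2) (s : ℝ) : 0 < symb k l c s :=
  lt_of_lt_of_le (by linarith) (symb_ge k l c s)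

theorem hasDerivAt_freqY (s : ℝ) : HasDerivAt (freqY k c) (-k) s := by
  unfold freqY
  simpa using (((hasDerivAt_id s).sub_const c).const_mul k).fun_neg

theorem hasDerivAt_symb (s : ℝ) :
    HasDerivAt (symb k l c) (-(2 * k * freqY k c s)) s := by
  unfold symb
  refine ((((hasDerivAt_freqY s).pow 2).const_add (k ^ 2)).add_const (l ^ 2)).congr_deriv ?_
  simp; ring

theorem hasDerivAt_logD (hk : 1 ≤ k ^ 2) (s : ℝ) :
    HasDerivAt (logD k l c) (2 * k ^ 2 / symb k l c s - logD k l c s ^ 2) s := by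
  have hp := symb_pos (l := l) (c := c) hk s
  refine ((((hasDerivAt_freqY (k := k) (c := c) s).const_mul (2 * k)).fun_neg).div
    (hasDerivAt_symb s) hp.ne').congr_deriv ?_
  unfold logD; field_simp

theorem hasDerivAt_corr (hk : 1 ≤ k ^ 2) (s : ℝ) :
    HasDerivAt (corr γ k l c) ((2 * k ^ 2 / symb k l c s - logD k l c s ^ 2) / 4) s := by
  unfold corr
  exact ((hasDerivAt_logD hk s).div_const 4).sub_const _

/-- The divergence is coupled to the density and, through the shear, to `u²`; the other components
drop out. -/
theorem IsModeSol.hasDerivAt_divC (h : IsModeSol ε μ lam k l c T b u₁ u₂ u₃) {s : ℝ}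
    (hs : s ∈ Icc 0 T) :
    HasDerivAt (divC k l c u₁ u₂ u₃) (-(2 * I * k * u₂ s) + symb k l c s * b s / ε ^ 2
      - (lam + 2 * μ) * symb k l c s * divC k l c u₁ u₂ u₃ s) s := by
  have hy := (hasDerivAt_freqY (k := k) (c := c) s).ofReal_comp
  refine ((((h.h1 s hs).const_mul (k : ℂ)).add (hy.mul (h.h2 s hs))).add
    ((h.h3 s hs).const_mul (l : ℂ))).const_mul I |>.congr_deriv ?_
  unfold divC symb
  push_cast
  ring_nf
  simp only [Complex.I_sq, Complex.I_pow_three]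
  ring

/-- The unknown `Δ u² - ∂ᵧ div u + ∂ₓ b` is only forced by the viscosity. -/
theorem IsModeSol.hasDerivAt_goodC (h : IsModeSol ε μ lam k l c T b u₁ u₂ u₃) {s : ℝ}
    (hs : s ∈ Icc 0 T) :
    HasDerivAt (goodC k l c b u₁ u₂ u₃) (-(μ * symb k l c s * goodC k l c b u₁ u₂ u₃ s)
      + μ * symb k l c s * (I * k * b s)) s := by
  have hy := (hasDerivAt_freqY (k := k) (c := c) s).ofReal_comp
  have hp := (hasDerivAt_symb (k := k) (l := l) (c := c) s).ofReal_comp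
  have hd := h.hasDerivAt_divC hs
  refine (((hp.mul (h.h2 s hs)).neg.sub ((hy.const_mul I).mul hd)).add
    ((h.hb s hs).const_mul (I * k))).congr_deriv ?_
  unfold goodC
  push_cast
  ring_nf
  simp only [Complex.I_sq]
  ring

theorem IsModeSol.hasDerivAt_vortZ (hk : 1 ≤ k ^ 2) (h : IsModeSol ε μ lam k l c T b u₁ u₂ u₃)
    {s : ℝ} (hs : s ∈ Icc 0 T) :
    HasDerivAt (vortZ k l c u₁ u₂ u₃) (-(μ * symb k l c s * vortZ k l c u₁ u₂ u₃ s)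
      + logD k l c s * vortZ k l c u₁ u₂ u₃ s
      + (2 * k * l / symb k l c s : ℝ) * (goodC k l c b u₁ u₂ u₃ s - I * k * b s)) s := by
  have hp := (hasDerivAt_symb (k := k) (l := l) (c := c) s).ofReal_comp
  have hd := h.hasDerivAt_divC hs
  have hp0 : (symb k l c s : ℂ) ≠ 0 := by exact_mod_cast (symb_pos hk s).ne'
  refine ((hp.mul (h.h3 s hs)).neg.sub (hd.const_mul (I * l))).congr_deriv ?_
  unfold goodC vortZ logD
  push_cast
  field_simp
  ring_nf
  simp only [Complex.I_sq]
  ring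

theorem IsModeSol.hasDerivAt_vortX (hk : 1 ≤ k ^ 2) (h : IsModeSol ε μ lam k l c T b u₁ u₂ u₃)
    {s : ℝ} (hs : s ∈ Icc 0 T) :
    HasDerivAt (vortX k l c b u₁ u₂ u₃) (-(μ * symb k l c s * vortX k l c b u₁ u₂ u₃ s)
      + logD k l c s * vortX k l c b u₁ u₂ u₃ s
      - (μ * symb k l c s * freqY k c s : ℝ) * (I * b s)
      + (logD k l c s * freqY k c s : ℝ) * (I * b s)
      - (1 - 2 * k ^ 2 / symb k l c s : ℝ) * (goodC k l c b u₁ u₂ u₃ s - I * k * b s)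
      + k * (I * b s)) s := by
  have hp := (hasDerivAt_symb (k := k) (l := l) (c := c) s).ofReal_comp
  have hy := (hasDerivAt_freqY (k := k) (c := c) s).ofReal_comp
  have hd := h.hasDerivAt_divC hs
  have hp0 : (symb k l c s : ℂ) ≠ 0 := by exact_mod_cast (symb_pos hk s).ne'
  refine (((hp.mul (h.h1 s hs)).neg.sub (hd.const_mul (I * k))).sub
    ((hy.const_mul I).mul (h.hb s hs))).congr_deriv ?_
  unfold goodC vortX logD
  push_cast
  field_simp
  ring_nf
  simp only [Complex.I_sq]
  ring

/-- In terms of the corrected divergence, `u²` is eliminated in favour of the good unknown. -/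
theorem IsModeSol.hasDerivAt_modDiv (hk : 1 ≤ k ^ 2) (h : IsModeSol ε μ lam k l c T b u₁ u₂ u₃)
    {s : ℝ} (hs : s ∈ Icc 0 T) :
    HasDerivAt (modDiv γ k l c b u₁ u₂ u₃)
      ((logD k l c s - (lam + 2 * μ) * symb k l c s - corr γ k l c s : ℝ)
          * modDiv γ k l c b u₁ u₂ u₃ s
        + (symb k l c s / ε ^ 2 + (-(logD k l c s - (lam + 2 * μ) * symb k l c s) * corr γ k l c s
          + (2 * k ^ 2 / symb k l c s - logD k l c s ^ 2) / 4 + corr γ k l c s ^ 2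
          + 2 * k ^ 2 / symb k l c s) : ℝ) * b s
        + (2 * k / symb k l c s : ℝ) * (I * goodC k l c b u₁ u₂ u₃ s)) s := by
  have hd := h.hasDerivAt_divC hs
  have hh := (hasDerivAt_corr (γ := γ) (l := l) (c := c) hk s).ofReal_comp
  have hp0 : (symb k l c s : ℂ) ≠ 0 := by exact_mod_cast (symb_pos hk s).ne'
  refine (hd.add (hh.mul (h.hb s hs))).congr_deriv ?_
  unfold modDiv goodC logD
  push_cast
  field_simp
  ring_nf
  simp only [Complex.I_sq]
  ring

end Couette

/-! ### Energy inequalities -/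

namespace Couette

open Complex (I)

/-- The derivative of `log (1 + max x 0 ^ 2)`, which dominates the logarithmic derivative of the
symbol and vanishes before the critical time. -/
def growth (x : ℝ) : ℝ := 2 * max x 0 / (1 + max x 0 ^ 2)

/-- The common part of all growth rates, at the time `x` after the critical time: the damping
`-σ / 4`, up to the integrable term `σ / (1 + σ² x²)` that makes up for the weak dissipation near
the critical time. -/
def dampRate (σ x : ℝ) : ℝ := σ / (1 + (σ * x) ^ 2) - σ / 4

theorem growth_nonneg (x : ℝ) : 0 ≤ growth x := by
  unfold growth; positivity

/-- Dissipation of size `σ (σ x)²` absorbs a growth of rate `3 σ / 4`. -/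
theorem le_dampRate {σ x t : ℝ} (hσ : 0 < σ) (ht : t ≤ 3 / 4) (u : ℝ) (hu : σ * (σ * x) ^ 2 ≤ u) :
    t * σ - u ≤ dampRate σ x := by
  unfold dampRate
  have h1 : 0 < 1 + (σ * x) ^ 2 := by positivity
  have h2 : 1 ≤ 1 / (1 + (σ * x) ^ 2) + (σ * x) ^ 2 := by
    rw [div_add' _ _ _ h1.ne', le_div_iff₀ h1]; nlinarith [sq_nonneg (σ * x)]
  have h3 : σ / (1 + (σ * x) ^ 2) = σ * (1 / (1 + (σ * x) ^ 2)) := by ring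
  rw [h3]
  nlinarith

set_option maxHeartbeats 1000000 in
/-- The algebraic inequality behind the energy estimate. Here `p` is the symbol, `r` its logarithmic
derivative, `ν = lam + 2 μ`, and `a`, `B`, `w` are the norms of the corrected divergence, of the
density and of the good unknown, with inner products `X`, `Y`, `Z`. The left side is the derivative
of the energy. The correction `r / 4 - σ / 4` distributes the growth `2 r a²` of the divergence and
the growth `r` of `p` evenly, and moves a part `σ / 2` of the damping from the divergence to the
density. -/
theorem energy_core {ε μ ν σ k m p r ρ G x a B w X Y Z : ℝ} (hε : 0 < ε) (hσ : 0 < σ)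
    (hμ : σ ^ 3 = μ) (hν : 4 / 3 * μ ≤ ν) (hν1 : ν ≤ 1) (hσε : σ * ε ≤ 1 / 4)
    (hσν : σ * ν * ε ^ 2 ≤ 1) (hp : 1 ≤ p) (hpx : x ^ 2 ≤ p)
    (hr : r ^ 2 ≤ 4 * (k ^ 2 / p)) (hrρ : r ≤ ρ) (hρ : 0 ≤ ρ) (hm : 0 < m) (hkm : k ^ 2 ≤ m ^ 2)
    (hG : |k| * m / p ≤ G) (ha : 0 ≤ a) (hB : 0 ≤ B)
    (hX : |X| ≤ a * B) (hY : |Y| ≤ a * w) (hZ : |Z| ≤ w * B) :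
    2 * ((r - ν * p - (r / 4 - σ / 2 / 2)) * a ^ 2
        + (p / ε ^ 2 + (-(r - ν * p) * (r / 4 - σ / 2 / 2)
          + (2 * k ^ 2 / p - r ^ 2) / 4 + (r / 4 - σ / 2 / 2) ^ 2 + 2 * k ^ 2 / p)) * X
        + 2 * k / p * Y)
      + (r * p / ε ^ 2 * B ^ 2 + p / ε ^ 2 * (2 * (-X + (r / 4 - σ / 2 / 2) * B ^ 2)))
      + 2 * (-(μ * p) * w ^ 2 + μ * p * (k * Z)) / m ^ 2
    ≤ (3 / 2 * ρ + (3 * ε + ε ^ 2 + 2) * G + dampRate σ x)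
      * (a ^ 2 + p / ε ^ 2 * B ^ 2 + w ^ 2 / m ^ 2) := by
  have hp0 : 0 < p := by linarith
  have hμ0 : 0 < μ := by rw [← hμ]; positivity
  have hν0 : 0 < ν := lt_of_lt_of_le (by positivity) hν
  set θ := k ^ 2 / p with hθ
  have hθ0 : 0 ≤ θ := by positivity
  have hθG : θ ≤ G := by
    refine le_trans ?_ hG
    rw [hθ]
    have : |k| ≤ m := abs_le_of_sq_le_sq hkm hm.le |> abs_le.1 |> fun h => abs_le.2 ⟨h.1, h.2⟩
    have h2 : k ^ 2 = |k| * |k| := by rw [← sq, sq_abs]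
    rw [h2]
    gcongr
  have hG0 : 0 ≤ G := hθ0.trans hθG
  set β := p / ε ^ 2 * B ^ 2 with hβ
  have hβ0 : 0 ≤ β := by positivity
  have hBβ : p * B ^ 2 = ε ^ 2 * β := by rw [hβ]; field_simp
  have hBβ' : B ^ 2 ≤ ε ^ 2 * β := by rw [← hBβ]; exact le_mul_of_one_le_left (sq_nonneg B) hp
  have hW0 : 0 ≤ w ^ 2 / m ^ 2 := by positivity
  set W := w ^ 2 / m ^ 2 with hW
  have h2aB : 2 * (a * B) ≤ ε * (a ^ 2 + β) := by
    have h1 : 2 * (a * B) * ε ≤ ε ^ 2 * a ^ 2 + B ^ 2 := by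
      linarith only [sq_nonneg (ε * a - B)]
    have h2 : 2 * (a * B) * ε ≤ ε * (a ^ 2 + β) * ε := by
      have : ε * (a ^ 2 + β) * ε = ε ^ 2 * a ^ 2 + ε ^ 2 * β := by ring
      linarith
    exact le_of_mul_le_mul_right h2 hε
  have haB0 : 0 ≤ a * B := by positivity
  -- the coefficient of the cross term that does not carry the viscosity
  set M := -(7 / 16) * r ^ 2 + 5 / 2 * θ + r * σ / 8 + σ ^ 2 / 16 with hM
  have hMabs : |M| ≤ 3 * θ + 3 / 32 * σ ^ 2 := by
    have e1 := sq_nonneg (2 * r - σ)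
    have e2 := sq_nonneg (2 * r + σ)
    have e3 := sq_nonneg r
    rw [abs_le, hM]; constructor <;> linarith only [e1, e2, e3, hr, hθ0, sq_nonneg σ]
  have hσ2ε : σ ^ 2 * ε ≤ σ / 4 := by
    have : σ ^ 2 * ε = σ * (σ * ε) := by ring
    rw [this]; linarith only [mul_le_mul_of_nonneg_left hσε hσ.le]
  have t1 : 2 * (M * X) ≤ (3 * ε * θ + 3 / 128 * σ) * (a ^ 2 + β) := by
    have h1 : M * X ≤ |M| * |X| := by rw [← abs_mul]; exact le_abs_self _
    have h2 : |M| * |X| ≤ (3 * θ + 3 / 32 * σ ^ 2) * (a * B) := by gcongr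
    have h3 : (3 * θ + 3 / 32 * σ ^ 2) * (2 * (a * B))
        ≤ (3 * θ + 3 / 32 * σ ^ 2) * (ε * (a ^ 2 + β)) := by gcongr
    have h4 : (σ ^ 2 * ε) * (a ^ 2 + β) ≤ σ / 4 * (a ^ 2 + β) := by gcongr
    linarith only [h1, h2, h3, h4]
  have t2 : 2 * (ν * p * (r / 4 - σ / 2 / 2) * X)
      ≤ ν * p * a ^ 2 + (ε ^ 2 / 2 * θ + σ / 8) * β := by
    have h1 : (r / 2 - σ / 2) * X ≤ a ^ 2 + (r ^ 2 / 8 + σ ^ 2 / 8) * B ^ 2 := by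
      have e1 : r / 2 * X ≤ |r| / 2 * (a * B) := by
        calc r / 2 * X ≤ |r / 2 * X| := le_abs_self _
          _ = |r| / 2 * |X| := by rw [abs_mul, abs_div]; norm_num
          _ ≤ _ := by gcongr
      have e2 : -(σ / 2) * X ≤ σ / 2 * (a * B) := by
        have h1 := mul_le_mul_of_nonneg_left ((neg_abs_le X).trans' (neg_le_neg hX)) hσ.le
        linarith
      have e3 : |r| / 2 * (a * B) ≤ a ^ 2 / 2 + r ^ 2 / 8 * B ^ 2 := by
        have := sq_abs r
        rw [← this]; linarith only [sq_nonneg (a - |r| / 2 * B)]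
      have e4 : σ / 2 * (a * B) ≤ a ^ 2 / 2 + σ ^ 2 / 8 * B ^ 2 := by
        linarith only [sq_nonneg (a - σ / 2 * B)]
      linarith only [e1, e2, e3, e4]
    have h2 : ν * p * ((r / 2 - σ / 2) * X)
        ≤ ν * p * (a ^ 2 + (r ^ 2 / 8 + σ ^ 2 / 8) * B ^ 2) := by gcongr
    have h3 : ν * p * ((r ^ 2 / 8 + σ ^ 2 / 8) * B ^ 2)
        = (r ^ 2 / 8) * ν * (ε ^ 2 * β) + σ / 8 * (σ * ν * ε ^ 2) * β := by
      rw [← hBβ]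
      have : σ / 8 * (σ * ν * ε ^ 2) * β = σ / 8 * σ * ν * (ε ^ 2 * β) := by ring
      rw [this, ← hBβ]; ring
    have h4 : (r ^ 2 / 8) * ν * (ε ^ 2 * β) ≤ (4 * θ / 8) * 1 * (ε ^ 2 * β) := by gcongr
    have h5 : σ / 8 * (σ * ν * ε ^ 2) * β ≤ σ / 8 * 1 * β := by gcongr
    linarith only [h1, h2, h3, h4, h5]
  have t3 : 2 * (2 * k / p * Y) ≤ 2 * G * (a ^ 2 + W) := by
    have h1 : k * Y ≤ |k| * (a * w) := by
      calc k * Y ≤ |k * Y| := le_abs_self _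
        _ = |k| * |Y| := abs_mul _ _
        _ ≤ _ := by gcongr
    have h2 : 2 * (a * w) ≤ m * (a ^ 2 + W) := by
      have : w ^ 2 = m ^ 2 * W := by rw [hW]; field_simp
      have h : 2 * (a * w) * m ≤ m * (a ^ 2 + W) * m := by
        have e1 := sq_nonneg (a * m - w)
        have e2 : m * (a ^ 2 + W) * m = m ^ 2 * a ^ 2 + m ^ 2 * W := by ring
        rw [e2, ← this]; linarith only [e1]
      exact le_of_mul_le_mul_right h hm
    calc 2 * (2 * k / p * Y) = 4 / p * (k * Y) := by ring
      _ ≤ 4 / p * (|k| * (a * w)) := by gcongr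
      _ = 2 * (|k| / p) * (2 * (a * w)) := by ring
      _ ≤ 2 * (|k| / p) * (m * (a ^ 2 + W)) := by gcongr
      _ = 2 * (|k| * m / p) * (a ^ 2 + W) := by ring
      _ ≤ _ := by gcongr
  have t4 : 2 * (-(μ * p) * w ^ 2 + μ * p * (k * Z)) / m ^ 2 ≤ -(μ * p) * W + σ / 16 * β := by
    have h1 : k * Z ≤ |k| * (w * B) := by
      calc k * Z ≤ |k * Z| := le_abs_self _
        _ = |k| * |Z| := abs_mul _ _
        _ ≤ _ := by gcongr
    have h2 : 2 * (|k| * (w * B)) ≤ w ^ 2 + m ^ 2 * B ^ 2 := by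
      have e1 := sq_nonneg (w - |k| * B)
      have e2 : |k| ^ 2 * B ^ 2 ≤ m ^ 2 * B ^ 2 := by rw [sq_abs]; gcongr
      linarith only [e1, e2]
    have h3 : μ * p * (2 * (k * Z)) ≤ μ * p * (w ^ 2 + m ^ 2 * B ^ 2) := by
      gcongr; linarith
    have h4 : 2 * (-(μ * p) * w ^ 2 + μ * p * (k * Z)) / m ^ 2
        ≤ (-(μ * p) * w ^ 2 + m ^ 2 * (μ * (p * B ^ 2))) / m ^ 2 := by
      gcongr; linarith only [h3]
    have h5 : (-(μ * p) * w ^ 2 + m ^ 2 * (μ * (p * B ^ 2))) / m ^ 2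
        = -(μ * p) * W + μ * (p * B ^ 2) := by rw [hW]; field_simp
    have h6 : μ * (p * B ^ 2) ≤ σ / 16 * β := by
      rw [hBβ, ← hμ]
      have : σ ^ 3 * (ε ^ 2 * β) = σ * (σ * ε) ^ 2 * β := by ring
      rw [this]
      have : (σ * ε) ^ 2 ≤ (1 / 4) ^ 2 := by gcongr
      calc σ * (σ * ε) ^ 2 * β ≤ σ * (1 / 4) ^ 2 * β := by gcongr
        _ = _ := by ring
    linarith only [h4, h5, h6]
  have hμp : σ * (σ * x) ^ 2 ≤ μ * p := by
    rw [← hμ]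
    calc σ * (σ * x) ^ 2 = σ ^ 3 * x ^ 2 := by ring
      _ ≤ _ := by gcongr
  have d1 : (67 / 128 * σ - ν * p) * a ^ 2 ≤ dampRate σ x * a ^ 2 := by
    refine mul_le_mul_of_nonneg_right (le_dampRate hσ (by norm_num) _ (hμp.trans ?_)) (sq_nonneg a)
    gcongr; linarith
  have d2 : -(37 / 128) * σ * β ≤ dampRate σ x * β := by
    refine mul_le_mul_of_nonneg_right ?_ hβ0
    unfold dampRate
    have : 0 ≤ σ / (1 + (σ * x) ^ 2) := by positivity
    linarith
  have d3 : -(μ * p) * W ≤ dampRate σ x * W := by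
    refine mul_le_mul_of_nonneg_right ?_ hW0
    have := le_dampRate hσ (t := 0) (by norm_num) _ hμp
    linarith
  have g1 : (3 * ε + ε ^ 2 / 2) * θ * (a ^ 2 + β) ≤ (3 * ε + ε ^ 2) * G * (a ^ 2 + β + W) := by
    have e1 : (3 * ε + ε ^ 2 / 2) * θ ≤ (3 * ε + ε ^ 2) * G :=
      mul_le_mul (by linarith only [sq_nonneg ε]) hθG hθ0 (by positivity)
    exact mul_le_mul e1 (by linarith only [hW0]) (by positivity) (by positivity)
  have g2 : 3 / 2 * r * (a ^ 2 + β) ≤ 3 / 2 * ρ * (a ^ 2 + β + W) := by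
    have : 3 / 2 * r * (a ^ 2 + β) ≤ 3 / 2 * ρ * (a ^ 2 + β) := by gcongr
    linarith [mul_nonneg hρ hW0]
  have g3 : 2 * G * (a ^ 2 + W) ≤ 2 * G * (a ^ 2 + β + W) := by gcongr; linarith
  have hpos : ε ^ 2 / 2 * θ * β ≤ ε ^ 2 / 2 * θ * (a ^ 2 + β) := by
    gcongr; linarith [sq_nonneg a]
  have key : 2 * ((r - ν * p - (r / 4 - σ / 2 / 2)) * a ^ 2
        + (p / ε ^ 2 + (-(r - ν * p) * (r / 4 - σ / 2 / 2)
          + (2 * k ^ 2 / p - r ^ 2) / 4 + (r / 4 - σ / 2 / 2) ^ 2 + 2 * k ^ 2 / p)) * X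
        + 2 * k / p * Y)
      + (r * p / ε ^ 2 * B ^ 2 + p / ε ^ 2 * (2 * (-X + (r / 4 - σ / 2 / 2) * B ^ 2)))
      = 3 / 2 * r * (a ^ 2 + β) + (σ / 2 - 2 * (ν * p)) * a ^ 2 - σ / 2 * β + 2 * (M * X)
        + 2 * (ν * p * (r / 4 - σ / 2 / 2) * X) + 2 * (2 * k / p * Y) := by
    rw [hβ, hM, hθ]; ring
  rw [key]
  clear_value M θ β W
  linarith only [t1, t2, t3, t4, d1, d2, d3, g1, g2, g3, hpos]

end Couette

namespace Couette

open Complex (I)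

/-- The conditions on the parameters, with `σ = μ ^ (1 / 3)`. -/
structure Admissible (ε μ lam σ : ℝ) : Prop where
  hε : 0 < ε
  hσ : 0 < σ
  hμ : σ ^ 3 = μ
  hν : 4 / 3 * μ ≤ lam + 2 * μ
  hν1 : lam + 2 * μ ≤ 1
  hσε : σ * ε ≤ 1 / 4
  hσν : σ * (lam + 2 * μ) * ε ^ 2 ≤ 1

theorem Admissible.mu_pos {ε μ lam σ : ℝ} (h : Admissible ε μ lam σ) : 0 < μ := by
  rw [← h.hμ]; exact pow_pos h.hσ 3

theorem Admissible.sigma_le_one {ε μ lam σ : ℝ} (h : Admissible ε μ lam σ) : σ ≤ 1 := by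
  have h1 : σ ^ 3 ≤ 1 := by rw [h.hμ]; linarith [h.hν, h.hν1]
  exact (pow_le_one_iff_of_nonneg h.hσ.le (by norm_num)).1 h1

theorem inner_ofReal_mul (z w : ℂ) (t : ℝ) : inner ℝ z ((t : ℂ) * w) = t * inner ℝ z w := by
  rw [← Complex.real_smul, real_inner_smul_right]

theorem abs_inner_I_mul_le (z w : ℂ) : |inner ℝ z (I * w)| ≤ ‖z‖ * ‖w‖ := by
  simpa using abs_real_inner_le_norm z (I * w)

/-- The energy of the density, the corrected divergence and the good unknown
`Δ u² - ∂ᵧ div u + ∂ₓ b`, which is weighted by `m⁻²`. -/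
def modeEnergy (ε γ k l c m : ℝ) (b u₁ u₂ u₃ : ℝ → ℂ) (s : ℝ) : ℝ :=
  ‖modDiv γ k l c b u₁ u₂ u₃ s‖ ^ 2 + symb k l c s / ε ^ 2 * ‖b s‖ ^ 2
    + ‖goodC k l c b u₁ u₂ u₃ s‖ ^ 2 / m ^ 2

variable {ε μ lam σ k l c T m G : ℝ} {b u₁ u₂ u₃ : ℝ → ℂ}

theorem modeEnergy_nonneg (hk : 1 ≤ k ^ 2) (γ s : ℝ) :
    0 ≤ modeEnergy ε γ k l c m b u₁ u₂ u₃ s := by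
  have := (symb_pos (l := l) (c := c) hk s).le
  unfold modeEnergy; positivity

theorem sq_le_symb (hk : 1 ≤ k ^ 2) (s : ℝ) : (s - c) ^ 2 ≤ symb k l c s := by
  have h : symb k l c s = k ^ 2 + k ^ 2 * (s - c) ^ 2 + l ^ 2 := by unfold symb freqY; ring
  rw [h]; nlinarith [sq_nonneg (s - c), sq_nonneg l]

theorem one_le_symb (hk : 1 ≤ k ^ 2) (s : ℝ) : 1 ≤ symb k l c s := hk.trans (symb_ge k l c s)

theorem logD_sq_le (hk : 1 ≤ k ^ 2) (s : ℝ) :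
    logD k l c s ^ 2 ≤ 4 * (k ^ 2 / symb k l c s) := by
  have hp := symb_pos (l := l) (c := c) hk s
  have hy : freqY k c s ^ 2 ≤ symb k l c s := by
    unfold symb; nlinarith [sq_nonneg k, sq_nonneg l]
  have e : logD k l c s ^ 2 = 4 * (k ^ 2 / symb k l c s) * (freqY k c s ^ 2 / symb k l c s) := by
    unfold logD; field_simp; ring
  rw [e]
  exact mul_le_of_le_one_right (by positivity) ((div_le_one hp).2 hy)

theorem logD_le_growth (hk : 1 ≤ k ^ 2) (s : ℝ) : logD k l c s ≤ growth (s - c) := by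
  have hp := symb_pos (l := l) (c := c) hk s
  have hs : symb k l c s = k ^ 2 * (1 + (s - c) ^ 2) + l ^ 2 := by unfold symb freqY; ring
  have e : logD k l c s = 2 * k ^ 2 * (s - c) / symb k l c s := by unfold logD freqY; ring
  rcases le_total (s - c) 0 with h | h
  · refine le_trans ?_ (growth_nonneg _)
    rw [e]
    exact div_nonpos_of_nonpos_of_nonneg (by nlinarith [sq_nonneg k]) hp.le
  · have : growth (s - c) = 2 * (s - c) / (1 + (s - c) ^ 2) := by
      unfold growth; rw [max_eq_left h]
    rw [this, e, div_le_div_iff₀ hp (by positivity), hs]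
    have : 0 ≤ (s - c) * l ^ 2 := by positivity
    linarith

/-- The energy inequality. The bound `G` of `|k| m / p` is left open, because `m` is chosen in three
different ways. -/
theorem IsModeSol.energy_deriv_le (ha : Admissible ε μ lam σ) (hk : 1 ≤ k ^ 2) (hm : 0 < m)
    (hkm : k ^ 2 ≤ m ^ 2) (h : IsModeSol ε μ lam k l c T b u₁ u₂ u₃) {s : ℝ} (hs : s ∈ Icc 0 T)
    (hG : |k| * m / symb k l c s ≤ G) :
    ∃ E', HasDerivAt (modeEnergy ε (σ / 2) k l c m b u₁ u₂ u₃) E' s ∧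
      E' ≤ (3 / 2 * growth (s - c) + (3 * ε + ε ^ 2 + 2) * G + dampRate σ (s - c))
        * modeEnergy ε (σ / 2) k l c m b u₁ u₂ u₃ s := by
  have hE := (h.hasDerivAt_modDiv (γ := σ / 2) hk hs).norm_sq
  have hb := (h.hb s hs).norm_sq
  have hw := (h.hasDerivAt_goodC hs).norm_sq
  have hp := (hasDerivAt_symb (k := k) (l := l) (c := c) s).div_const (ε ^ 2)
  refine ⟨_, (hE.add (hp.mul hb)).add (hw.div_const (m ^ 2)), ?_⟩
  have hp0 := symb_pos (l := l) (c := c) hk s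
  have key := energy_core (X := inner ℝ (modDiv (σ / 2) k l c b u₁ u₂ u₃ s) (b s))
    (Y := inner ℝ (modDiv (σ / 2) k l c b u₁ u₂ u₃ s) (I * goodC k l c b u₁ u₂ u₃ s))
    (Z := inner ℝ (goodC k l c b u₁ u₂ u₃ s) (I * b s))
    ha.hε ha.hσ ha.hμ ha.hν ha.hν1 ha.hσε ha.hσν (one_le_symb (l := l) (c := c) hk s)
    (sq_le_symb hk s) (logD_sq_le hk s)
    (logD_le_growth hk s) (growth_nonneg _) hm hkm hG (norm_nonneg _) (norm_nonneg _)
    (abs_real_inner_le_norm _ _) (abs_inner_I_mul_le _ _) (abs_inner_I_mul_le _ _)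
  refine le_trans (le_of_eq ?_) key
  have hdiv : -divC k l c u₁ u₂ u₃ s = -modDiv (σ / 2) k l c b u₁ u₂ u₃ s
      + (corr (σ / 2) k l c s : ℝ) * b s := by unfold modDiv; ring
  have hw' : -(μ * symb k l c s * goodC k l c b u₁ u₂ u₃ s) + μ * symb k l c s * (I * k * b s)
      = (-(μ * symb k l c s) : ℝ) * goodC k l c b u₁ u₂ u₃ s
        + (μ * symb k l c s * k : ℝ) * (I * b s) := by push_cast; ring
  have hr : -(2 * k * freqY k c s) = logD k l c s * symb k l c s := by
    unfold logD; field_simp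
  rw [hdiv, hw', hr]
  simp only [inner_add_right, inner_ofReal_mul, inner_neg_right, real_inner_self_eq_norm_sq]
  rw [real_inner_comm (modDiv (σ / 2) k l c b u₁ u₂ u₃ s) (b s)]
  unfold corr
  ring

/-- The difference of the good unknown and `∂ₓ b` is controlled by the energy. -/
theorem norm_goodC_sub_sq_le (hε : 0 < ε) (hk : 1 ≤ k ^ 2) (hm : 0 < m) (hkm : k ^ 2 ≤ m ^ 2)
    (γ s : ℝ) :
    ‖goodC k l c b u₁ u₂ u₃ s - I * k * b s‖ ^ 2
      ≤ 2 * (1 + ε ^ 2) * (m ^ 2 * modeEnergy ε γ k l c m b u₁ u₂ u₃ s) := by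
  have hp := one_le_symb (l := l) (c := c) hk s
  have h1 : ‖goodC k l c b u₁ u₂ u₃ s - I * k * b s‖
      ≤ ‖goodC k l c b u₁ u₂ u₃ s‖ + |k| * ‖b s‖ := by
    refine (norm_sub_le _ _).trans (le_of_eq ?_)
    simp
  set w := ‖goodC k l c b u₁ u₂ u₃ s‖ with hw
  set B := ‖b s‖
  have h2 : ‖goodC k l c b u₁ u₂ u₃ s - I * k * b s‖ ^ 2 ≤ 2 * w ^ 2 + 2 * (k ^ 2 * B ^ 2) := by
    have := pow_le_pow_left₀ (norm_nonneg _) h1 2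
    have e1 := sq_nonneg (w - |k| * B)
    have e2 : (|k| * B) ^ 2 = k ^ 2 * B ^ 2 := by rw [mul_pow, sq_abs]
    linarith
  have h3 : w ^ 2 + ε ^ 2 * (m ^ 2 * (symb k l c s / ε ^ 2 * B ^ 2))
      ≤ (1 + ε ^ 2) * (m ^ 2 * modeEnergy ε γ k l c m b u₁ u₂ u₃ s) := by
    have e : m ^ 2 * modeEnergy ε γ k l c m b u₁ u₂ u₃ s
        = m ^ 2 * ‖modDiv γ k l c b u₁ u₂ u₃ s‖ ^ 2
          + m ^ 2 * (symb k l c s / ε ^ 2 * B ^ 2) + w ^ 2 := by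
      unfold modeEnergy; field_simp; rfl
    rw [e]
    have i1 : 0 ≤ m ^ 2 * ‖modDiv γ k l c b u₁ u₂ u₃ s‖ ^ 2 := by positivity
    have i2 : 0 ≤ m ^ 2 * (symb k l c s / ε ^ 2 * B ^ 2) := by positivity
    have i3 : 0 ≤ ε ^ 2 * (m ^ 2 * ‖modDiv γ k l c b u₁ u₂ u₃ s‖ ^ 2) := by positivity
    have i4 : 0 ≤ ε ^ 2 * w ^ 2 := by positivity
    linarith
  have h4 : ε ^ 2 * (m ^ 2 * (symb k l c s / ε ^ 2 * B ^ 2)) = m ^ 2 * symb k l c s * B ^ 2 := by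
    field_simp
  have h5 : k ^ 2 * B ^ 2 ≤ m ^ 2 * symb k l c s * B ^ 2 := by
    gcongr
    nlinarith [sq_nonneg m]
  linarith

theorem diss_le_damp (ha : Admissible ε μ lam σ) (hk : 1 ≤ k ^ 2) (s : ℝ) {t : ℝ} (ht : t ≤ 3 / 4) :
    t * σ - μ * symb k l c s ≤ dampRate σ (s - c) := by
  refine le_dampRate ha.hσ ht _ ?_
  rw [← ha.hμ]
  have := ha.hσ
  calc σ * (σ * (s - c)) ^ 2 = σ ^ 3 * (s - c) ^ 2 := by ring
    _ ≤ _ := by gcongr; exact sq_le_symb hk s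

/-- `Δ u³ - ∂_z div u` is transported with the growth rate `p' / p` and forced by `Δ u² - ∂ᵧ div u`,
which the energy with `m² = k² + l²` controls. -/
theorem IsModeSol.vortZ_deriv_le (ha : Admissible ε μ lam σ) (hk : 1 ≤ k ^ 2) (hm : 0 < m)
    (hkm : m ^ 2 = k ^ 2 + l ^ 2) (h : IsModeSol ε μ lam k l c T b u₁ u₂ u₃) {s : ℝ}
    (hs : s ∈ Icc 0 T) (hG : |k| * m / symb k l c s ≤ G) :
    ∃ E', HasDerivAt (fun s => m ^ 2 * modeEnergy ε (σ / 2) k l c m b u₁ u₂ u₃ s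
        + ‖vortZ k l c u₁ u₂ u₃ s‖ ^ 2) E' s ∧
      E' ≤ (2 * growth (s - c) + (3 * ε + 5 * ε ^ 2 + 8) * G + dampRate σ (s - c))
        * (m ^ 2 * modeEnergy ε (σ / 2) k l c m b u₁ u₂ u₃ s
        + ‖vortZ k l c u₁ u₂ u₃ s‖ ^ 2) := by
  have hkm' : k ^ 2 ≤ m ^ 2 := by rw [hkm]; linarith [sq_nonneg l]
  obtain ⟨E', hE, hEle⟩ := h.energy_deriv_le ha hk hm hkm' hs hG
  have hv := (h.hasDerivAt_vortZ hk hs).norm_sq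
  refine ⟨_, (hE.const_mul (m ^ 2)).add hv, ?_⟩
  have hp0 := symb_pos (l := l) (c := c) hk s
  have hE0 := modeEnergy_nonneg (ε := ε) (l := l) (c := c) (m := m) (b := b) (u₁ := u₁) (u₂ := u₂)
    (u₃ := u₃) hk (σ / 2) s
  set E := modeEnergy ε (σ / 2) k l c m b u₁ u₂ u₃ s
  have hq := norm_goodC_sub_sq_le (l := l) (c := c) (b := b) (u₁ := u₁) (u₂ := u₂)
    (u₃ := u₃) ha.hε hk hm hkm' (σ / 2) s
  set q := goodC k l c b u₁ u₂ u₃ s - I * k * b s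
  set z := vortZ k l c u₁ u₂ u₃ s
  have hX : (2 * k * l / symb k l c s) * inner ℝ z q
      ≤ (2 * (|k| * m) / symb k l c s) * (‖z‖ * ‖q‖) := by
    have hl : |l| ≤ m :=
      abs_le.2 (abs_le_of_sq_le_sq' (by rw [hkm]; linarith [sq_nonneg k]) hm.le)
    calc _ ≤ |(2 * k * l / symb k l c s) * inner ℝ z q| := le_abs_self _
      _ = (2 * (|k| * |l|) / symb k l c s) * |inner ℝ z q| := by
        rw [abs_mul, abs_div, abs_mul, abs_mul, abs_of_pos hp0]; norm_num; left; ring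
      _ ≤ _ := by
        gcongr
        exact abs_real_inner_le_norm _ _
  have hX2 : (2 * (|k| * m) / symb k l c s) * (‖z‖ * ‖q‖)
      ≤ G * (‖z‖ ^ 2 + 2 * (1 + ε ^ 2) * (m ^ 2 * E)) := by
    have e : (2 * (|k| * m) / symb k l c s) * (‖z‖ * ‖q‖)
      = (|k| * m / symb k l c s) * (2 * (‖z‖ * ‖q‖)) := by ring
    rw [e]
    have h2 : 2 * (‖z‖ * ‖q‖) ≤ ‖z‖ ^ 2 + 2 * (1 + ε ^ 2) * (m ^ 2 * E) := by
      linarith [sq_nonneg (‖z‖ - ‖q‖)]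
    calc _ ≤ (|k| * m / symb k l c s) * (‖z‖ ^ 2 + 2 * (1 + ε ^ 2) * (m ^ 2 * E)) := by gcongr
      _ ≤ _ := by gcongr
  have hG0 : 0 ≤ G := le_trans (by positivity) hG
  have hd : (0 * σ - μ * symb k l c s) * ‖z‖ ^ 2 ≤ dampRate σ (s - c) * ‖z‖ ^ 2 :=
    mul_le_mul_of_nonneg_right (diss_le_damp ha hk s (by norm_num)) (sq_nonneg _)
  have hr : logD k l c s * ‖z‖ ^ 2 ≤ growth (s - c) * ‖z‖ ^ 2 :=
    mul_le_mul_of_nonneg_right (logD_le_growth hk s) (sq_nonneg _)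
  have hm2 : 0 ≤ m ^ 2 * E := by positivity
  have h1 := mul_le_mul_of_nonneg_left hEle (sq_nonneg m)
  have hin : -(μ * symb k l c s * z) + logD k l c s * z + (2 * k * l / symb k l c s : ℝ) * q
      = ((-(μ * symb k l c s) : ℝ) : ℂ) * z + (logD k l c s : ℝ) * z
        + (2 * k * l / symb k l c s : ℝ) * q := by
    push_cast; ring
  rw [hin]
  simp only [inner_add_right, inner_ofReal_mul, real_inner_self_eq_norm_sq]
  have i1 : 0 ≤ growth (s - c) * (m ^ 2 * E) := mul_nonneg (growth_nonneg _) hm2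
  have i2 : 0 ≤ G * (m ^ 2 * E) := mul_nonneg hG0 hm2
  have i3 : 0 ≤ G * ‖z‖ ^ 2 := by positivity
  have i4 : 0 ≤ ε * (G * ‖z‖ ^ 2) := mul_nonneg ha.hε.le i3
  have i5 : 0 ≤ ε ^ 2 * (G * ‖z‖ ^ 2) := mul_nonneg (sq_nonneg ε) i3
  have i6 : 0 ≤ μ * symb k l c s * ‖z‖ ^ 2 := by
    have := ha.mu_pos
    positivity
  linarith only [h1, hX, hX2, hd, hr, i1, i2, i3, i4, i5, i6]

/-- The forcing of `Δ u¹ - ∂ₓ div u - ∂ᵧ b` has no decaying coefficient. It is absorbed by half of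
the damping `σ / 4` after the energy has been given the weight `K / σ²`; the viscous term in `∂ᵧ b`
remains as a forcing. -/
theorem IsModeSol.vortX_deriv_le (ha : Admissible ε μ lam σ) (hk : 1 ≤ k ^ 2)
    (h : IsModeSol ε μ lam k l c T b u₁ u₂ u₃) {s : ℝ} (hs : s ∈ Icc 0 T) {G : ℝ}
    (hG : k ^ 2 / symb k l c s ≤ G) {K : ℝ} (hK : K = 256 * (8 * ε ^ 2 + 1)) :
    ∃ E', HasDerivAt (fun s => K / σ ^ 2 * (k ^ 2 * modeEnergy ε (σ / 2) k l c |k| b u₁ u₂ u₃ s)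
        + ‖vortX k l c b u₁ u₂ u₃ s‖ ^ 2) E' s ∧
      E' ≤ (2 * growth (s - c) + (3 * ε + ε ^ 2 + 2) * G + dampRate σ (s - c) + σ / 8)
        * (K / σ ^ 2 * (k ^ 2 * modeEnergy ε (σ / 2) k l c |k| b u₁ u₂ u₃ s)
        + ‖vortX k l c b u₁ u₂ u₃ s‖ ^ 2)
        + μ * freqY k c s ^ 2 * (symb k l c s * ‖b s‖ ^ 2) := by
  have hk0 : 0 < |k| := by
    rw [abs_pos]; rintro rfl; norm_num at hk
  obtain ⟨E', hE, hEle⟩ := h.energy_deriv_le ha hk hk0 (sq_abs k).ge hs (G := G)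
    (by rwa [← sq, sq_abs])
  have hv := (h.hasDerivAt_vortX hk hs).norm_sq
  refine ⟨_, ((hE.const_mul (k ^ 2)).const_mul (K / σ ^ 2)).add hv, ?_⟩
  have hp0 := symb_pos (l := l) (c := c) hk s
  have hp1 := one_le_symb (l := l) (c := c) hk s
  have hμ := ha.mu_pos
  have hσ := ha.hσ
  have hε := ha.hε
  have hE0 := modeEnergy_nonneg (ε := ε) (l := l) (c := c) (m := |k|) (b := b) (u₁ := u₁)
    (u₂ := u₂) (u₃ := u₃) hk (σ / 2) s
  have hG0 : 0 ≤ G := le_trans (by positivity) hG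
  -- the energy controls the forcing terms
  have hfE : 16 * (k ^ 2 * ‖b s‖ ^ 2) + ‖goodC k l c b u₁ u₂ u₃ s‖ ^ 2
      ≤ 2 * (8 * ε ^ 2 + 1) * (k ^ 2 * modeEnergy ε (σ / 2) k l c |k| b u₁ u₂ u₃ s) := by
    have e : k ^ 2 * modeEnergy ε (σ / 2) k l c |k| b u₁ u₂ u₃ s
        = k ^ 2 * ‖modDiv (σ / 2) k l c b u₁ u₂ u₃ s‖ ^ 2
          + k ^ 2 * (symb k l c s / ε ^ 2 * ‖b s‖ ^ 2) + ‖goodC k l c b u₁ u₂ u₃ s‖ ^ 2 := by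
      have : k ≠ 0 := abs_pos.1 hk0
      unfold modeEnergy; rw [sq_abs]; field_simp
    have e2 : ε ^ 2 * (symb k l c s / ε ^ 2 * ‖b s‖ ^ 2) = symb k l c s * ‖b s‖ ^ 2 := by
      field_simp
    have e3 : ‖b s‖ ^ 2 ≤ symb k l c s * ‖b s‖ ^ 2 :=
      le_mul_of_one_le_left (sq_nonneg _) hp1
    have e4 : k ^ 2 * ‖b s‖ ^ 2 ≤ k ^ 2 * (ε ^ 2 * (symb k l c s / ε ^ 2 * ‖b s‖ ^ 2)) := by
      rw [e2]; gcongr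
    rw [e]
    have i1 : 0 ≤ (8 * ε ^ 2 + 1) * (k ^ 2 * ‖modDiv (σ / 2) k l c b u₁ u₂ u₃ s‖ ^ 2) := by
      positivity
    have i2 : 0 ≤ k ^ 2 * (symb k l c s / ε ^ 2 * ‖b s‖ ^ 2) := by positivity
    have i3 : 0 ≤ ε ^ 2 * ‖goodC k l c b u₁ u₂ u₃ s‖ ^ 2 := by positivity
    linarith only [e4, i1, i2, i3, sq_nonneg ‖goodC k l c b u₁ u₂ u₃ s‖]
  set E := modeEnergy ε (σ / 2) k l c |k| b u₁ u₂ u₃ s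
  set w := goodC k l c b u₁ u₂ u₃ s
  set z := vortX k l c b u₁ u₂ u₃ s
  set B := ‖b s‖
  set y := freqY k c s
  set p := symb k l c s
  set r := logD k l c s with hr
  have hin : -(μ * p * z) + r * z - (μ * p * y : ℝ) * (I * b s) + (r * y : ℝ) * (I * b s)
      - (1 - 2 * k ^ 2 / p : ℝ) * (w - I * k * b s) + k * (I * b s)
      = ((-(μ * p) : ℝ) : ℂ) * z + (r : ℝ) * z + (-(μ * p * y) : ℝ) * (I * b s)
        + (r * y + (1 - 2 * k ^ 2 / p) * k + k : ℝ) * (I * b s)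
        + (-(1 - 2 * k ^ 2 / p) : ℝ) * w := by
    push_cast; ring
  rw [hin]
  simp only [inner_add_right, inner_ofReal_mul, real_inner_self_eq_norm_sq]
  have hXb := abs_inner_I_mul_le z (b s)
  have hXw := abs_real_inner_le_norm z w
  have hθ : |1 - 2 * k ^ 2 / p| ≤ 1 := by
    have : k ^ 2 / p ≤ 1 := (div_le_one hp0).2 (symb_ge k l c s)
    have h0 : 0 ≤ k ^ 2 / p := by positivity
    rw [abs_le]; constructor <;> rw [mul_div_assoc] <;> linarith
  have hry : |r * y| ≤ 2 * |k| := by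
    have e : r * y = -(2 * k) * (y ^ 2 / p) := by rw [hr]; unfold logD; ring
    have hy : y ^ 2 ≤ p := by simp only [p, symb]; nlinarith [sq_nonneg k, sq_nonneg l]
    rw [e, abs_mul, abs_neg, abs_mul, abs_of_nonneg (by positivity : 0 ≤ y ^ 2 / p)]
    have : y ^ 2 / p ≤ 1 := (div_le_one hp0).2 hy
    norm_num
    exact mul_le_of_le_one_right (by positivity) this
  have hcoef : |r * y + (1 - 2 * k ^ 2 / p) * k + k| ≤ 4 * |k| := by
    have h1 := abs_add_le (r * y + (1 - 2 * k ^ 2 / p) * k) k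
    have h2 := abs_add_le (r * y) ((1 - 2 * k ^ 2 / p) * k)
    have h3 : |(1 - 2 * k ^ 2 / p) * k| ≤ |k| := by
      rw [abs_mul]; exact mul_le_of_le_one_left (abs_nonneg k) hθ
    linarith
  have t1 : 2 * (-(μ * p * y) * inner ℝ z (I * b s))
      ≤ μ * p * ‖z‖ ^ 2 + μ * y ^ 2 * (p * B ^ 2) := by
    have h1 : -(μ * p * y) * inner ℝ z (I * b s) ≤ (μ * p * |y|) * (‖z‖ * B) := by
      calc _ ≤ |-(μ * p * y) * inner ℝ z (I * b s)| := le_abs_self _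
        _ = (μ * p * |y|) * |inner ℝ z (I * b s)| := by
          rw [abs_mul, abs_neg, abs_mul, abs_of_pos (mul_pos hμ hp0)]
        _ ≤ _ := by gcongr
    have h2 : (μ * p) * (2 * (‖z‖ * (|y| * B))) ≤ (μ * p) * (‖z‖ ^ 2 + y ^ 2 * B ^ 2) := by
      gcongr
      have := sq_abs y
      rw [← this]
      linarith [sq_nonneg (‖z‖ - |y| * B)]
    linarith
  have t2 : 2 * ((r * y + (1 - 2 * k ^ 2 / p) * k + k) * inner ℝ z (I * b s)
      + -(1 - 2 * k ^ 2 / p) * inner ℝ z w)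
      ≤ σ / 8 * ‖z‖ ^ 2 + σ / 8 * (K / σ ^ 2 * (k ^ 2 * E)) := by
    have h1 : (r * y + (1 - 2 * k ^ 2 / p) * k + k) * inner ℝ z (I * b s)
        ≤ 4 * |k| * (‖z‖ * B) := by
      calc _ ≤ |(r * y + (1 - 2 * k ^ 2 / p) * k + k) * inner ℝ z (I * b s)| := le_abs_self _
        _ ≤ _ := by rw [abs_mul]; gcongr
    have h2 : -(1 - 2 * k ^ 2 / p) * inner ℝ z w ≤ 1 * (‖z‖ * ‖w‖) := by
      calc _ ≤ |-(1 - 2 * k ^ 2 / p) * inner ℝ z w| := le_abs_self _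
        _ ≤ _ := by rw [abs_mul, abs_neg]; gcongr
    have h3 : 2 * (‖z‖ * (4 * |k| * B + ‖w‖))
        ≤ σ / 8 * ‖z‖ ^ 2 + 8 / σ * (4 * |k| * B + ‖w‖) ^ 2 := by
      have e : σ / 8 * ‖z‖ ^ 2 + 8 / σ * (4 * |k| * B + ‖w‖) ^ 2 - 2 * (‖z‖ * (4 * |k| * B + ‖w‖))
          = σ / 8 * (‖z‖ - 8 / σ * (4 * |k| * B + ‖w‖)) ^ 2 := by field_simp; ring
      have : 0 ≤ σ / 8 * (‖z‖ - 8 / σ * (4 * |k| * B + ‖w‖)) ^ 2 := by positivity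
      linarith
    have h4 : (4 * |k| * B + ‖w‖) ^ 2 ≤ 2 * (16 * (k ^ 2 * B ^ 2) + ‖w‖ ^ 2) := by
      rw [← sq_abs k]
      linarith [sq_nonneg (4 * |k| * B - ‖w‖)]
    have h5 : 8 / σ * (4 * |k| * B + ‖w‖) ^ 2
        ≤ 8 / σ * (2 * (2 * (8 * ε ^ 2 + 1) * (k ^ 2 * E))) := by
      gcongr; linarith
    have h6 : 8 / σ * (2 * (2 * (8 * ε ^ 2 + 1) * (k ^ 2 * E)))
        ≤ σ / 8 * (K / σ ^ 2 * (k ^ 2 * E)) := by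
      rw [hK]; apply le_of_eq; field_simp; ring
    linarith
  have hd : (0 * σ - μ * p) * ‖z‖ ^ 2 ≤ dampRate σ (s - c) * ‖z‖ ^ 2 :=
    mul_le_mul_of_nonneg_right (diss_le_damp ha hk s (by norm_num)) (sq_nonneg _)
  have hrg : r * ‖z‖ ^ 2 ≤ growth (s - c) * ‖z‖ ^ 2 :=
    mul_le_mul_of_nonneg_right (logD_le_growth hk s) (sq_nonneg _)
  have hKσ : 0 ≤ K / σ ^ 2 := by rw [hK]; positivity
  have hm2 : 0 ≤ K / σ ^ 2 * (k ^ 2 * E) := by positivity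
  have h1 := mul_le_mul_of_nonneg_left (mul_le_mul_of_nonneg_left hEle (sq_nonneg k)) hKσ
  have i1 : 0 ≤ growth (s - c) * (K / σ ^ 2 * (k ^ 2 * E)) := mul_nonneg (growth_nonneg _) hm2
  have i3 : 0 ≤ (3 * ε + ε ^ 2 + 2) * G * ‖z‖ ^ 2 := by positivity
  clear_value E w z B y p r
  linarith only [h1, t1, t2, hd, hrg, i1, i3]

end Couette

/-! ### Integration of the energy inequalities -/

namespace Couette

open Complex (I)

/-- Grönwall's inequality with a variable rate `R = Λ'` and a forcing that is bounded after
multiplication by the integrating factor. -/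
theorem gronwall_forced {f g Λ R : ℝ → ℝ} {T C : ℝ} (hT : 0 ≤ T)
    (hΛ : ∀ s ∈ Icc 0 T, HasDerivAt Λ (R s) s)
    (hf : ∀ s ∈ Icc 0 T, ∃ f', HasDerivAt f f' s ∧ f' ≤ R s * f s + g s)
    (hg : ∀ s ∈ Icc 0 T, g s * Real.exp (-(Λ s - Λ 0)) ≤ C) :
    f T ≤ Real.exp (Λ T - Λ 0) * (f 0 + C * T) := by
  have hder : ∀ s ∈ Icc 0 T, ∃ F', HasDerivAt
      (fun s => f s * Real.exp (-(Λ s - Λ 0)) - C * s) F' s ∧ F' ≤ 0 := by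
    intro s hs
    obtain ⟨f', hf', hle⟩ := hf s hs
    refine ⟨_, (hf'.mul (((hΛ s hs).sub_const (Λ 0)).fun_neg.exp)).sub
      ((hasDerivAt_id s).const_mul C), ?_⟩
    have h1 := hg s hs
    have h2 := mul_le_mul_of_nonneg_right hle (Real.exp_pos (-(Λ s - Λ 0))).le
    linarith
  have hanti : AntitoneOn (fun s => f s * Real.exp (-(Λ s - Λ 0)) - C * s) (Icc 0 T) := by
    refine antitoneOn_of_deriv_nonpos (convex_Icc 0 T) (fun s hs => ?_) (fun s hs => ?_)
      (fun s hs => ?_)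
    · obtain ⟨F', h, -⟩ := hder s hs
      exact h.continuousAt.continuousWithinAt
    · obtain ⟨F', h, -⟩ := hder s (interior_subset hs)
      exact h.differentiableAt.differentiableWithinAt
    · obtain ⟨F', h, h'⟩ := hder s (interior_subset hs)
      rw [h.deriv]; exact h'
  have h := hanti (left_mem_Icc.2 hT) (right_mem_Icc.2 hT) hT
  simp only [sub_self, neg_zero, Real.exp_zero, mul_one, mul_zero, sub_zero] at h
  have h3 : f T * Real.exp (-(Λ T - Λ 0)) ≤ f 0 + C * T := by linarith
  calc f T = Real.exp (Λ T - Λ 0) * (f T * Real.exp (-(Λ T - Λ 0))) := by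
        rw [mul_left_comm, ← Real.exp_add]; simp
    _ ≤ _ := by gcongr

theorem hasDerivAt_max_sq (x : ℝ) : HasDerivAt (fun x : ℝ => max x 0 ^ 2) (2 * max x 0) x := by
  rcases lt_trichotomy x 0 with h | rfl | h
  · rw [max_eq_right h.le, mul_zero]
    refine (hasDerivAt_const x (0 : ℝ)).congr_of_eventuallyEq ?_
    filter_upwards [Iio_mem_nhds h] with z hz
    rw [max_eq_right (le_of_lt hz)]; norm_num
  · rw [max_self, mul_zero]
    rw [hasDerivAt_iff_isLittleO]
    simp only [max_self, ne_eq, OfNat.ofNat_ne_zero, not_false_eq_true, zero_pow, sub_zero,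
      smul_zero]
    have h1 : (fun x : ℝ => max x 0 ^ 2) =O[nhds 0] fun x : ℝ => x ^ 2 := by
      refine Asymptotics.IsBigO.of_bound 1 (Filter.Eventually.of_forall fun z => ?_)
      rw [one_mul, Real.norm_of_nonneg (sq_nonneg (max z 0)),
        Real.norm_of_nonneg (sq_nonneg z)]
      rcases le_total z 0 with hz | hz
      · rw [max_eq_right hz, zero_pow two_ne_zero]; exact sq_nonneg z
      · rw [max_eq_left hz]
    exact h1.trans_isLittleO (by simpa using Asymptotics.isLittleO_pow_id (𝕜 := ℝ) one_lt_two)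
  · rw [max_eq_left h.le]
    have h1 : HasDerivAt (fun x : ℝ => x ^ 2) (2 * x) x := by simpa using hasDerivAt_pow 2 x
    refine h1.congr_of_eventuallyEq ?_
    filter_upwards [Ioi_mem_nhds h] with z hz
    rw [max_eq_left (le_of_lt hz)]

/-- The logarithm of the growth factor of the symbol after the critical time `c`. -/
def logGrowth (c s : ℝ) : ℝ := Real.log (1 + max (s - c) 0 ^ 2)

theorem hasDerivAt_logGrowth (c s : ℝ) : HasDerivAt (logGrowth c) (growth (s - c)) s := by
  have h := ((hasDerivAt_max_sq (s - c)).comp s ((hasDerivAt_id s).sub_const c)).const_add 1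
  have h2 := h.log (by simp only [Function.comp]; positivity)
  refine h2.congr_deriv ?_
  simp [growth]

theorem logGrowth_mono {c s t : ℝ} (h : s ≤ t) : logGrowth c s ≤ logGrowth c t := by
  unfold logGrowth; gcongr

/-- The growth factor that bounds `(p(s) / p(0))^{N / 2}` is at most of the order of `(1 + s)^N`,
whatever the critical time is. -/
theorem exp_logGrowth_le (N : ℕ) {c s : ℝ} (hs : 0 ≤ s) :
    Real.exp (N / 2 * (logGrowth c s - logGrowth c 0)) ≤ (2 * (1 + s)) ^ N := by
  have h0 : 0 < 1 + max (0 - c) 0 ^ 2 := by positivity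
  have key : 1 + max (s - c) 0 ^ 2 ≤ (2 * (1 + s)) ^ 2 * (1 + max (0 - c) 0 ^ 2) := by
    have h1 : max (s - c) 0 ≤ s + max (0 - c) 0 := by
      apply max_le
      · linarith [le_max_left (0 - c) 0]
      · linarith [le_max_right (0 - c) 0]
    have h2 : 0 ≤ max (s - c) 0 := le_max_right _ _
    have h3 : 0 ≤ max (0 - c) 0 := le_max_right _ _
    set X := max (0 - c) 0
    have h4 : max (s - c) 0 ^ 2 ≤ (s + X) ^ 2 := by gcongr
    nlinarith [sq_nonneg (s - X), mul_nonneg hs (sq_nonneg X),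
      mul_nonneg (sq_nonneg s) (sq_nonneg X)]
  have h5 : logGrowth c s - logGrowth c 0 ≤ 2 * Real.log (2 * (1 + s)) := by
    have := Real.log_le_log (by positivity) key
    rw [Real.log_mul (by positivity) h0.ne', Real.log_pow] at this
    unfold logGrowth; push_cast at this; linarith
  calc _ ≤ Real.exp (N / 2 * (2 * Real.log (2 * (1 + s)))) := by gcongr
    _ = Real.exp (N * Real.log (2 * (1 + s))) := by ring_nf
    _ = _ := by rw [Real.exp_nat_mul, Real.exp_log (by positivity)]

/-- The primitive of a growth rate. -/
def ratePrim (N : ℕ) (A ρ σ c : ℝ) (Γ : ℝ → ℝ) (s : ℝ) : ℝ :=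
  N / 2 * logGrowth c s + A * Γ s + Real.arctan (σ * (s - c)) - ρ * s

theorem hasDerivAt_ratePrim (N : ℕ) (A ρ σ c : ℝ) {Γ : ℝ → ℝ} {G s : ℝ} (hΓ : HasDerivAt Γ G s) :
    HasDerivAt (ratePrim N A ρ σ c Γ)
      (N / 2 * growth (s - c) + A * G + σ / (1 + (σ * (s - c)) ^ 2) - ρ) s := by
  have h1 := (hasDerivAt_logGrowth c s).const_mul ((N : ℝ) / 2)
  have h2 := (((hasDerivAt_id s).sub_const c).const_mul σ).arctan
  refine (((h1.add (hΓ.const_mul A)).add h2).sub ((hasDerivAt_id s).const_mul ρ)).congr_deriv ?_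
  simp [div_eq_inv_mul]

theorem exp_ratePrim_le (N : ℕ) {A ρ σ c g₀ s : ℝ} {Γ : ℝ → ℝ} (hA : 0 ≤ A)
    (hΓ : Γ s - Γ 0 ≤ g₀) :
    Real.exp (ratePrim N A ρ σ c Γ s - ratePrim N A ρ σ c Γ 0)
      ≤ Real.exp (A * g₀ + Real.pi)
        * (Real.exp (N / 2 * (logGrowth c s - logGrowth c 0)) * Real.exp (-(ρ * s))) := by
  rw [← Real.exp_add, ← Real.exp_add]
  apply Real.exp_le_exp.2
  have h1 := Real.arctan_lt_pi_div_two (σ * (s - c))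
  have h2 := Real.neg_pi_div_two_lt_arctan (σ * (0 - c))
  have h3 := mul_le_mul_of_nonneg_left hΓ hA
  unfold ratePrim
  linarith

theorem exp_neg_ratePrim_le (N : ℕ) {A ρ σ c s : ℝ} {Γ : ℝ → ℝ} (hA : 0 ≤ A)
    (hΓ : Γ 0 ≤ Γ s) :
    Real.exp (-(ratePrim N A ρ σ c Γ s - ratePrim N A ρ σ c Γ 0))
      ≤ Real.exp Real.pi
        * (Real.exp (-(N / 2 * (logGrowth c s - logGrowth c 0))) * Real.exp (ρ * s)) := by
  rw [← Real.exp_add, ← Real.exp_add]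
  apply Real.exp_le_exp.2
  have h1 := Real.neg_pi_div_two_lt_arctan (σ * (s - c))
  have h2 := Real.arctan_lt_pi_div_two (σ * (0 - c))
  have h3 := mul_le_mul_of_nonneg_left hΓ hA
  unfold ratePrim
  linarith

/-- Exponential decay absorbs polynomial growth. -/
theorem one_add_pow_le_exp (N : ℕ) {a τ : ℝ} (ha : 0 < a) (hτ : 0 ≤ τ) :
    (1 + τ) ^ N ≤ (1 + N / a) ^ N * Real.exp (a * τ) := by
  rcases Nat.eq_zero_or_pos N with rfl | hN
  · simpa using Real.one_le_exp (by positivity : 0 ≤ a * τ)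
  have hN' : (0 : ℝ) < N := by exact_mod_cast hN
  have h1 : 1 + τ ≤ (1 + N / a) * Real.exp (a * τ / N) := by
    have h := Real.add_one_le_exp (a * τ / N)
    calc 1 + τ ≤ (1 + N / a) * (a * τ / N + 1) := by
          have e : (1 + N / a) * (a * τ / N + 1) = 1 + τ + (a * τ / N + N / a) := by
            field_simp; ring
          have : 0 ≤ a * τ / N + N / a := by positivity
          rw [e]; linarith
      _ ≤ _ := by gcongr
  calc (1 + τ) ^ N ≤ ((1 + N / a) * Real.exp (a * τ / N)) ^ N := by gcongr
    _ = _ := by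
      rw [mul_pow, ← Real.exp_nat_mul]; congr 2; field_simp

variable {ε μ lam σ k l c T t m G : ℝ} {b u₁ u₂ u₃ : ℝ → ℂ}

/-- A primitive of `|k| √(k² + l²) / p`. It is bounded, uniformly in the frequency. -/
def ghostPrim (k l c s : ℝ) : ℝ := Real.arctan (|k| * (s - c) / √(k ^ 2 + l ^ 2))

theorem hasDerivAt_ghostPrim (hk : 1 ≤ k ^ 2) (s : ℝ) :
    HasDerivAt (ghostPrim k l c) (|k| * √(k ^ 2 + l ^ 2) / symb k l c s) s := by
  have hp := symb_pos (l := l) (c := c) hk s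
  have hm : 0 < √(k ^ 2 + l ^ 2) := Real.sqrt_pos.2 (by nlinarith [sq_nonneg l])
  have hm2 : √(k ^ 2 + l ^ 2) ^ 2 = k ^ 2 + l ^ 2 := Real.sq_sqrt (by positivity)
  have hs : symb k l c s = √(k ^ 2 + l ^ 2) ^ 2 + |k| ^ 2 * (s - c) ^ 2 := by
    rw [hm2, sq_abs]; unfold symb freqY; ring
  have h := ((((hasDerivAt_id s).sub_const c).const_mul |k|).div_const √(k ^ 2 + l ^ 2)).arctan
  refine h.congr_deriv ?_
  rw [hs] at hp ⊢
  simp only [id]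
  have h0 : 0 < 1 + (|k| * (s - c) / √(k ^ 2 + l ^ 2)) ^ 2 := by positivity
  field_simp

theorem ghostPrim_sub_le (k l c s s' : ℝ) : ghostPrim k l c s - ghostPrim k l c s' ≤ Real.pi := by
  unfold ghostPrim
  have h1 := Real.arctan_lt_pi_div_two (|k| * (s - c) / √(k ^ 2 + l ^ 2))
  have h2 := Real.neg_pi_div_two_lt_arctan (|k| * (s' - c) / √(k ^ 2 + l ^ 2))
  linarith

theorem ghostPrim_mono (k l c : ℝ) {s s' : ℝ} (h : s ≤ s') :
    ghostPrim k l c s ≤ ghostPrim k l c s' := by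
  unfold ghostPrim
  apply Real.arctan_strictMono.monotone
  gcongr

theorem IsModeSol.energy_le (ha : Admissible ε μ lam σ) (hk : 1 ≤ k ^ 2) (hm : 0 < m)
    (hkm : k ^ 2 ≤ m ^ 2) (h : IsModeSol ε μ lam k l c t b u₁ u₂ u₃) (ht : 0 ≤ t)
    {Γ gh : ℝ → ℝ} {g₀ : ℝ} (hΓ : ∀ s ∈ Icc 0 t, HasDerivAt Γ (gh s) s)
    (hgh : ∀ s ∈ Icc 0 t, |k| * m / symb k l c s ≤ gh s) (hg₀ : Γ t - Γ 0 ≤ g₀) :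
    modeEnergy ε (σ / 2) k l c m b u₁ u₂ u₃ t
      ≤ Real.exp ((3 * ε + ε ^ 2 + 2) * g₀ + Real.pi)
        * (Real.exp ((3 : ℕ) / 2 * (logGrowth c t - logGrowth c 0)) * Real.exp (-(σ / 4 * t)))
        * modeEnergy ε (σ / 2) k l c m b u₁ u₂ u₃ 0 := by
  have hε := ha.hε
  have h1 := gronwall_forced (f := modeEnergy ε (σ / 2) k l c m b u₁ u₂ u₃) (g := fun _ => 0)
    (C := 0) ht (fun s hs => hasDerivAt_ratePrim 3 (3 * ε + ε ^ 2 + 2) (σ / 4) σ c (hΓ s hs))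
    (fun s hs => by
      obtain ⟨E', hE, hle⟩ := h.energy_deriv_le ha hk hm hkm hs (hgh s hs)
      refine ⟨E', hE, hle.trans (le_of_eq ?_)⟩
      unfold dampRate; push_cast; ring) (by simp)
  rw [zero_mul, add_zero] at h1
  refine h1.trans ?_
  have hE0 := modeEnergy_nonneg (ε := ε) (l := l) (c := c) (m := m) (b := b) (u₁ := u₁) (u₂ := u₂)
    (u₃ := u₃) hk (σ / 2) 0
  gcongr
  exact exp_ratePrim_le 3 (by positivity) hg₀

theorem IsModeSol.vortZ_le (ha : Admissible ε μ lam σ) (hk : 1 ≤ k ^ 2)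
    (h : IsModeSol ε μ lam k l c t b u₁ u₂ u₃) (ht : 0 ≤ t) :
    (k ^ 2 + l ^ 2) * modeEnergy ε (σ / 2) k l c √(k ^ 2 + l ^ 2) b u₁ u₂ u₃ t
        + ‖vortZ k l c u₁ u₂ u₃ t‖ ^ 2
      ≤ Real.exp ((3 * ε + 5 * ε ^ 2 + 8) * Real.pi + Real.pi)
        * (Real.exp ((4 : ℕ) / 2 * (logGrowth c t - logGrowth c 0)) * Real.exp (-(σ / 4 * t)))
        * ((k ^ 2 + l ^ 2) * modeEnergy ε (σ / 2) k l c √(k ^ 2 + l ^ 2) b u₁ u₂ u₃ 0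
        + ‖vortZ k l c u₁ u₂ u₃ 0‖ ^ 2) := by
  have hε := ha.hε
  have hm : 0 < √(k ^ 2 + l ^ 2) := Real.sqrt_pos.2 (by nlinarith [sq_nonneg l])
  have hm2 : √(k ^ 2 + l ^ 2) ^ 2 = k ^ 2 + l ^ 2 := Real.sq_sqrt (by positivity)
  have h1 := gronwall_forced (f := fun s => √(k ^ 2 + l ^ 2) ^ 2
        * modeEnergy ε (σ / 2) k l c √(k ^ 2 + l ^ 2) b u₁ u₂ u₃ s
        + ‖vortZ k l c u₁ u₂ u₃ s‖ ^ 2) (g := fun _ => 0)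
    (C := 0) ht (fun s _ => hasDerivAt_ratePrim 4 (3 * ε + 5 * ε ^ 2 + 8) (σ / 4) σ c
      (hasDerivAt_ghostPrim hk s))
    (fun s hs => by
      obtain ⟨E', hE, hle⟩ := h.vortZ_deriv_le ha hk hm hm2 hs le_rfl
      refine ⟨E', hE, hle.trans (le_of_eq ?_)⟩
      unfold dampRate; push_cast; ring) (by simp)
  rw [zero_mul, add_zero, hm2] at h1
  refine h1.trans ?_
  have hE0 := modeEnergy_nonneg (ε := ε) (l := l) (c := c) (m := √(k ^ 2 + l ^ 2)) (b := b)
    (u₁ := u₁) (u₂ := u₂) (u₃ := u₃) hk (σ / 2) 0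
  gcongr
  exact exp_ratePrim_le 4 (by positivity) (ghostPrim_sub_le _ _ _ _ _)

end Couette

/-! ### The first estimate of a single frequency -/

namespace Couette

open Complex (I)

variable {ε μ lam σ k l c T t m G : ℝ} {b u₁ u₂ u₃ : ℝ → ℂ}

/-- The coefficient of `Δ u² - ∂ᵧ div u`. -/
def vortY (k l c : ℝ) (u₁ u₂ u₃ : ℝ → ℂ) (s : ℝ) : ℂ :=
  -(symb k l c s * u₂ s) - I * freqY k c s * divC k l c u₁ u₂ u₃ s

/-- The coefficient of `Δ u¹ - ∂ₓ div u`. -/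
def vortX' (k l c : ℝ) (u₁ u₂ u₃ : ℝ → ℂ) (s : ℝ) : ℂ :=
  -(symb k l c s * u₁ s) - I * k * divC k l c u₁ u₂ u₃ s

theorem norm_add_sq_le_two (z w : ℂ) : ‖z + w‖ ^ 2 ≤ 2 * ‖z‖ ^ 2 + 2 * ‖w‖ ^ 2 := by
  have := pow_le_pow_left₀ (norm_nonneg _) (norm_add_le z w) 2
  nlinarith [sq_nonneg (‖z‖ - ‖w‖)]

theorem norm_sub_sq_le_two (z w : ℂ) : ‖z - w‖ ^ 2 ≤ 2 * ‖z‖ ^ 2 + 2 * ‖w‖ ^ 2 := by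
  have := norm_add_sq_le_two z (-w)
  rwa [norm_neg, ← sub_eq_add_neg] at this

theorem corr_sq_le_one (hσ : 0 < σ) (hσ1 : σ ≤ 1) (hk : 1 ≤ k ^ 2) (s : ℝ) :
    corr (σ / 2) k l c s ^ 2 ≤ 1 := by
  have h1 := logD_sq_le (l := l) (c := c) hk s
  have h2 : k ^ 2 / symb k l c s ≤ 1 := (div_le_one (symb_pos hk s)).2 (symb_ge k l c s)
  unfold corr
  nlinarith [sq_nonneg (logD k l c s / 4 + σ / 4)]

theorem norm_sq_b_le (hε : 0 < ε) (hk : 1 ≤ k ^ 2) (s : ℝ) :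
    ‖b s‖ ^ 2 ≤ ε ^ 2 * (symb k l c s / ε ^ 2 * ‖b s‖ ^ 2) := by
  have : ε ^ 2 * (symb k l c s / ε ^ 2 * ‖b s‖ ^ 2) = symb k l c s * ‖b s‖ ^ 2 := by field_simp
  rw [this]
  exact le_mul_of_one_le_left (sq_nonneg _) (one_le_symb hk s)

theorem norm_sq_corr_mul_le (hε : 0 < ε) (hσ : 0 < σ) (hσ1 : σ ≤ 1) (hk : 1 ≤ k ^ 2) (s : ℝ) :
    ‖(corr (σ / 2) k l c s : ℂ) * b s‖ ^ 2 ≤ ε ^ 2 * (symb k l c s / ε ^ 2 * ‖b s‖ ^ 2) := by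
  rw [norm_mul, mul_pow, Complex.norm_real, Real.norm_eq_abs, sq_abs]
  exact (mul_le_of_le_one_left (sq_nonneg _) (corr_sq_le_one hσ hσ1 hk s)).trans
    (norm_sq_b_le hε hk s)

theorem norm_sq_divC_le (hε : 0 < ε) (hσ : 0 < σ) (hσ1 : σ ≤ 1) (hk : 1 ≤ k ^ 2) (s : ℝ) :
    ‖divC k l c u₁ u₂ u₃ s‖ ^ 2 ≤ 2 * ‖modDiv (σ / 2) k l c b u₁ u₂ u₃ s‖ ^ 2
      + 2 * ε ^ 2 * (symb k l c s / ε ^ 2 * ‖b s‖ ^ 2) := by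
  have h : divC k l c u₁ u₂ u₃ s = modDiv (σ / 2) k l c b u₁ u₂ u₃ s
      - (corr (σ / 2) k l c s : ℂ) * b s := by unfold modDiv; ring
  rw [h]
  refine (norm_sub_sq_le_two _ _).trans ?_
  linarith [norm_sq_corr_mul_le (l := l) (c := c) (b := b) hε hσ hσ1 hk s]

theorem norm_sq_modDiv_le (hε : 0 < ε) (hσ : 0 < σ) (hσ1 : σ ≤ 1) (hk : 1 ≤ k ^ 2) (s : ℝ) :
    ‖modDiv (σ / 2) k l c b u₁ u₂ u₃ s‖ ^ 2 ≤ 2 * ‖divC k l c u₁ u₂ u₃ s‖ ^ 2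
      + 2 * ε ^ 2 * (symb k l c s / ε ^ 2 * ‖b s‖ ^ 2) := by
  unfold modDiv
  refine (norm_add_sq_le_two _ _).trans ?_
  linarith [norm_sq_corr_mul_le (l := l) (c := c) (b := b) hε hσ hσ1 hk s]

theorem norm_sq_goodC_le (hε : 0 < ε) (hk : 1 ≤ k ^ 2) (s : ℝ) :
    ‖goodC k l c b u₁ u₂ u₃ s‖ ^ 2 ≤ 4 * (symb k l c s ^ 2 * ‖u₂ s‖ ^ 2)
      + 4 * (freqY k c s ^ 2 * ‖divC k l c u₁ u₂ u₃ s‖ ^ 2)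
      + 2 * ε ^ 2 * (k ^ 2 * (symb k l c s / ε ^ 2 * ‖b s‖ ^ 2)) := by
  have h1 := norm_add_sq_le_two (-(symb k l c s * u₂ s) - I * freqY k c s * divC k l c u₁ u₂ u₃ s)
    (I * k * b s)
  have h2 := norm_sub_sq_le_two (-(symb k l c s * u₂ s)) (I * freqY k c s * divC k l c u₁ u₂ u₃ s)
  have h3 := mul_le_mul_of_nonneg_left (norm_sq_b_le (l := l) (c := c) (b := b) hε hk s)
    (sq_nonneg k)
  simp only [norm_neg, norm_mul, Complex.norm_I, one_mul, Complex.norm_real, Real.norm_eq_abs,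
    mul_pow, sq_abs] at h1 h2
  unfold goodC
  linarith

theorem norm_sq_vortZ_le (s : ℝ) :
    ‖vortZ k l c u₁ u₂ u₃ s‖ ^ 2 ≤ 2 * (symb k l c s ^ 2 * ‖u₃ s‖ ^ 2)
      + 2 * (l ^ 2 * ‖divC k l c u₁ u₂ u₃ s‖ ^ 2) := by
  have h2 := norm_sub_sq_le_two (-(symb k l c s * u₃ s)) (I * l * divC k l c u₁ u₂ u₃ s)
  simp only [norm_neg, norm_mul, Complex.norm_I, one_mul, Complex.norm_real, Real.norm_eq_abs,
    mul_pow, sq_abs] at h2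
  exact h2

/-- The initial value of the energy, in terms of the data. -/
theorem modeEnergy_le (hε : 0 < ε) (hσ : 0 < σ) (hσ1 : σ ≤ 1) (hk : 1 ≤ k ^ 2) (hm : 0 < m)
    (hkm : k ^ 2 ≤ m ^ 2) (s : ℝ) :
    m ^ 2 * modeEnergy ε (σ / 2) k l c m b u₁ u₂ u₃ s
      ≤ (4 + 4 * ε ^ 2) * (m ^ 2 * (symb k l c s / ε ^ 2 * ‖b s‖ ^ 2)
        + (m ^ 2 + freqY k c s ^ 2) * ‖divC k l c u₁ u₂ u₃ s‖ ^ 2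
        + symb k l c s ^ 2 * ‖u₂ s‖ ^ 2) := by
  have hp := symb_pos (l := l) (c := c) hk s
  have e : m ^ 2 * modeEnergy ε (σ / 2) k l c m b u₁ u₂ u₃ s
      = m ^ 2 * ‖modDiv (σ / 2) k l c b u₁ u₂ u₃ s‖ ^ 2
        + m ^ 2 * (symb k l c s / ε ^ 2 * ‖b s‖ ^ 2) + ‖goodC k l c b u₁ u₂ u₃ s‖ ^ 2 := by
    unfold modeEnergy; field_simp
  rw [e]
  have h1 := mul_le_mul_of_nonneg_left (norm_sq_modDiv_le (l := l) (c := c) (b := b) (u₁ := u₁)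
    (u₂ := u₂) (u₃ := u₃) hε hσ hσ1 hk s) (sq_nonneg m)
  have h2 := norm_sq_goodC_le (l := l) (c := c) (b := b) (u₁ := u₁) (u₂ := u₂) (u₃ := u₃) hε hk s
  set β := symb k l c s / ε ^ 2 * ‖b s‖ ^ 2
  set D := ‖divC k l c u₁ u₂ u₃ s‖ ^ 2
  set U := symb k l c s ^ 2 * ‖u₂ s‖ ^ 2
  have hβ : 0 ≤ β := by positivity
  have i0 : ε ^ 2 * (k ^ 2 * β) ≤ ε ^ 2 * (m ^ 2 * β) := by gcongr
  have i1 : 0 ≤ m ^ 2 * β := by positivity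
  have i2 : 0 ≤ m ^ 2 * D := by positivity
  have i3 : 0 ≤ ε ^ 2 * ((m ^ 2 + freqY k c s ^ 2) * D) := by positivity
  have i4 : 0 ≤ ε ^ 2 * U := by positivity
  linarith

/-- Combined effect of the growth `(1 + t)^N` and of the damping, in the form `σ ^ N · growth`. -/
theorem sigma_pow_mul_le (N M : ℕ) {a a' : ℝ} (haa : a' < a) (hσ : 0 < σ) (hσ1 : σ ≤ 1)
    (ht : 0 ≤ t) :
    σ ^ N * (2 * (1 + t)) ^ N * (1 + σ * t) ^ M * Real.exp (-(a * (σ * t)))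
      ≤ 2 ^ N * (1 + (N + M : ℕ) / (a - a')) ^ (N + M) * Real.exp (-(a' * (σ * t))) := by
  have h1 : σ ^ N * (2 * (1 + t)) ^ N ≤ 2 ^ N * (1 + σ * t) ^ N := by
    rw [← mul_pow, ← mul_pow]
    have : σ * (2 * (1 + t)) ≤ 2 * (1 + σ * t) := by linarith
    gcongr
  have h2 := one_add_pow_le_exp (N + M) (sub_pos.2 haa) (by positivity : 0 ≤ σ * t)
  calc _ ≤ 2 ^ N * (1 + σ * t) ^ N * (1 + σ * t) ^ M * Real.exp (-(a * (σ * t))) := by gcongr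
    _ = 2 ^ N * (1 + σ * t) ^ (N + M) * Real.exp (-(a * (σ * t))) := by rw [pow_add]; ring
    _ ≤ 2 ^ N * ((1 + (N + M : ℕ) / (a - a')) ^ (N + M) * Real.exp ((a - a') * (σ * t)))
        * Real.exp (-(a * (σ * t))) := by gcongr
    _ = 2 ^ N * (1 + (N + M : ℕ) / (a - a')) ^ (N + M)
        * (Real.exp ((a - a') * (σ * t)) * Real.exp (-(a * (σ * t)))) := by ring
    _ = _ := by rw [← Real.exp_add]; congr 2; ring

theorem mul_le_of_decay {X K g Y r P e Q : ℝ} (hr : 0 ≤ r) (hK : 0 ≤ K) (hY : 0 ≤ Y)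
    (hX : X ≤ K * g * Y) (hg : r * g ≤ P * e) (hQ : Y ≤ Q) (hg0 : 0 ≤ g) :
    r * X ≤ K * P * e * Q := by
  have hPe : 0 ≤ P * e := le_trans (by positivity) hg
  calc r * X ≤ r * (K * g * Y) := by gcongr
    _ = K * (r * g) * Y := by ring
    _ ≤ K * (P * e) * Q := by gcongr
    _ = _ := by ring

set_option maxHeartbeats 400000 in
/-- The estimate of a single frequency that gives the first inequality of the theorem. -/
theorem exists_mode_estimate_xz (ε : ℝ) : ∃ C : ℝ, 0 < C ∧ ∀ (μ lam σ k l c t : ℝ)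
    (b u₁ u₂ u₃ : ℝ → ℂ), Admissible ε μ lam σ → 1 ≤ k ^ 2 → 0 ≤ t →
    IsModeSol ε μ lam k l c t b u₁ u₂ u₃ →
    σ ^ 3 * ((k ^ 2 + l ^ 2) * (symb k l c t / ε ^ 2 * ‖b t‖ ^ 2)
        + (k ^ 2 + l ^ 2) * ‖divC k l c u₁ u₂ u₃ t‖ ^ 2 + ‖vortY k l c u₁ u₂ u₃ t‖ ^ 2)
      + σ ^ 4 * ‖vortZ k l c u₁ u₂ u₃ t‖ ^ 2
    ≤ C * Real.exp (-(σ * t / 22)) * ((k ^ 2 + l ^ 2) * (symb k l c 0 / ε ^ 2 * ‖b 0‖ ^ 2)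
        + symb k l c 0 * ‖divC k l c u₁ u₂ u₃ 0‖ ^ 2 + symb k l c 0 ^ 2 * ‖u₂ 0‖ ^ 2
        + symb k l c 0 ^ 2 * ‖u₃ 0‖ ^ 2) := by
  set C₁ := Real.exp ((3 * ε + ε ^ 2 + 2) * Real.pi + Real.pi)
    * (2 ^ 3 * (1 + (3 + 0 : ℕ) / (1 / 4 - 1 / 22 : ℝ)) ^ (3 + 0)) with hC₁
  set C₂ := Real.exp ((3 * ε + 5 * ε ^ 2 + 8) * Real.pi + Real.pi)
    * (2 ^ 4 * (1 + (4 + 0 : ℕ) / (1 / 4 - 1 / 22 : ℝ)) ^ (4 + 0)) with hC₂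
  have hC₁0 : 0 < C₁ := by rw [hC₁]; norm_num; positivity
  have hC₂0 : 0 < C₂ := by rw [hC₂]; norm_num; positivity
  refine ⟨(5 + 4 * ε ^ 2) * (C₁ + C₂) * (6 + 4 * ε ^ 2), by positivity, ?_⟩
  intro μ lam σ k l c t b u₁ u₂ u₃ ha hk ht h
  have hε := ha.hε
  have hσ := ha.hσ
  have hσ1 := ha.sigma_le_one
  have hm : 0 < √(k ^ 2 + l ^ 2) := Real.sqrt_pos.2 (by nlinarith [sq_nonneg l])
  have hm2 : √(k ^ 2 + l ^ 2) ^ 2 = k ^ 2 + l ^ 2 := Real.sq_sqrt (by positivity)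
  have hkm : k ^ 2 ≤ √(k ^ 2 + l ^ 2) ^ 2 := by rw [hm2]; linarith [sq_nonneg l]
  have hp0 := symb_pos (l := l) (c := c) hk 0
  have hpt := symb_pos (l := l) (c := c) hk t
  have g1 := h.energy_le ha hk hm hkm ht (fun s _ => hasDerivAt_ghostPrim hk s)
    (fun s _ => le_rfl) (ghostPrim_sub_le k l c t 0)
  have g2 := h.vortZ_le ha hk ht
  have i1 := modeEnergy_le (l := l) (c := c) (b := b) (u₁ := u₁) (u₂ := u₂) (u₃ := u₃)
    hε hσ hσ1 hk hm hkm 0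
  have i2 := norm_sq_vortZ_le (k := k) (l := l) (c := c) (u₁ := u₁) (u₂ := u₂) (u₃ := u₃) 0
  have f1 := norm_goodC_sub_sq_le (l := l) (c := c) (b := b) (u₁ := u₁) (u₂ := u₂) (u₃ := u₃)
    hε hk hm hkm (σ / 2) t
  have f2 := mul_le_mul_of_nonneg_left (norm_sq_divC_le (l := l) (c := c) (b := b) (u₁ := u₁)
    (u₂ := u₂) (u₃ := u₃) hε hσ hσ1 hk t) (by positivity : 0 ≤ k ^ 2 + l ^ 2)
  have hvY : goodC k l c b u₁ u₂ u₃ t - I * k * b t = vortY k l c u₁ u₂ u₃ t := by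
    unfold goodC vortY; ring
  rw [hvY] at f1
  have hEt : modeEnergy ε (σ / 2) k l c √(k ^ 2 + l ^ 2) b u₁ u₂ u₃ t
      ≥ ‖modDiv (σ / 2) k l c b u₁ u₂ u₃ t‖ ^ 2 + symb k l c t / ε ^ 2 * ‖b t‖ ^ 2 := by
    unfold modeEnergy
    have : 0 ≤ ‖goodC k l c b u₁ u₂ u₃ t‖ ^ 2 / √(k ^ 2 + l ^ 2) ^ 2 := by positivity
    linarith
  have hE0 := modeEnergy_nonneg (ε := ε) (l := l) (c := c) (m := √(k ^ 2 + l ^ 2)) (b := b)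
    (u₁ := u₁) (u₂ := u₂) (u₃ := u₃) hk (σ / 2) 0
  rw [hm2] at i1 f1
  have hsy : k ^ 2 + l ^ 2 + freqY k c 0 ^ 2 = symb k l c 0 := by unfold symb; ring
  rw [hsy] at i1
  set E₀ := modeEnergy ε (σ / 2) k l c √(k ^ 2 + l ^ 2) b u₁ u₂ u₃ 0
  set E := modeEnergy ε (σ / 2) k l c √(k ^ 2 + l ^ 2) b u₁ u₂ u₃ t
  set κ := k ^ 2 + l ^ 2 with hκ
  have hκ0 : 0 < κ := by rw [← hm2]; positivity
  set D := κ * (symb k l c 0 / ε ^ 2 * ‖b 0‖ ^ 2)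
        + symb k l c 0 * ‖divC k l c u₁ u₂ u₃ 0‖ ^ 2 + symb k l c 0 ^ 2 * ‖u₂ 0‖ ^ 2
        + symb k l c 0 ^ 2 * ‖u₃ 0‖ ^ 2 with hD
  have hl : l ^ 2 * ‖divC k l c u₁ u₂ u₃ 0‖ ^ 2 ≤ symb k l c 0 * ‖divC k l c u₁ u₂ u₃ 0‖ ^ 2 := by
    gcongr
    unfold symb; linarith only [sq_nonneg k, sq_nonneg (freqY k c 0)]
  have d1 : 0 ≤ κ * (symb k l c 0 / ε ^ 2 * ‖b 0‖ ^ 2) := by positivity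
  have d2 : 0 ≤ symb k l c 0 * ‖divC k l c u₁ u₂ u₃ 0‖ ^ 2 := by positivity
  have d3 : 0 ≤ symb k l c 0 ^ 2 * ‖u₂ 0‖ ^ 2 := by positivity
  have d4 : 0 ≤ symb k l c 0 ^ 2 * ‖u₃ 0‖ ^ 2 := by positivity
  have hD0 : 0 ≤ D := by positivity
  have j1 : κ * E₀ ≤ (4 + 4 * ε ^ 2) * D := by
    refine i1.trans ?_
    gcongr
    rw [hD]; linarith
  have j2 : κ * E₀ + ‖vortZ k l c u₁ u₂ u₃ 0‖ ^ 2 ≤ (6 + 4 * ε ^ 2) * D := by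
    have : ‖vortZ k l c u₁ u₂ u₃ 0‖ ^ 2 ≤ 2 * D := by rw [hD]; linarith
    linarith
  -- the decay of the two energies
  have decay : ∀ (N : ℕ), σ ^ N * (Real.exp (N / 2 * (logGrowth c t - logGrowth c 0))
      * Real.exp (-(σ / 4 * t))) ≤ 2 ^ N * (1 + (N + 0 : ℕ) / (1 / 4 - 1 / 22 : ℝ)) ^ (N + 0)
        * Real.exp (-(σ * t / 22)) := by
    intro N
    have h1 := sigma_pow_mul_le (a := 1 / 4) (a' := 1 / 22) N 0 (by norm_num) hσ hσ1 ht
    have e1 : -(1 / 4 * (σ * t)) = -(σ / 4 * t) := by ring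
    have e2 : -(1 / 22 * (σ * t)) = -(σ * t / 22) := by ring
    rw [pow_zero, mul_one, e1, e2] at h1
    refine le_trans ?_ h1
    rw [← mul_assoc]
    gcongr
    exact exp_logGrowth_le N ht
  have k1 : σ ^ 3 * (κ * E) ≤ C₁ * Real.exp (-(σ * t / 22)) * ((4 + 4 * ε ^ 2) * D) := by
    have g1' : κ * E ≤ Real.exp ((3 * ε + ε ^ 2 + 2) * Real.pi + Real.pi)
        * (Real.exp ((3 : ℕ) / 2 * (logGrowth c t - logGrowth c 0)) * Real.exp (-(σ / 4 * t)))
        * (κ * E₀) := by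
      rw [mul_left_comm]; exact mul_le_mul_of_nonneg_left g1 hκ0.le
    rw [hC₁]
    exact mul_le_of_decay (by positivity) (by positivity) (by positivity) g1' (decay 3) j1
      (by positivity)
  have k2 : σ ^ 4 * (κ * E + ‖vortZ k l c u₁ u₂ u₃ t‖ ^ 2)
      ≤ C₂ * Real.exp (-(σ * t / 22)) * ((6 + 4 * ε ^ 2) * D) := by
    rw [hC₂]
    exact mul_le_of_decay (by positivity) (by positivity) (by positivity) g2 (decay 4) j2
      (by positivity)
  have hE : 0 ≤ E := le_trans (by positivity) hEt
  have a1 : κ * (symb k l c t / ε ^ 2 * ‖b t‖ ^ 2) + κ * ‖divC k l c u₁ u₂ u₃ t‖ ^ 2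
      + ‖vortY k l c u₁ u₂ u₃ t‖ ^ 2 ≤ (5 + 4 * ε ^ 2) * (κ * E) := by
    have h3 := mul_le_mul_of_nonneg_left hEt hκ0.le
    have h4 : 0 ≤ κ * ‖modDiv (σ / 2) k l c b u₁ u₂ u₃ t‖ ^ 2 := by positivity
    have h5 : 0 ≤ κ * (symb k l c t / ε ^ 2 * ‖b t‖ ^ 2) := by positivity
    have h7 := mul_le_mul_of_nonneg_left h3 (sq_nonneg ε)
    have h8 := mul_nonneg (sq_nonneg ε) h4
    linarith
  have k1' := mul_le_mul_of_nonneg_left k1 (by positivity : 0 ≤ 5 + 4 * ε ^ 2)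
  have a1' := mul_le_mul_of_nonneg_left a1 (by positivity : 0 ≤ σ ^ 3)
  have hED : 0 ≤ Real.exp (-(σ * t / 22)) * D := by positivity
  have q1 : 0 ≤ (5 + 4 * ε ^ 2) * C₁ * (Real.exp (-(σ * t / 22)) * D) := by positivity
  have q2 : 0 ≤ (4 + 4 * ε ^ 2) * (6 + 4 * ε ^ 2) * C₂ * (Real.exp (-(σ * t / 22)) * D) := by
    positivity
  have q3 : 0 ≤ σ ^ 4 * (κ * E) := by positivity
  clear_value C₁ C₂ D E E₀ κ
  linarith only [k1', a1', k2, q1, q2, q3]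

end Couette

/-! ### The second estimate of a single frequency -/

namespace Couette

open Complex (I)

variable {ε μ lam σ k l c T t m G : ℝ} {b u₁ u₂ u₃ : ℝ → ℂ}

theorem IsModeSol.mono (h : IsModeSol ε μ lam k l c T b u₁ u₂ u₃) {s : ℝ} (hs : s ≤ T) :
    IsModeSol ε μ lam k l c s b u₁ u₂ u₃ :=
  ⟨fun r hr => h.hb r ⟨hr.1, hr.2.trans hs⟩, fun r hr => h.h1 r ⟨hr.1, hr.2.trans hs⟩,
    fun r hr => h.h2 r ⟨hr.1, hr.2.trans hs⟩, fun r hr => h.h3 r ⟨hr.1, hr.2.trans hs⟩⟩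

/-- The part of the data that enters the second inequality with the factor `μ ^ (-2 / 3)`. -/
def dataX (ε k l c : ℝ) (b u₁ u₂ u₃ : ℝ → ℂ) : ℝ :=
  k ^ 2 * (symb k l c 0 / ε ^ 2 * ‖b 0‖ ^ 2)
    + (k ^ 2 + freqY k c 0 ^ 2) * ‖divC k l c u₁ u₂ u₃ 0‖ ^ 2 + symb k l c 0 ^ 2 * ‖u₂ 0‖ ^ 2

/-- The part of the data that enters the second inequality with the factor `1`. -/
def dataY (ε k l c : ℝ) (b u₁ : ℝ → ℂ) : ℝ :=
  freqY k c 0 ^ 2 * (symb k l c 0 / ε ^ 2 * ‖b 0‖ ^ 2) + symb k l c 0 ^ 2 * ‖u₁ 0‖ ^ 2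

theorem dataX_nonneg (hk : 1 ≤ k ^ 2) : 0 ≤ dataX ε k l c b u₁ u₂ u₃ := by
  have := symb_pos (l := l) (c := c) hk 0
  unfold dataX; positivity

theorem dataY_nonneg (hk : 1 ≤ k ^ 2) : 0 ≤ dataY ε k l c b u₁ := by
  have := symb_pos (l := l) (c := c) hk 0
  unfold dataY; positivity

theorem abs_pos_of_one_le_sq (hk : 1 ≤ k ^ 2) : 0 < |k| := by
  rw [abs_pos]; rintro rfl; norm_num at hk

theorem IsModeSol.energy_abs_le (ha : Admissible ε μ lam σ) (hk : 1 ≤ k ^ 2)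
    (h : IsModeSol ε μ lam k l c T b u₁ u₂ u₃) (hT : 0 ≤ T) :
    k ^ 2 * modeEnergy ε (σ / 2) k l c |k| b u₁ u₂ u₃ T
      ≤ Real.exp ((3 * ε + ε ^ 2 + 2) * Real.pi + Real.pi) * (4 + 4 * ε ^ 2)
        * (Real.exp ((3 : ℕ) / 2 * (logGrowth c T - logGrowth c 0)) * Real.exp (-(σ / 4 * T)))
        * dataX ε k l c b u₁ u₂ u₃ := by
  have hk0 := abs_pos_of_one_le_sq hk
  have g := h.energy_le (m := |k|) ha hk hk0 (sq_abs k).ge hT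
    (fun s _ => hasDerivAt_ghostPrim hk s) (fun s _ => by
      have := symb_pos (l := l) (c := c) hk s
      gcongr
      exact Real.abs_le_sqrt (by linarith [sq_nonneg l])) (ghostPrim_sub_le k l c T 0)
  have i := modeEnergy_le (l := l) (c := c) (b := b) (u₁ := u₁) (u₂ := u₂) (u₃ := u₃) (m := |k|)
    ha.hε ha.hσ ha.sigma_le_one hk hk0 (sq_abs k).ge 0
  rw [sq_abs] at i
  calc _ ≤ k ^ 2 * _ := mul_le_mul_of_nonneg_left g (sq_nonneg k)
    _ = Real.exp ((3 * ε + ε ^ 2 + 2) * Real.pi + Real.pi)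
        * (Real.exp ((3 : ℕ) / 2 * (logGrowth c T - logGrowth c 0)) * Real.exp (-(σ / 4 * T)))
        * (k ^ 2 * modeEnergy ε (σ / 2) k l c |k| b u₁ u₂ u₃ 0) := by ring
    _ ≤ Real.exp ((3 * ε + ε ^ 2 + 2) * Real.pi + Real.pi)
        * (Real.exp ((3 : ℕ) / 2 * (logGrowth c T - logGrowth c 0)) * Real.exp (-(σ / 4 * T)))
        * ((4 + 4 * ε ^ 2) * dataX ε k l c b u₁ u₂ u₃) := by
      exact mul_le_mul_of_nonneg_left i (by positivity)
    _ = _ := by ring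

/-- If `T ≤ |c| / 2`, the symbol stays comparable to its initial value on `[0, T]`, and the good
unknown may be weighted by `m² = k² (1 + c²)`. -/
theorem IsModeSol.energy_far_le (ha : Admissible ε μ lam σ) (hk : 1 ≤ k ^ 2)
    (h : IsModeSol ε μ lam k l c T b u₁ u₂ u₃) (hT : 0 ≤ T) (hTc : 2 * T ≤ |c|) :
    k ^ 2 * (1 + c ^ 2) * modeEnergy ε (σ / 2) k l c (|k| * √(1 + c ^ 2)) b u₁ u₂ u₃ T
      ≤ Real.exp ((3 * ε + ε ^ 2 + 2) * 2 + Real.pi) * (4 + 4 * ε ^ 2)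
        * (Real.exp ((3 : ℕ) / 2 * (logGrowth c T - logGrowth c 0)) * Real.exp (-(σ / 4 * T)))
        * (2 * (dataX ε k l c b u₁ u₂ u₃ + dataY ε k l c b u₁)) := by
  have hk0 := abs_pos_of_one_le_sq hk
  have hc0 : 0 < √(1 + c ^ 2) := Real.sqrt_pos.2 (by positivity)
  have hc2 : √(1 + c ^ 2) ^ 2 = 1 + c ^ 2 := Real.sq_sqrt (by positivity)
  have hm : 0 < |k| * √(1 + c ^ 2) := by positivity
  have hm2 : (|k| * √(1 + c ^ 2)) ^ 2 = k ^ 2 * (1 + c ^ 2) := by rw [mul_pow, sq_abs, hc2]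
  have hkm : k ^ 2 ≤ (|k| * √(1 + c ^ 2)) ^ 2 := by
    rw [hm2]; nlinarith [mul_nonneg (sq_nonneg k) (sq_nonneg c)]
  have hcc : |c| ≤ √(1 + c ^ 2) := Real.abs_le_sqrt (by linarith)
  have g := h.energy_le (m := |k| * √(1 + c ^ 2)) (Γ := fun s => s * (4 / √(1 + c ^ 2)))
    (gh := fun _ => 1 * (4 / √(1 + c ^ 2))) (g₀ := 2) ha hk hm hkm hT
    (fun s _ => (hasDerivAt_id s).mul_const _) (fun s hs => by
      have hp := symb_pos (l := l) (c := c) hk s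
      have hsc : c ^ 2 ≤ 4 * (s - c) ^ 2 := by
        have h1 : |c| ≤ |2 * (s - c)| := by
          have h2 : |c| ≤ |s - c| + |s| := by
            have := abs_sub_abs_le_abs_sub c s
            rw [abs_sub_comm c s] at this
            linarith
          rw [abs_mul, abs_of_pos (by norm_num : (0 : ℝ) < 2)]
          rw [abs_of_nonneg hs.1] at h2
          linarith [hs.2]
        have := sq_le_sq' (by linarith [abs_nonneg c, neg_abs_le c, abs_nonneg (2 * (s - c))]) h1
        rw [sq_abs, sq_abs] at this
        linarith
      have hs' : symb k l c s = k ^ 2 * (1 + (s - c) ^ 2) + l ^ 2 := by unfold symb freqY; ring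
      rw [one_mul, div_le_div_iff₀ hp hc0]
      calc |k| * (|k| * √(1 + c ^ 2)) * √(1 + c ^ 2) = k ^ 2 * (1 + c ^ 2) := by
            rw [← hm2]; ring
        _ ≤ k ^ 2 * (4 * (1 + (s - c) ^ 2)) := by gcongr; linarith
        _ ≤ 4 * symb k l c s := by rw [hs']; linarith [sq_nonneg l])
    (by
      rw [zero_mul, sub_zero, mul_div_assoc', div_le_iff₀ hc0]
      linarith)
  have i := modeEnergy_le (l := l) (c := c) (b := b) (u₁ := u₁) (u₂ := u₂) (u₃ := u₃)
    (m := |k| * √(1 + c ^ 2)) ha.hε ha.hσ ha.sigma_le_one hk hm hkm 0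
  rw [hm2] at i
  have hy : freqY k c 0 ^ 2 = k ^ 2 * c ^ 2 := by unfold freqY; ring
  have hp := symb_pos (l := l) (c := c) hk 0
  have i' : k ^ 2 * (1 + c ^ 2) * (symb k l c 0 / ε ^ 2 * ‖b 0‖ ^ 2)
        + (k ^ 2 * (1 + c ^ 2) + freqY k c 0 ^ 2) * ‖divC k l c u₁ u₂ u₃ 0‖ ^ 2
        + symb k l c 0 ^ 2 * ‖u₂ 0‖ ^ 2
        ≤ 2 * (dataX ε k l c b u₁ u₂ u₃ + dataY ε k l c b u₁) := by
    unfold dataX dataY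
    rw [hy]
    have e1 : 0 ≤ k ^ 2 * (symb k l c 0 / ε ^ 2 * ‖b 0‖ ^ 2) := by positivity
    have e2 : 0 ≤ k ^ 2 * c ^ 2 * (symb k l c 0 / ε ^ 2 * ‖b 0‖ ^ 2) := by positivity
    have e3 : 0 ≤ k ^ 2 * ‖divC k l c u₁ u₂ u₃ 0‖ ^ 2 := by positivity
    have e4 : 0 ≤ symb k l c 0 ^ 2 * ‖u₂ 0‖ ^ 2 := by positivity
    have e5 : 0 ≤ symb k l c 0 ^ 2 * ‖u₁ 0‖ ^ 2 := by positivity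
    linarith only [e1, e2, e3, e4, e5]
  calc _ ≤ k ^ 2 * (1 + c ^ 2) * _ := mul_le_mul_of_nonneg_left g (by positivity)
    _ = Real.exp ((3 * ε + ε ^ 2 + 2) * 2 + Real.pi)
        * (Real.exp ((3 : ℕ) / 2 * (logGrowth c T - logGrowth c 0)) * Real.exp (-(σ / 4 * T)))
        * (k ^ 2 * (1 + c ^ 2)
          * modeEnergy ε (σ / 2) k l c (|k| * √(1 + c ^ 2)) b u₁ u₂ u₃ 0) := by ring
    _ ≤ Real.exp ((3 * ε + ε ^ 2 + 2) * 2 + Real.pi)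
        * (Real.exp ((3 : ℕ) / 2 * (logGrowth c T - logGrowth c 0)) * Real.exp (-(σ / 4 * T)))
        * ((4 + 4 * ε ^ 2) * (2 * (dataX ε k l c b u₁ u₂ u₃ + dataY ε k l c b u₁))) := by
      exact mul_le_mul_of_nonneg_left
        (i.trans (mul_le_mul_of_nonneg_left i' (by positivity))) (by positivity)
    _ = _ := by ring

/-- The energy weighted by the vertical frequency. Either `|T - c| ≤ 3 T`, and the weight costs the
factor `T²`, or the critical time is far away. -/
theorem IsModeSol.freqY_sq_mul_le (ha : Admissible ε μ lam σ) (hk : 1 ≤ k ^ 2)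
    (h : IsModeSol ε μ lam k l c T b u₁ u₂ u₃) (hT : 0 ≤ T) :
    freqY k c T ^ 2 * (‖modDiv (σ / 2) k l c b u₁ u₂ u₃ T‖ ^ 2
        + symb k l c T / ε ^ 2 * ‖b T‖ ^ 2)
      ≤ 9 * Real.exp ((3 * ε + ε ^ 2 + 2) * Real.pi + Real.pi) * (4 + 4 * ε ^ 2)
        * (Real.exp ((3 : ℕ) / 2 * (logGrowth c T - logGrowth c 0)) * Real.exp (-(σ / 4 * T)))
        * ((1 + T ^ 2) * dataX ε k l c b u₁ u₂ u₃ + dataY ε k l c b u₁) := by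
  have hk0 := abs_pos_of_one_le_sq hk
  have hε := ha.hε
  have hX := dataX_nonneg (ε := ε) (l := l) (c := c) (b := b) (u₁ := u₁) (u₂ := u₂) (u₃ := u₃) hk
  have hY := dataY_nonneg (ε := ε) (l := l) (c := c) (b := b) (u₁ := u₁) hk
  have hp := symb_pos (l := l) (c := c) hk T
  have hEm : ∀ m : ℝ, ‖modDiv (σ / 2) k l c b u₁ u₂ u₃ T‖ ^ 2 + symb k l c T / ε ^ 2 * ‖b T‖ ^ 2
      ≤ modeEnergy ε (σ / 2) k l c m b u₁ u₂ u₃ T := by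
    intro m
    unfold modeEnergy
    have : 0 ≤ ‖goodC k l c b u₁ u₂ u₃ T‖ ^ 2 / m ^ 2 := by positivity
    linarith
  have hy : freqY k c T ^ 2 = k ^ 2 * (T - c) ^ 2 := by unfold freqY; ring
  have hS0 : 0 ≤ ‖modDiv (σ / 2) k l c b u₁ u₂ u₃ T‖ ^ 2 + symb k l c T / ε ^ 2 * ‖b T‖ ^ 2 := by
    positivity
  set S := ‖modDiv (σ / 2) k l c b u₁ u₂ u₃ T‖ ^ 2 + symb k l c T / ε ^ 2 * ‖b T‖ ^ 2
  set X := dataX ε k l c b u₁ u₂ u₃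
  set Y := dataY ε k l c b u₁
  set g := Real.exp ((3 : ℕ) / 2 * (logGrowth c T - logGrowth c 0)) * Real.exp (-(σ / 4 * T))
    with hg
  have hg0 : 0 ≤ g := by positivity
  rcases le_or_gt |T - c| (3 * T) with h3 | h3
  · have h4 : (T - c) ^ 2 ≤ 9 * T ^ 2 := by
      have := sq_le_sq' (by linarith [neg_abs_le (T - c), abs_nonneg (T - c)]) h3
      rw [sq_abs] at this; linarith
    calc freqY k c T ^ 2 * S ≤ 9 * T ^ 2 * (k ^ 2 * S) := by
          rw [hy]
          have := mul_le_mul_of_nonneg_right h4 (by positivity : 0 ≤ k ^ 2 * S)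
          linarith
      _ ≤ 9 * T ^ 2 * (k ^ 2 * modeEnergy ε (σ / 2) k l c |k| b u₁ u₂ u₃ T) := by
          gcongr; exact hEm _
      _ ≤ 9 * T ^ 2 * (Real.exp ((3 * ε + ε ^ 2 + 2) * Real.pi + Real.pi) * (4 + 4 * ε ^ 2)
          * g * X) := by
          exact mul_le_mul_of_nonneg_left (h.energy_abs_le ha hk hT) (by positivity)
      _ = 9 * Real.exp ((3 * ε + ε ^ 2 + 2) * Real.pi + Real.pi) * (4 + 4 * ε ^ 2)
          * g * (T ^ 2 * X) := by ring
      _ ≤ _ := by gcongr; linarith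
  · have hc1 : |T - c| ≤ |c| + T := by
      have := abs_sub T c
      rw [abs_of_nonneg hT] at this; linarith
    have hTc : 2 * T ≤ |c| := by linarith
    have h4 : (T - c) ^ 2 ≤ 9 / 4 * (1 + c ^ 2) := by
      have h5 : |T - c| ≤ 3 / 2 * |c| := by linarith
      have := pow_le_pow_left₀ (abs_nonneg _) h5 2
      rw [mul_pow, sq_abs, sq_abs] at this
      linarith
    have hfar := h.energy_far_le ha hk hT hTc
    have hpi : Real.exp ((3 * ε + ε ^ 2 + 2) * 2 + Real.pi)
        ≤ Real.exp ((3 * ε + ε ^ 2 + 2) * Real.pi + Real.pi) := by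
      gcongr; exact Real.two_le_pi
    calc freqY k c T ^ 2 * S ≤ 9 / 4 * (k ^ 2 * (1 + c ^ 2) * S) := by
          rw [hy]
          have := mul_le_mul_of_nonneg_right h4 (by positivity : 0 ≤ k ^ 2 * S)
          linarith
      _ ≤ 9 / 4 * (k ^ 2 * (1 + c ^ 2)
          * modeEnergy ε (σ / 2) k l c (|k| * √(1 + c ^ 2)) b u₁ u₂ u₃ T) := by
          gcongr; exact hEm _
      _ ≤ 9 / 4 * (Real.exp ((3 * ε + ε ^ 2 + 2) * 2 + Real.pi) * (4 + 4 * ε ^ 2)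
          * g * (2 * (X + Y))) := by gcongr
      _ ≤ 9 / 4 * (Real.exp ((3 * ε + ε ^ 2 + 2) * Real.pi + Real.pi) * (4 + 4 * ε ^ 2)
          * g * (2 * (X + Y))) := by gcongr
      _ = 9 * Real.exp ((3 * ε + ε ^ 2 + 2) * Real.pi + Real.pi) * (4 + 4 * ε ^ 2)
          * g * ((X + Y) / 2) := by ring
      _ ≤ _ := by
          gcongr
          have : 0 ≤ T ^ 2 * X := by positivity
          linarith

theorem vortX_zero_le (hε : 0 < ε) (hσ : 0 < σ) (hσ1 : σ ≤ 1) (hk : 1 ≤ k ^ 2) :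
    ‖vortX k l c b u₁ u₂ u₃ 0‖ ^ 2
      ≤ (4 + 2 * ε ^ 2) * ((σ ^ 2)⁻¹ * dataX ε k l c b u₁ u₂ u₃ + dataY ε k l c b u₁) := by
  have h1 := norm_sub_sq_le_two (-(symb k l c 0 * u₁ 0) - I * k * divC k l c u₁ u₂ u₃ 0)
    (I * freqY k c 0 * b 0)
  have h2 := norm_sub_sq_le_two (-(symb k l c 0 * u₁ 0)) (I * k * divC k l c u₁ u₂ u₃ 0)
  have h3 := mul_le_mul_of_nonneg_left (norm_sq_b_le (l := l) (c := c) (b := b) hε hk 0)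
    (sq_nonneg (freqY k c 0))
  have hp := symb_pos (l := l) (c := c) hk 0
  have hX : k ^ 2 * ‖divC k l c u₁ u₂ u₃ 0‖ ^ 2 ≤ dataX ε k l c b u₁ u₂ u₃ := by
    unfold dataX
    have e1 : 0 ≤ k ^ 2 * (symb k l c 0 / ε ^ 2 * ‖b 0‖ ^ 2) := by positivity
    have e3 : 0 ≤ freqY k c 0 ^ 2 * ‖divC k l c u₁ u₂ u₃ 0‖ ^ 2 := by positivity
    have e4 : 0 ≤ symb k l c 0 ^ 2 * ‖u₂ 0‖ ^ 2 := by positivity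
    linarith
  have hX0 := dataX_nonneg (ε := ε) (l := l) (c := c) (b := b) (u₁ := u₁) (u₂ := u₂) (u₃ := u₃) hk
  have hXs : dataX ε k l c b u₁ u₂ u₃ ≤ (σ ^ 2)⁻¹ * dataX ε k l c b u₁ u₂ u₃ :=
    le_mul_of_one_le_left hX0 ((one_le_inv₀ (by positivity)).2 (pow_le_one₀ hσ.le hσ1))
  simp only [norm_neg, norm_mul, Complex.norm_I, one_mul, Complex.norm_real, Real.norm_eq_abs,
    mul_pow, sq_abs] at h1 h2
  have e6 : 0 ≤ ε ^ 2 * ((σ ^ 2)⁻¹ * dataX ε k l c b u₁ u₂ u₃) := by positivity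
  have e5 : 0 ≤ ε ^ 2 * (symb k l c 0 ^ 2 * ‖u₁ 0‖ ^ 2) := by positivity
  have e7 : 0 ≤ freqY k c 0 ^ 2 * (symb k l c 0 / ε ^ 2 * ‖b 0‖ ^ 2) := by positivity
  have hY : dataY ε k l c b u₁ = freqY k c 0 ^ 2 * (symb k l c 0 / ε ^ 2 * ‖b 0‖ ^ 2)
    + symb k l c 0 ^ 2 * ‖u₁ 0‖ ^ 2 := rfl
  have hdef : vortX k l c b u₁ u₂ u₃ 0 = -(symb k l c 0 * u₁ 0) - I * k * divC k l c u₁ u₂ u₃ 0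
    - I * freqY k c 0 * b 0 := rfl
  rw [hdef, hY]
  linarith

theorem IsModeSol.vortX_le (ha : Admissible ε μ lam σ) (hk : 1 ≤ k ^ 2)
    (h : IsModeSol ε μ lam k l c t b u₁ u₂ u₃) (ht : 0 ≤ t) {K K₂ : ℝ}
    (hK : K = 256 * (8 * ε ^ 2 + 1))
    (hK₂ : K₂ = 9 * Real.exp ((3 * ε + ε ^ 2 + 2) * Real.pi + Real.pi) * (4 + 4 * ε ^ 2)) :
    ‖vortX k l c b u₁ u₂ u₃ t‖ ^ 2
      ≤ Real.exp ((3 * ε + ε ^ 2 + 2) * Real.pi + Real.pi)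
        * (Real.exp ((4 : ℕ) / 2 * (logGrowth c t - logGrowth c 0)) * Real.exp (-(σ / 8 * t)))
        * ((K * (4 + 4 * ε ^ 2) + 4 + 2 * ε ^ 2)
            * ((σ ^ 2)⁻¹ * dataX ε k l c b u₁ u₂ u₃ + dataY ε k l c b u₁)
          + σ ^ 3 * ε ^ 2 * K₂ * Real.exp Real.pi
            * ((1 + t ^ 2) * dataX ε k l c b u₁ u₂ u₃ + dataY ε k l c b u₁) * t) := by
  have hk0 := abs_pos_of_one_le_sq hk
  have hε := ha.hε
  have hσ := ha.hσ
  have hK0 : 0 < K := by rw [hK]; positivity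
  have hK₂0 : 0 < K₂ := by rw [hK₂]; positivity
  have hX0 := dataX_nonneg (ε := ε) (l := l) (c := c) (b := b) (u₁ := u₁) (u₂ := u₂) (u₃ := u₃) hk
  have hY0 := dataY_nonneg (ε := ε) (l := l) (c := c) (b := b) (u₁ := u₁) hk
  have hE0 := modeEnergy_nonneg (ε := ε) (l := l) (c := c) (m := |k|) (b := b) (u₁ := u₁)
    (u₂ := u₂) (u₃ := u₃) hk (σ / 2)
  have hforce : ∀ s ∈ Icc 0 t, μ * freqY k c s ^ 2 * (symb k l c s * ‖b s‖ ^ 2)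
      * Real.exp (-(ratePrim 4 (3 * ε + ε ^ 2 + 2) (σ / 8) σ c (ghostPrim k l c) s
        - ratePrim 4 (3 * ε + ε ^ 2 + 2) (σ / 8) σ c (ghostPrim k l c) 0))
      ≤ σ ^ 3 * ε ^ 2 * K₂ * Real.exp Real.pi
        * ((1 + t ^ 2) * dataX ε k l c b u₁ u₂ u₃ + dataY ε k l c b u₁) := by
    intro s hs
    have h1 := (h.mono hs.2).freqY_sq_mul_le ha hk hs.1
    rw [← hK₂] at h1
    have h2 := exp_neg_ratePrim_le 4 (A := 3 * ε + ε ^ 2 + 2) (ρ := σ / 8) (σ := σ) (c := c)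
      (by positivity) (ghostPrim_mono k l c hs.1)
    have hp := symb_pos (l := l) (c := c) hk s
    have hL : 0 ≤ logGrowth c s - logGrowth c 0 := sub_nonneg.2 (logGrowth_mono hs.1)
    set Lg := logGrowth c s - logGrowth c 0
    set X := dataX ε k l c b u₁ u₂ u₃
    set Y := dataY ε k l c b u₁
    set R := Real.exp (-(ratePrim 4 (3 * ε + ε ^ 2 + 2) (σ / 8) σ c (ghostPrim k l c) s
        - ratePrim 4 (3 * ε + ε ^ 2 + 2) (σ / 8) σ c (ghostPrim k l c) 0))
    have hst : (1 + s ^ 2) * X + Y ≤ (1 + t ^ 2) * X + Y := by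
      have := hs.1
      have := hs.2
      gcongr
    have h3 : μ * freqY k c s ^ 2 * (symb k l c s * ‖b s‖ ^ 2)
        ≤ σ ^ 3 * ε ^ 2 * (K₂ * (Real.exp ((3 : ℕ) / 2 * Lg) * Real.exp (-(σ / 4 * s)))
          * ((1 + t ^ 2) * X + Y)) := by
      have e : μ * freqY k c s ^ 2 * (symb k l c s * ‖b s‖ ^ 2)
          = σ ^ 3 * ε ^ 2 * (freqY k c s ^ 2 * (symb k l c s / ε ^ 2 * ‖b s‖ ^ 2)) := by
        rw [← ha.hμ]; field_simp
      rw [e]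
      refine mul_le_mul_of_nonneg_left ?_ (by positivity)
      calc freqY k c s ^ 2 * (symb k l c s / ε ^ 2 * ‖b s‖ ^ 2) ≤ freqY k c s ^ 2
            * (‖modDiv (σ / 2) k l c b u₁ u₂ u₃ s‖ ^ 2 + symb k l c s / ε ^ 2 * ‖b s‖ ^ 2) := by
            gcongr; linarith [sq_nonneg ‖modDiv (σ / 2) k l c b u₁ u₂ u₃ s‖]
        _ ≤ _ := h1
        _ ≤ _ := by gcongr
    have h4 : Real.exp ((3 : ℕ) / 2 * Lg) * Real.exp (-(σ / 4 * s))
        * (Real.exp (-((4 : ℕ) / 2 * Lg)) * Real.exp (σ / 8 * s)) ≤ 1 := by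
      rw [← Real.exp_add, ← Real.exp_add, ← Real.exp_add]
      apply Real.exp_le_one_iff.2
      have := mul_nonneg hσ.le hs.1
      push_cast
      linarith
    calc _ ≤ σ ^ 3 * ε ^ 2 * (K₂ * (Real.exp ((3 : ℕ) / 2 * Lg) * Real.exp (-(σ / 4 * s)))
          * ((1 + t ^ 2) * X + Y)) * (Real.exp Real.pi
          * (Real.exp (-((4 : ℕ) / 2 * Lg)) * Real.exp (σ / 8 * s))) := by gcongr
      _ = σ ^ 3 * ε ^ 2 * K₂ * Real.exp Real.pi * ((1 + t ^ 2) * X + Y)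
          * (Real.exp ((3 : ℕ) / 2 * Lg) * Real.exp (-(σ / 4 * s))
        * (Real.exp (-((4 : ℕ) / 2 * Lg)) * Real.exp (σ / 8 * s))) := by ring
      _ ≤ σ ^ 3 * ε ^ 2 * K₂ * Real.exp Real.pi * ((1 + t ^ 2) * X + Y) * 1 := by gcongr
      _ = _ := by ring
  have g := gronwall_forced (f := fun s => K / σ ^ 2
      * (k ^ 2 * modeEnergy ε (σ / 2) k l c |k| b u₁ u₂ u₃ s) + ‖vortX k l c b u₁ u₂ u₃ s‖ ^ 2)
    (g := fun s => μ * freqY k c s ^ 2 * (symb k l c s * ‖b s‖ ^ 2)) ht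
    (fun s _ => hasDerivAt_ratePrim 4 (3 * ε + ε ^ 2 + 2) (σ / 8) σ c (hasDerivAt_ghostPrim hk s))
    (fun s hs => by
      obtain ⟨E', hE, hle⟩ := h.vortX_deriv_le ha hk hs
        (G := |k| * √(k ^ 2 + l ^ 2) / symb k l c s) (by
          have := symb_pos (l := l) (c := c) hk s
          rw [← sq_abs, sq]
          gcongr
          exact Real.abs_le_sqrt (by rw [abs_mul_abs_self]; linarith [sq_nonneg l, sq k])) hK
      refine ⟨E', hE, hle.trans (le_of_eq ?_)⟩
      unfold dampRate; push_cast; ring) hforce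
  have hexp := exp_ratePrim_le 4 (A := 3 * ε + ε ^ 2 + 2) (ρ := σ / 8) (σ := σ) (c := c) (s := t)
    (by positivity) (ghostPrim_sub_le k l c t 0)
  have hinit : K / σ ^ 2 * (k ^ 2 * modeEnergy ε (σ / 2) k l c |k| b u₁ u₂ u₃ 0)
      + ‖vortX k l c b u₁ u₂ u₃ 0‖ ^ 2 ≤ (K * (4 + 4 * ε ^ 2) + 4 + 2 * ε ^ 2)
            * ((σ ^ 2)⁻¹ * dataX ε k l c b u₁ u₂ u₃ + dataY ε k l c b u₁) := by
    have i := modeEnergy_le (l := l) (c := c) (b := b) (u₁ := u₁) (u₂ := u₂) (u₃ := u₃) (m := |k|)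
      ha.hε ha.hσ ha.sigma_le_one hk hk0 (sq_abs k).ge 0
    rw [sq_abs] at i
    have i2 := vortX_zero_le (l := l) (c := c) (b := b) (u₁ := u₁) (u₂ := u₂) (u₃ := u₃) hε hσ
      ha.sigma_le_one hk
    have i3 := mul_le_mul_of_nonneg_left i (by positivity : 0 ≤ K / σ ^ 2)
    have e : K / σ ^ 2 * ((4 + 4 * ε ^ 2) * dataX ε k l c b u₁ u₂ u₃)
        = K * (4 + 4 * ε ^ 2) * ((σ ^ 2)⁻¹ * dataX ε k l c b u₁ u₂ u₃) := by
      field_simp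
    have i4 : K / σ ^ 2 * (k ^ 2 * modeEnergy ε (σ / 2) k l c |k| b u₁ u₂ u₃ 0)
        ≤ K * (4 + 4 * ε ^ 2) * ((σ ^ 2)⁻¹ * dataX ε k l c b u₁ u₂ u₃) := by
      rw [← e]; exact i3
    have i5 : 0 ≤ K * (4 + 4 * ε ^ 2) * dataY ε k l c b u₁ := by positivity
    linarith
  have hv : ‖vortX k l c b u₁ u₂ u₃ t‖ ^ 2 ≤ K / σ ^ 2
      * (k ^ 2 * modeEnergy ε (σ / 2) k l c |k| b u₁ u₂ u₃ t) + ‖vortX k l c b u₁ u₂ u₃ t‖ ^ 2 := by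
    have := hE0 t
    have : 0 ≤ K / σ ^ 2 * (k ^ 2 * modeEnergy ε (σ / 2) k l c |k| b u₁ u₂ u₃ t) := by positivity
    linarith
  refine hv.trans (g.trans ?_)
  refine mul_le_mul hexp (by linarith) ?_ (by positivity)
  have := hE0 0
  positivity

end Couette

namespace Couette

open Complex (I)

theorem sigma_sq_mul_le {σ t X Y : ℝ} (hσ : 0 < σ) (hσ1 : σ ≤ 1) (ht : 0 ≤ t) (hX : 0 ≤ X)
    (hY : 0 ≤ Y) :
    (1 + t ^ 2) * X + Y ≤ (1 + σ * t) ^ 2 * ((σ ^ 2)⁻¹ * X + Y) := by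
  have hτ : 0 ≤ σ * t := by positivity
  have h1 : (1 + t ^ 2) * X ≤ (1 + σ * t) ^ 2 * ((σ ^ 2)⁻¹ * X) := by
    have e : (1 + σ * t) ^ 2 * ((σ ^ 2)⁻¹ * X) = (1 + σ * t) ^ 2 * X / σ ^ 2 := by field_simp
    rw [e, le_div_iff₀ (by positivity)]
    have h2 : σ ^ 2 ≤ 1 := pow_le_one₀ hσ.le hσ1
    have h3 : (1 + t ^ 2) * σ ^ 2 ≤ (1 + σ * t) ^ 2 := by nlinarith
    calc (1 + t ^ 2) * X * σ ^ 2 = (1 + t ^ 2) * σ ^ 2 * X := by ring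
      _ ≤ _ := by gcongr
  have h4 : Y ≤ (1 + σ * t) ^ 2 * Y := le_mul_of_one_le_left hY (one_le_pow₀ (by linarith))
  linarith

/-- The estimate of a single frequency that gives the second inequality of the theorem. -/
theorem exists_mode_estimate_y (ε : ℝ) : ∃ C : ℝ, 0 < C ∧ ∀ (μ lam σ k l c t : ℝ)
    (b u₁ u₂ u₃ : ℝ → ℂ), Admissible ε μ lam σ → 1 ≤ k ^ 2 → 0 ≤ t →
    IsModeSol ε μ lam k l c t b u₁ u₂ u₃ →
    σ ^ 3 * (freqY k c t ^ 2 * (symb k l c t / ε ^ 2 * ‖b t‖ ^ 2)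
        + freqY k c t ^ 2 * ‖divC k l c u₁ u₂ u₃ t‖ ^ 2)
      + σ ^ 4 * ‖vortX' k l c u₁ u₂ u₃ t‖ ^ 2
    ≤ C * Real.exp (-(σ * t / 44))
      * ((σ ^ 2)⁻¹ * dataX ε k l c b u₁ u₂ u₃ + dataY ε k l c b u₁) := by
  set K := 256 * (8 * ε ^ 2 + 1) with hK
  set K₂ := 9 * Real.exp ((3 * ε + ε ^ 2 + 2) * Real.pi + Real.pi) * (4 + 4 * ε ^ 2) with hK₂
  set K₃ := K * (4 + 4 * ε ^ 2) + 4 + 2 * ε ^ 2 + ε ^ 2 * K₂ * Real.exp Real.pi with hK₃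
  set P₁ : ℝ := 2 ^ 3 * (1 + (3 + 2 : ℕ) / (1 / 4 - 1 / 44 : ℝ)) ^ (3 + 2) with hP₁
  set P₂ : ℝ := 2 ^ 4 * (1 + (4 + 3 : ℕ) / (1 / 8 - 1 / 44 : ℝ)) ^ (4 + 3) with hP₂
  set Q := Real.exp ((3 * ε + ε ^ 2 + 2) * Real.pi + Real.pi) with hQ
  have hP₁0 : 0 < P₁ := by rw [hP₁]; norm_num
  have hP₂0 : 0 < P₂ := by rw [hP₂]; norm_num
  have hK0 : 0 < K := by positivity
  have hK₂0 : 0 < K₂ := by positivity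
  have hK₃0 : 0 < K₃ := by positivity
  have hQ0 : 0 < Q := by positivity
  refine ⟨(3 + 4 * ε ^ 2) * (K₂ * P₁) + 2 * (Q * P₂ * K₃), by positivity, ?_⟩
  intro μ lam σ k l c t b u₁ u₂ u₃ ha hk ht h
  have hε := ha.hε
  have hσ := ha.hσ
  have hσ1 := ha.sigma_le_one
  have hτ : 0 ≤ σ * t := by positivity
  have hpt := symb_pos (l := l) (c := c) hk t
  have hX0 := dataX_nonneg (ε := ε) (l := l) (c := c) (b := b) (u₁ := u₁) (u₂ := u₂) (u₃ := u₃) hk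
  have hY0 := dataY_nonneg (ε := ε) (l := l) (c := c) (b := b) (u₁ := u₁) hk
  have g1 := h.freqY_sq_mul_le ha hk ht
  have g2 := h.vortX_le ha hk ht hK hK₂
  have f1 := norm_sq_divC_le (l := l) (c := c) (b := b) (u₁ := u₁) (u₂ := u₂) (u₃ := u₃)
    hε hσ hσ1 hk t
  have f2 := norm_sq_b_le (l := l) (c := c) (b := b) hε hk t
  have hsum := sigma_sq_mul_le hσ hσ1 ht hX0 hY0
  rw [← hK₂] at g1
  set X := dataX ε k l c b u₁ u₂ u₃
  set Y := dataY ε k l c b u₁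
  set D := (σ ^ 2)⁻¹ * X + Y with hD
  have hD0 : 0 ≤ D := by positivity
  have hL := fun N => exp_logGrowth_le N (c := c) ht
  -- the two decaying factors, after the powers of `t` have been paid for by powers of `σ`
  have dec1 : σ ^ 3 * (Real.exp ((3 : ℕ) / 2 * (logGrowth c t - logGrowth c 0))
      * Real.exp (-(σ / 4 * t)) * (1 + σ * t) ^ 2) ≤ P₁ * Real.exp (-(σ * t / 44)) := by
    have h1 := sigma_pow_mul_le (a := 1 / 4) (a' := 1 / 44) 3 2 (by norm_num) hσ hσ1 ht
    have e1 : -(1 / 4 * (σ * t)) = -(σ / 4 * t) := by ring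
    have e2 : -(1 / 44 * (σ * t)) = -(σ * t / 44) := by ring
    rw [e1, e2] at h1
    refine le_trans ?_ h1
    calc _ = σ ^ 3 * Real.exp ((3 : ℕ) / 2 * (logGrowth c t - logGrowth c 0))
          * (1 + σ * t) ^ 2 * Real.exp (-(σ / 4 * t)) := by ring
      _ ≤ _ := by gcongr; exact hL 3
  have dec2 : σ ^ 4 * (Real.exp ((4 : ℕ) / 2 * (logGrowth c t - logGrowth c 0))
      * Real.exp (-(σ / 8 * t)) * (1 + σ * t) ^ 3) ≤ P₂ * Real.exp (-(σ * t / 44)) := by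
    have h1 := sigma_pow_mul_le (a := 1 / 8) (a' := 1 / 44) 4 3 (by norm_num) hσ hσ1 ht
    have e1 : -(1 / 8 * (σ * t)) = -(σ / 8 * t) := by ring
    have e2 : -(1 / 44 * (σ * t)) = -(σ * t / 44) := by ring
    rw [e1, e2] at h1
    refine le_trans ?_ h1
    calc _ = σ ^ 4 * Real.exp ((4 : ℕ) / 2 * (logGrowth c t - logGrowth c 0))
          * (1 + σ * t) ^ 3 * Real.exp (-(σ / 8 * t)) := by ring
      _ ≤ _ := by gcongr; exact hL 4
  set G₃ := Real.exp ((3 : ℕ) / 2 * (logGrowth c t - logGrowth c 0)) * Real.exp (-(σ / 4 * t))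
    with hG₃
  set G₄ := Real.exp ((4 : ℕ) / 2 * (logGrowth c t - logGrowth c 0)) * Real.exp (-(σ / 8 * t))
    with hG₄
  have hG₃0 : 0 ≤ G₃ := by positivity
  have hG₄0 : 0 ≤ G₄ := by positivity
  set e₄ := Real.exp (-(σ * t / 44))
  have he₄ : 0 < e₄ := Real.exp_pos _
  set S := ‖modDiv (σ / 2) k l c b u₁ u₂ u₃ t‖ ^ 2 + symb k l c t / ε ^ 2 * ‖b t‖ ^ 2 with hS
  have k1 : σ ^ 3 * (freqY k c t ^ 2 * S) ≤ K₂ * P₁ * e₄ * D := by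
    have g1' : freqY k c t ^ 2 * S ≤ K₂ * (G₃ * (1 + σ * t) ^ 2) * D := by
      refine g1.trans ?_
      calc K₂ * G₃ * ((1 + t ^ 2) * X + Y) ≤ K₂ * G₃ * ((1 + σ * t) ^ 2 * D) := by gcongr
        _ = _ := by ring
    exact mul_le_of_decay (by positivity) hK₂0.le hD0 g1' dec1 le_rfl (by positivity)
  have k2 : σ ^ 4 * ‖vortX k l c b u₁ u₂ u₃ t‖ ^ 2 ≤ Q * P₂ * e₄ * (K₃ * D) := by
    have g2' : ‖vortX k l c b u₁ u₂ u₃ t‖ ^ 2 ≤ Q * (G₄ * (1 + σ * t) ^ 3) * (K₃ * D) := by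
      refine g2.trans ?_
      have h1 : σ ^ 3 * t ≤ 1 + σ * t := by
        have : σ ^ 3 ≤ σ := by
          calc σ ^ 3 = σ * σ ^ 2 := by ring
            _ ≤ σ * 1 := by gcongr; exact pow_le_one₀ hσ.le hσ1
            _ = σ := mul_one σ
        have := mul_le_mul_of_nonneg_right this ht
        linarith
      have h2 : σ ^ 3 * t * ((1 + t ^ 2) * X + Y) ≤ (1 + σ * t) * ((1 + σ * t) ^ 2 * D) := by
        gcongr
      have h3 : 1 ≤ (1 + σ * t) ^ 3 := one_le_pow₀ (by linarith)
      have h4 : (K * (4 + 4 * ε ^ 2) + 4 + 2 * ε ^ 2) * D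
          + σ ^ 3 * ε ^ 2 * K₂ * Real.exp Real.pi * ((1 + t ^ 2) * X + Y) * t
          ≤ (1 + σ * t) ^ 3 * (K₃ * D) := by
        calc _ = (K * (4 + 4 * ε ^ 2) + 4 + 2 * ε ^ 2) * D * 1
          + ε ^ 2 * K₂ * Real.exp Real.pi * (σ ^ 3 * t * ((1 + t ^ 2) * X + Y)) := by ring
          _ ≤ (K * (4 + 4 * ε ^ 2) + 4 + 2 * ε ^ 2) * D * (1 + σ * t) ^ 3
          + ε ^ 2 * K₂ * Real.exp Real.pi * ((1 + σ * t) * ((1 + σ * t) ^ 2 * D)) := by gcongr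
          _ = _ := by rw [hK₃]; ring
      calc _ ≤ Q * G₄ * ((1 + σ * t) ^ 3 * (K₃ * D)) :=
            mul_le_mul_of_nonneg_left h4 (by positivity)
        _ = _ := by ring
    exact mul_le_of_decay (by positivity) hQ0.le (by positivity) g2' dec2 le_rfl (by positivity)
  have hvX : vortX' k l c u₁ u₂ u₃ t = vortX k l c b u₁ u₂ u₃ t + I * freqY k c t * b t := by
    unfold vortX vortX'; ring
  have hq : ‖vortX' k l c u₁ u₂ u₃ t‖ ^ 2 ≤ 2 * ‖vortX k l c b u₁ u₂ u₃ t‖ ^ 2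
      + 2 * ε ^ 2 * (freqY k c t ^ 2 * (symb k l c t / ε ^ 2 * ‖b t‖ ^ 2)) := by
    have h1 := norm_add_sq_le_two (vortX k l c b u₁ u₂ u₃ t) (I * freqY k c t * b t)
    rw [← hvX] at h1
    simp only [norm_mul, Complex.norm_I, one_mul, Complex.norm_real, Real.norm_eq_abs,
      mul_pow, sq_abs] at h1
    have h2 := mul_le_mul_of_nonneg_left f2 (sq_nonneg (freqY k c t))
    linarith
  set β := symb k l c t / ε ^ 2 * ‖b t‖ ^ 2
  have hβ0 : 0 ≤ β := by positivity
  set d := ‖divC k l c u₁ u₂ u₃ t‖ ^ 2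
  set y2 := freqY k c t ^ 2
  have hy0 : 0 ≤ y2 := sq_nonneg _
  set a2 := ‖modDiv (σ / 2) k l c b u₁ u₂ u₃ t‖ ^ 2
  have ha0 : 0 ≤ a2 := sq_nonneg _
  have hσ4 : σ ^ 4 ≤ σ ^ 3 := pow_le_pow_of_le_one hσ.le hσ1 (by norm_num)
  have m1 : y2 * β + y2 * d ≤ (3 + 2 * ε ^ 2) * (y2 * S) := by
    have h1 := mul_le_mul_of_nonneg_left f1 hy0
    have h2 : 0 ≤ y2 * a2 := by positivity
    have h3 : 0 ≤ y2 * β := by positivity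
    have h4 : 0 ≤ ε ^ 2 * (y2 * a2) := by positivity
    rw [hS]
    linarith
  have m2 : σ ^ 4 * (2 * ε ^ 2 * (y2 * β)) ≤ σ ^ 3 * (2 * ε ^ 2 * (y2 * S)) := by
    have : β ≤ S := by rw [hS]; linarith
    gcongr
  have m3 := mul_le_mul_of_nonneg_left m1 (by positivity : 0 ≤ σ ^ 3)
  have m4 := mul_le_mul_of_nonneg_left hq (by positivity : 0 ≤ σ ^ 4)
  have m5 := mul_le_mul_of_nonneg_left k1 (by positivity : 0 ≤ 3 + 4 * ε ^ 2)
  clear_value D X Y S β d y2 a2 G₃ G₄ P₁ P₂ Q K₃ e₄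
  linarith only [m2, m3, m4, m5, k2]

end Couette

/-! ### Linear differential equations in Banach spaces and multiplication operators -/

namespace Couette

open Filter Topology
open scoped BoundedContinuousFunction

section LinearODE

variable {E : Type*} [NormedAddCommGroup E] [NormedSpace ℝ E]

/-- The iterated integrals of the Dyson series that solves `y' = A(t) y`, `y(0) = x₀`. -/
def dyson (A : ℝ → E →L[ℝ] E) (x₀ : E) : ℕ → ℝ → E
  | 0 => fun _ => x₀
  | n + 1 => fun t => ∫ s in (0 : ℝ)..t, A s (dyson A x₀ n s)

variable {A : ℝ → E →L[ℝ] E} {x₀ : E}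

theorem hasDerivAt_dyson_succ [CompleteSpace E] (hA : Continuous A) {n : ℕ}
    (hn : Continuous (dyson A x₀ n)) (t : ℝ) :
    HasDerivAt (dyson A x₀ (n + 1)) (A t (dyson A x₀ n t)) t :=
  intervalIntegral.integral_hasDerivAt_right
    ((hA.clm_apply hn).intervalIntegrable _ _)
    ((hA.clm_apply hn).stronglyMeasurableAtFilter _ _) (hA.clm_apply hn).continuousAt

theorem continuous_dyson [CompleteSpace E] (hA : Continuous A) (n : ℕ) :
    Continuous (dyson A x₀ n) := by
  induction n with
  | zero => exact continuous_const
  | succ n ih =>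
    exact continuous_iff_continuousAt.2 fun t => (hasDerivAt_dyson_succ hA ih t).continuousAt

theorem norm_dyson_le {R M : ℝ} (hM : 0 ≤ M)
    (hR : ∀ s, |s| ≤ R → ‖A s‖ ≤ M) (n : ℕ) {t : ℝ} (ht : |t| ≤ R) :
    ‖dyson A x₀ n t‖ ≤ ‖x₀‖ * ((M * |t|) ^ n / n.factorial) := by
  induction n generalizing t with
  | zero => simp [dyson]
  | succ n ih =>
    have h1 : ∀ s ∈ uIoc 0 t, ‖A s (dyson A x₀ n s)‖
        ≤ ‖x₀‖ * M ^ (n + 1) / n.factorial * |s - 0| ^ n := by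
      intro s hs
      have hs' : |s| ≤ R := by
        refine le_trans ?_ ht
        rcases le_total 0 t with h | h
        · rw [uIoc_of_le h] at hs
          rw [abs_of_pos hs.1, abs_of_nonneg h]; exact hs.2
        · rw [uIoc_of_ge h] at hs
          rw [abs_of_nonpos hs.2, abs_of_nonpos h]; linarith [hs.1]
      calc ‖A s (dyson A x₀ n s)‖ ≤ ‖A s‖ * ‖dyson A x₀ n s‖ := (A s).le_opNorm _
        _ ≤ M * (‖x₀‖ * ((M * |s|) ^ n / n.factorial)) :=
          mul_le_mul (hR s hs') (ih hs') (norm_nonneg _) hM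
        _ = _ := by rw [sub_zero, mul_pow]; ring
    have h2 := intervalIntegral.norm_integral_le_abs_of_norm_le (μ := volume)
      (f := fun s => A s (dyson A x₀ n s)) (a := 0) (b := t)
      (g := fun s => ‖x₀‖ * M ^ (n + 1) / n.factorial * |s - 0| ^ n)
      (Eventually.of_forall h1 |> (ae_restrict_iff' measurableSet_uIoc).2)
      ((by fun_prop : Continuous _).intervalIntegrable _ _)
    refine h2.trans (le_of_eq ?_)
    rw [intervalIntegral.abs_intervalIntegral_eq, integral_const_mul,
      integral_pow_abs_sub_uIoc, sub_zero, abs_of_nonneg (by positivity), mul_pow,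
      Nat.factorial_succ]
    push_cast
    field_simp

/-- A linear differential equation with continuous coefficients has global solutions. -/
theorem exists_hasDerivAt_linear [CompleteSpace E] (hA : Continuous A) (x₀ : E) :
    ∃ y : ℝ → E, y 0 = x₀ ∧ ∀ t, HasDerivAt y (A t (y t)) t := by
  have h0 : ∀ n, dyson A x₀ (n + 1) 0 = 0 := fun n => intervalIntegral.integral_same
  have hsum0 : HasSum (fun n => dyson A x₀ n 0) x₀ := by
    have := hasSum_single (f := fun n => dyson A x₀ n 0) 0 (by
      rintro (_ | n) hn
      · exact absurd rfl hn
      · exact h0 n)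
    simpa [dyson] using this
  refine ⟨fun t => ∑' n, dyson A x₀ n t, hsum0.tsum_eq, fun t => ?_⟩
  set R := |t| + 1 with hRdef
  obtain ⟨M, hM⟩ : ∃ M, ∀ s ∈ Icc (-R) R, ‖A s‖ ≤ M :=
    isCompact_Icc.exists_bound_of_continuousOn hA.continuousOn
  have hM0 : 0 ≤ M := (norm_nonneg _).trans (hM 0 (by rw [mem_Icc, ← abs_le, abs_zero]; positivity))
  have hR : ∀ s, |s| ≤ R → ‖A s‖ ≤ M := fun s hs => hM s (abs_le.1 hs)
  -- derivative of the `n`-th term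
  set g' : ℕ → ℝ → E := fun n s => match n with
    | 0 => 0
    | n + 1 => A s (dyson A x₀ n s) with hg'
  have hbound : ∀ n s, |s| ≤ R → ‖dyson A x₀ n s‖ ≤ ‖x₀‖ * ((M * R) ^ n / n.factorial) := by
    intro n s hs
    refine (norm_dyson_le hM0 hR n hs).trans ?_
    gcongr
  have hs1 : Summable fun n : ℕ => ‖x₀‖ * ((M * R) ^ n / n.factorial) :=
    (Real.summable_pow_div_factorial _).mul_left _
  set v : ℕ → ℝ := fun n => match n with
    | 0 => 0
    | n + 1 => M * (‖x₀‖ * ((M * R) ^ n / n.factorial)) with hv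
  have hv1 : Summable v := (summable_nat_add_iff 1).1 (hs1.mul_left M)
  have hmem : t ∈ Ioo (-R) R := by
    rw [mem_Ioo, ← abs_lt]; simp [R]
  have key := hasDerivAt_tsum_of_isPreconnected (𝕜 := ℝ) (g := dyson A x₀) (g' := g') (u := v)
    hv1 (t := Ioo (-R) R) isOpen_Ioo isPreconnected_Ioo (y₀ := 0)
    (fun n y _ => by
      cases n with
      | zero => exact hasDerivAt_const y x₀
      | succ n => exact hasDerivAt_dyson_succ hA (continuous_dyson hA n) y)
    (fun n y hy => by
      have hy' : |y| ≤ R := (abs_lt.2 hy).le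
      cases n with
      | zero => simp [g', v]
      | succ n =>
        exact ((A y).le_opNorm _).trans (mul_le_mul (hR y hy') (hbound n y hy')
          (norm_nonneg _) hM0))
    (by rw [mem_Ioo, ← abs_lt, abs_zero]; positivity) hsum0.summable hmem
  have hsum : Summable fun n => dyson A x₀ n t :=
    Summable.of_norm_bounded hs1 fun n => hbound n t (abs_lt.2 hmem).le
  have hval : ∑' n, g' n t = A t (∑' n, dyson A x₀ n t) := by
    have h1 : HasSum (fun n => g' (n + 1) t) (A t (∑' n, dyson A x₀ n t)) :=
      (A t).hasSum hsum.hasSum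
    exact ((hasSum_nat_add_iff' 1).1 (by simpa [g'] using h1)).tsum_eq
  rwa [hval] at key

end LinearODE

section Mul

variable (ν : Measure ℝ) [IsFiniteMeasure ν]

/-- Multiplication of `L²` functions by bounded continuous functions. -/
def mulOp : (ℝ →ᵇ ℂ) →L[ℝ] Lp ℂ 2 ν →L[ℝ] Lp ℂ 2 ν :=
  ((ContinuousLinearMap.mul ℝ ℂ).holderL ν ∞ 2 2).comp (BoundedContinuousFunction.toLp ∞ ν ℝ)

theorem coeFn_mulOp (φ : ℝ →ᵇ ℂ) (f : Lp ℂ 2 ν) :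
    mulOp ν φ f =ᵐ[ν] fun ξ => φ ξ * f ξ := by
  have h1 := (ContinuousLinearMap.mul ℝ ℂ).coeFn_holder (r := 2)
    (BoundedContinuousFunction.toLp ∞ ν ℝ φ) f
  filter_upwards [h1, BoundedContinuousFunction.coeFn_toLp (p := ∞) (𝕜 := ℝ) ν φ] with ξ h1 h2
  rw [h2] at h1
  exact h1

theorem mulOp_mul (φ ψ : ℝ →ᵇ ℂ) (f : Lp ℂ 2 ν) :
    mulOp ν (φ * ψ) f = mulOp ν φ (mulOp ν ψ f) := by
  apply Lp.ext
  filter_upwards [coeFn_mulOp ν (φ * ψ) f, coeFn_mulOp ν φ (mulOp ν ψ f), coeFn_mulOp ν ψ f]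
    with ξ h1 h2 h3
  rw [h1, h2, h3]
  simp [mul_assoc]

theorem mulOp_one (f : Lp ℂ 2 ν) : mulOp ν 1 f = f := by
  apply Lp.ext
  filter_upwards [coeFn_mulOp ν 1 f] with ξ h1
  rw [h1]
  simp

end Mul

section Fibre

variable {ι : Type*} [Fintype ι] [DecidableEq ι]

/-- The action of a matrix with entries in `B` on vectors with entries in `F`, for an action `m` of
`B` on `F` by continuous linear maps. -/
def matOp {B F : Type*} [NormedAddCommGroup B] [NormedSpace ℝ B] [NormedAddCommGroup F]
    [NormedSpace ℝ F] (m : B →L[ℝ] F →L[ℝ] F) (α : ι → ι → B) : (ι → F) →L[ℝ] (ι → F) :=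
  ∑ i, ∑ j, (ContinuousLinearMap.single ℝ (fun _ : ι => F) i).comp
    ((m (α i j)).comp (ContinuousLinearMap.proj j))

theorem matOp_apply {B F : Type*} [NormedAddCommGroup B] [NormedSpace ℝ B] [NormedAddCommGroup F]
    [NormedSpace ℝ F] (m : B →L[ℝ] F →L[ℝ] F) (α : ι → ι → B) (x : ι → F) (i : ι) :
    matOp m α x i = ∑ j, m (α i j) (x j) := by
  simp only [matOp, sum_apply, Finset.sum_apply,
    ContinuousLinearMap.comp_apply, ContinuousLinearMap.proj_apply]
  rw [Finset.sum_eq_single i]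
  · simp
  · intro k _ hk
    simp [Pi.single_eq_of_ne' hk]
  · simp

theorem continuous_matOp {B F : Type*} [NormedAddCommGroup B] [NormedSpace ℝ B]
    [NormedAddCommGroup F] [NormedSpace ℝ F] (m : B →L[ℝ] F →L[ℝ] F) {a : ℝ → ι → ι → B}
    (ha : Continuous a) : Continuous fun s => matOp m (a s) := by
  refine continuous_finsetSum _ fun i _ => continuous_finsetSum _ fun j _ => ?_
  have h : Continuous fun s => m (a s i j) :=
    m.continuous.comp ((continuous_apply_apply i j).comp ha)
  exact continuous_const.clm_comp (h.clm_comp continuous_const)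

variable (ν : Measure ℝ) [IsFiniteMeasure ν]

/-- A linear differential equation in `L²(ν)` whose coefficients are multiplication operators is
solved fibrewise: almost every `ξ` carries a classical solution of the equation with frozen `ξ`
that connects the values at the two end points. The fundamental matrix exists as a curve of bounded
continuous functions, and it propagates the solution in `L²` by uniqueness. -/
theorem exists_fibre_solution {a : ℝ → ι → ι → ℝ →ᵇ ℂ} (ha : Continuous a) {T : ℝ} (hT : 0 ≤ T)
    {W : ℝ → ι → Lp ℂ 2 ν} (hW : ContinuousOn W (Icc 0 T))
    (hW' : ∀ s ∈ Ico 0 T, HasDerivWithinAt W (matOp (mulOp ν) (a s) (W s)) (Ici s) s) :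
    ∀ᵐ ξ ∂ν, ∃ w : ℝ → ι → ℂ,
      (∀ s i, HasDerivAt (fun r => w r i) (∑ m, a s i m ξ * w s m) s) ∧
      (∀ i, w 0 i = W 0 i ξ) ∧ ∀ i, w T i = W T i ξ := by
  choose Φ hΦ0 hΦ using fun j : ι => exists_hasDerivAt_linear
    (continuous_matOp (ContinuousLinearMap.mul ℝ (ℝ →ᵇ ℂ)) ha) (Pi.single j 1)
  have hΦ' : ∀ j i s, HasDerivAt (fun r => Φ j r i) (∑ m, a s i m * Φ j s m) s := by
    intro j i s
    have := hasDerivAt_pi.1 (hΦ j s) i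
    rwa [matOp_apply] at this
  set Z : ℝ → ι → Lp ℂ 2 ν := fun s i => ∑ j, mulOp ν (Φ j s i) (W 0 j) with hZ
  have hZ' : ∀ s, HasDerivAt Z (matOp (mulOp ν) (a s) (Z s)) s := by
    intro s
    refine hasDerivAt_pi.2 fun i => ?_
    have h1 : HasDerivAt (fun r => ∑ j, mulOp ν (Φ j r i) (W 0 j))
        (∑ j, mulOp ν (∑ m, a s i m * Φ j s m) (W 0 j)) s :=
      HasDerivAt.fun_sum fun j _ =>
        (((mulOp ν).hasFDerivAt.comp_hasDerivAt s (hΦ' j i s)).clm_apply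
          (hasDerivAt_const s (W 0 j))).congr_deriv (by simp)
    refine h1.congr_deriv ?_
    rw [matOp_apply]
    simp only [hZ, map_sum, sum_apply, mulOp_mul]
    exact Finset.sum_comm
  have hZ0 : W 0 = Z 0 := by
    funext i
    simp only [hZ, hΦ0]
    rw [Finset.sum_eq_single i]
    · simp [mulOp_one]
    · intro k _ hk
      simp [Pi.single_eq_of_ne' hk]
    · simp
  obtain ⟨K, hK⟩ : ∃ K, ∀ s ∈ Icc 0 T, ‖matOp (mulOp ν) (a s)‖ ≤ K :=
    isCompact_Icc.exists_bound_of_continuousOn (continuous_matOp (mulOp ν) ha).continuousOn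
  have hEq : EqOn W Z (Icc 0 T) := by
    refine ODE_solution_unique_of_mem_Icc_right (K := K.toNNReal)
      (v := fun s => matOp (mulOp ν) (a s)) (s := fun _ => univ) (fun s hs => ?_) hW hW'
      (fun _ _ => mem_univ _) (fun s _ => (hZ' s).continuousAt.continuousWithinAt)
      (fun s _ => (hZ' s).hasDerivWithinAt) (fun _ _ => mem_univ _) hZ0
    refine ((matOp (mulOp ν) (a s)).lipschitz.weaken ?_).lipschitzOnWith
    rw [← NNReal.coe_le_coe]
    exact (hK s (Ico_subset_Icc_self hs)).trans (Real.le_coe_toNNReal K)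
  have hae : ∀ᵐ ξ ∂ν, ∀ i, W T i ξ = ∑ j, Φ j T i ξ * W 0 j ξ := by
    refine ae_all_iff.2 fun i => ?_
    have h1 : W T i = ∑ j, mulOp ν (Φ j T i) (W 0 j) := congrFun (hEq (right_mem_Icc.2 hT)) i
    have h2 := ae_all_iff.2 fun j => coeFn_mulOp ν (Φ j T i) (W 0 j)
    rw [h1]
    filter_upwards [h2, Lp.coeFn_finsetSum Finset.univ fun j => mulOp ν (Φ j T i) (W 0 j)]
      with ξ h2 h3
    rw [h3, Finset.sum_apply]
    exact Finset.sum_congr rfl fun j _ => h2 j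
  filter_upwards [hae] with ξ hξ
  refine ⟨fun s i => ∑ j, Φ j s i ξ * W 0 j ξ, fun s i => ?_, fun i => ?_, fun i => (hξ i).symm⟩
  · have h1 : ∀ j, HasDerivAt (fun r => Φ j r i ξ) (∑ m, a s i m ξ * Φ j s m ξ) s := by
      intro j
      have := ((BoundedContinuousFunction.evalCLM ℝ ξ).hasFDerivAt (x := Φ j s i)).comp_hasDerivAt s
        (hΦ' j i s)
      simpa [Function.comp_def] using this
    refine (HasDerivAt.fun_sum fun j _ => (h1 j).mul_const (W 0 j ξ)).congr_deriv ?_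
    simp only [Finset.sum_mul, Finset.mul_sum, mul_assoc]
    exact Finset.sum_comm
  · simp only [hΦ0]
    rw [Finset.sum_eq_single i]
    · simp
    · intro k _ hk
      simp [Pi.single_eq_of_ne' hk]
    · simp

end Fibre

end Couette

/-! ### Test functions and the Fourier transform on the line -/

namespace Couette

open Filter Topology FourierTransform
open scoped SchwartzMap

/-- The complex Hilbert space `L²(ℝ)`. -/
abbrev L2R : Type := Lp ℂ 2 (volume : Measure ℝ)

/-- Complex test functions on the line. -/
structure IsLineTest (ψ : ℝ → ℂ) : Prop where
  smooth : ContDiff ℝ ∞ ψ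
  compact : HasCompactSupport ψ

namespace IsLineTest

variable {ψ : ℝ → ℂ}

theorem continuous (h : IsLineTest ψ) : Continuous ψ := h.smooth.continuous

theorem differentiable (h : IsLineTest ψ) : Differentiable ℝ ψ := h.smooth.differentiable (by simp)

theorem hasDerivAt (h : IsLineTest ψ) (y : ℝ) : HasDerivAt ψ (deriv ψ y) y :=
  (h.differentiable y).hasDerivAt

theorem memLp (h : IsLineTest ψ) {p : ℝ≥0∞} : MemLp ψ p volume :=
  h.continuous.memLp_of_hasCompactSupport h.compact

theorem deriv (h : IsLineTest ψ) : IsLineTest (deriv ψ) :=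
  ⟨(contDiff_infty_iff_deriv.1 h.smooth).2, h.compact.deriv⟩

theorem smooth_mul (h : IsLineTest ψ) {g : ℝ → ℂ} (hg : ContDiff ℝ ∞ g) :
    IsLineTest fun y => g y * ψ y :=
  ⟨hg.mul h.smooth, h.compact.mul_left⟩

theorem const_mul (h : IsLineTest ψ) (c : ℂ) : IsLineTest fun y => c * ψ y :=
  h.smooth_mul contDiff_const

theorem id_mul (h : IsLineTest ψ) : IsLineTest fun y => (y : ℂ) * ψ y :=
  h.smooth_mul Complex.ofRealCLM.contDiff

/-- A test function as a Schwartz function. -/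
def toSchwartz (h : IsLineTest ψ) : 𝓢(ℝ, ℂ) := h.compact.toSchwartzMap h.smooth

theorem toSchwartz_apply (h : IsLineTest ψ) (y : ℝ) : h.toSchwartz y = ψ y := rfl

end IsLineTest

theorem integrable_mul_of_memLp {α : Type*} [MeasurableSpace α] {μ : Measure α} {f g : α → ℂ}
    (hf : MemLp f 2 μ) (hg : MemLp g 2 μ) : Integrable (fun x => f x * g x) μ :=
  memLp_one_iff_integrable.1 (MemLp.mul hg hf)

/-- Cutting off a Schwartz function: test functions approximate it, together with its first two
derivatives, weakly in `L²`. -/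
theorem exists_tendsto_lineTest (ψ : 𝓢(ℝ, ℂ)) : ∃ ψn : ℕ → ℝ → ℂ, (∀ n, IsLineTest (ψn n)) ∧
    ∀ F : ℝ → ℂ, MemLp F 2 volume →
      Tendsto (fun n => ∫ y, F y * ψn n y) atTop (𝓝 (∫ y, F y * ψ y)) ∧
      Tendsto (fun n => ∫ y, F y * deriv (ψn n) y) atTop (𝓝 (∫ y, F y * deriv ψ y)) ∧
      Tendsto (fun n => ∫ y, F y * deriv (deriv (ψn n)) y) atTop
        (𝓝 (∫ y, F y * deriv (deriv ψ) y)) := by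
  set η : ContDiffBump (0 : ℝ) := ⟨1, 2, one_pos, one_lt_two⟩
  set θ : ℝ → ℂ := fun y => (η y : ℂ) with hθdef
  have hθ : IsLineTest θ :=
    ⟨Complex.ofRealCLM.contDiff.comp η.contDiff, η.hasCompactSupport.comp_left Complex.ofReal_zero⟩
  have hθ0 : θ 0 = 1 := by
    simp [hθdef, η.one_of_mem_closedBall (Metric.mem_closedBall_self zero_le_one)]
  obtain ⟨M₀, hM₀⟩ := hθ.continuous.bounded_above_of_compact_support hθ.compact
  obtain ⟨M₁, hM₁⟩ := hθ.deriv.continuous.bounded_above_of_compact_support hθ.deriv.compact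
  obtain ⟨M₂, hM₂⟩ :=
    hθ.deriv.deriv.continuous.bounded_above_of_compact_support hθ.deriv.deriv.compact
  set ψ₁ : 𝓢(ℝ, ℂ) := SchwartzMap.derivCLM ℂ ℂ ψ with hψ₁
  set ψ₂ : 𝓢(ℝ, ℂ) := SchwartzMap.derivCLM ℂ ℂ ψ₁ with hψ₂
  have hd1 : deriv ψ = ψ₁ := by funext y; simp [hψ₁]
  have hd2 : deriv (deriv ψ) = ψ₂ := by rw [hd1]; funext y; simp [hψ₂]
  have hD1 : ∀ y, HasDerivAt ψ (ψ₁ y) y := fun y => by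
    rw [← hd1]; exact ψ.differentiableAt.hasDerivAt
  have hD2 : ∀ y, HasDerivAt ψ₁ (ψ₂ y) y := fun y => by
    rw [← hd2, hd1]; exact ψ₁.differentiableAt.hasDerivAt
  -- the cutoff at scale `1 / h` and its derivatives
  set g₀ : ℝ → ℝ → ℂ := fun h y => θ (h * y) * ψ y with hg₀
  set g₁ : ℝ → ℝ → ℂ := fun h y => h * deriv θ (h * y) * ψ y + θ (h * y) * ψ₁ y with hg₁
  set g₂ : ℝ → ℝ → ℂ := fun h y => h ^ 2 * deriv (deriv θ) (h * y) * ψ y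
    + 2 * (h * deriv θ (h * y) * ψ₁ y) + θ (h * y) * ψ₂ y with hg₂
  have hs : ∀ {f : ℝ → ℂ}, IsLineTest f → ∀ h y : ℝ,
      HasDerivAt (fun y => f (h * y)) (h * deriv f (h * y)) y := by
    intro f hf h y
    have := (hf.hasDerivAt (h * y)).scomp y ((hasDerivAt_id y).const_mul h)
    simpa [Function.comp_def] using this
  have hgd1 : ∀ h, deriv (g₀ h) = g₁ h := fun h => by
    funext y; exact ((hs hθ h y).mul (hD1 y)).deriv
  have hgd2 : ∀ h, deriv (deriv (g₀ h)) = g₂ h := fun h => by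
    rw [hgd1]
    funext y
    refine (((((hs hθ.deriv h y).const_mul (h : ℂ)).mul (hD1 y)).add
      ((hs hθ h y).mul (hD2 y))).congr_deriv ?_).deriv
    simp only [hg₂]
    ring
  have htest : ∀ h : ℝ, h ≠ 0 → IsLineTest (g₀ h) := by
    intro h hh
    refine ⟨(hθ.smooth.comp (contDiff_const.mul contDiff_id)).mul (ψ.smooth ⊤),
      HasCompactSupport.mul_right ?_⟩
    exact hθ.compact.comp_homeomorph (Homeomorph.mulLeft₀ h hh)
  set hn : ℕ → ℝ := fun n => 1 / ((n : ℝ) + 1) with hhn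
  have hn0 : Tendsto hn atTop (𝓝 0) := tendsto_one_div_add_atTop_nhds_zero_nat
  have hnle : ∀ n, |hn n| ≤ 1 := fun n => by
    rw [abs_of_nonneg (by positivity)]
    exact div_le_one_of_le₀ (by simp) (by positivity)
  have hM₀' : 0 ≤ M₀ := (norm_nonneg _).trans (hM₀ 0)
  have hM₁' : 0 ≤ M₁ := (norm_nonneg _).trans (hM₁ 0)
  have hM₂' : 0 ≤ M₂ := (norm_nonneg _).trans (hM₂ 0)
  have hθ1c := hθ.deriv.continuous
  have hθ2c := hθ.deriv.deriv.continuous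
  have hθc := hθ.continuous
  have main : ∀ (F : ℝ → ℂ), MemLp F 2 volume → ∀ (g : ℝ → ℝ → ℂ) (D : ℝ → ℂ),
      MemLp D 2 volume → (∀ h, |h| ≤ 1 → ∀ y, ‖g h y‖ ≤ ‖D y‖) → Continuous (Function.uncurry g) →
      Tendsto (fun n => ∫ y, F y * g (hn n) y) atTop (𝓝 (∫ y, F y * g 0 y)) := by
    intro F hF g D hD hgD hg
    refine tendsto_integral_of_dominated_convergence (fun y => ‖F y * D y‖) (fun n => ?_)
      (integrable_mul_of_memLp hF hD).norm (fun n => Eventually.of_forall fun y => ?_)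
      (Eventually.of_forall fun y => ?_)
    · exact hF.1.mul (hg.comp (Continuous.prodMk_right (hn n))).aestronglyMeasurable
    · rw [norm_mul, norm_mul]
      exact mul_le_mul_of_nonneg_left (hgD _ (hnle n) y) (norm_nonneg _)
    · exact (((hg.comp (Continuous.prodMk_left y)).tendsto 0).comp hn0).const_mul (F y)
  have hL : ∀ φ : 𝓢(ℝ, ℂ), MemLp (fun y => (‖φ y‖ : ℂ)) 2 volume := fun φ =>
    (φ.memLp 2 volume).norm.ofReal
  have hcψ := ψ.continuous
  have hcψ₁ := ψ₁.continuous
  have hcψ₂ := ψ₂.continuous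
  refine ⟨fun n => g₀ (hn n), fun n => htest _ (by positivity), fun F hF => ⟨?_, ?_, ?_⟩⟩
  · have := main F hF g₀ (fun y => M₀ * ‖ψ y‖) ((hL ψ).const_mul _) (fun h hh y => ?_)
      (by simp only [hg₀, Function.uncurry_def]; fun_prop)
    · simpa [hg₀, hθ0] using this
    · rw [norm_mul, norm_mul, Complex.norm_real M₀, Complex.norm_real ‖ψ y‖, norm_norm,
        Real.norm_of_nonneg hM₀']
      exact mul_le_mul_of_nonneg_right (hM₀ _) (norm_nonneg _)
  · simp only [hgd1, hd1]
    have := main F hF g₁ (fun y => M₁ * ‖ψ y‖ + M₀ * ‖ψ₁ y‖)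
      (((hL ψ).const_mul _).add ((hL ψ₁).const_mul _)) (fun h hh y => ?_)
      (by simp only [hg₁, Function.uncurry_def]; fun_prop)
    · simpa [hg₁, hθ0] using this
    · have e : ((M₁ : ℂ) * ‖ψ y‖ + M₀ * ‖ψ₁ y‖) = ((M₁ * ‖ψ y‖ + M₀ * ‖ψ₁ y‖ : ℝ) : ℂ) := by
        push_cast; ring
      rw [e, Complex.norm_real, Real.norm_of_nonneg (by positivity)]
      refine (norm_add_le _ _).trans (add_le_add ?_ ?_)
      · rw [norm_mul, norm_mul, Complex.norm_real, Real.norm_eq_abs]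
        refine mul_le_mul_of_nonneg_right ?_ (norm_nonneg _)
        calc |h| * ‖deriv θ (h * y)‖ ≤ 1 * M₁ := mul_le_mul hh (hM₁ _) (norm_nonneg _) zero_le_one
          _ = M₁ := one_mul _
      · rw [norm_mul]
        exact mul_le_mul_of_nonneg_right (hM₀ _) (norm_nonneg _)
  · simp only [hgd2, hd2]
    have := main F hF g₂ (fun y => M₂ * ‖ψ y‖ + 2 * (M₁ * ‖ψ₁ y‖) + M₀ * ‖ψ₂ y‖)
      ((((hL ψ).const_mul _).add (((hL ψ₁).const_mul _).const_mul _)).add ((hL ψ₂).const_mul _))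
      (fun h hh y => ?_)
      (by simp only [hg₂, Function.uncurry_def]; fun_prop)
    · simpa [hg₂, hθ0] using this
    · have e : ((M₂ : ℂ) * ‖ψ y‖ + 2 * (M₁ * ‖ψ₁ y‖) + M₀ * ‖ψ₂ y‖)
          = ((M₂ * ‖ψ y‖ + 2 * (M₁ * ‖ψ₁ y‖) + M₀ * ‖ψ₂ y‖ : ℝ) : ℂ) := by
        push_cast; ring
      rw [e, Complex.norm_real, Real.norm_of_nonneg (by positivity)]
      have hh2 : |h| ^ 2 ≤ 1 := pow_le_one₀ (abs_nonneg _) hh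
      refine (norm_add₃_le).trans (add_le_add (add_le_add ?_ ?_) ?_)
      · rw [norm_mul, norm_mul, norm_pow, Complex.norm_real, Real.norm_eq_abs]
        refine mul_le_mul_of_nonneg_right ?_ (norm_nonneg _)
        calc |h| ^ 2 * ‖deriv (deriv θ) (h * y)‖ ≤ 1 * M₂ :=
              mul_le_mul hh2 (hM₂ _) (norm_nonneg _) zero_le_one
          _ = M₂ := one_mul _
      · rw [norm_mul, norm_mul, norm_mul, Complex.norm_real, Real.norm_eq_abs, Complex.norm_ofNat]
        refine mul_le_mul_of_nonneg_left (mul_le_mul_of_nonneg_right ?_ (norm_nonneg _)) zero_le_two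
        calc |h| * ‖deriv θ (h * y)‖ ≤ 1 * M₁ := mul_le_mul hh (hM₁ _) (norm_nonneg _) zero_le_one
          _ = M₁ := one_mul _
      · rw [norm_mul]
        exact mul_le_mul_of_nonneg_right (hM₀ _) (norm_nonneg _)

theorem integral_fourier_mul (F : L2R) (φ : 𝓢(ℝ, ℂ)) :
    ∫ ξ, (𝓕 F : L2R) ξ * φ ξ = ∫ y, F y * 𝓕 (φ : ℝ → ℂ) y := by
  have h := congrArg (fun T => T φ) (Lp.fourier_toTemperedDistribution_eq F)
  simp only [TemperedDistribution.fourier_apply, Lp.toTemperedDistribution_apply,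
    SchwartzMap.fourier_coe, smul_eq_mul] at h
  simp only [mul_comm _ (φ _), mul_comm _ (𝓕 (φ : ℝ → ℂ) _), ← h]

theorem deriv_fourier_lineTest {φ : ℝ → ℂ} (h : IsLineTest φ) :
    deriv (𝓕 φ) = 𝓕 fun x : ℝ => (-2 * Real.pi * Complex.I) * (x * φ x) := by
  rw [Real.deriv_fourier (memLp_one_iff_integrable.1 h.memLp)]
  · congr 1
    funext x
    rw [smul_eq_mul]; ring
  · simpa using memLp_one_iff_integrable.1 h.id_mul.memLp

/-- An identity between functions in `L²(ℝ)` and their weak derivatives, in terms of the Fourier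
transforms. -/
theorem fourier_ae_eq_of_weak {A B₀ B₁ B₂ : L2R}
    (h : ∀ ψ : ℝ → ℂ, IsLineTest ψ → ∫ y, A y * ψ y
      = (∫ y, B₀ y * ψ y) + (∫ y, B₁ y * deriv ψ y) + ∫ y, B₂ y * deriv (deriv ψ) y) :
    (𝓕 A : L2R) =ᵐ[volume] fun ξ => (𝓕 B₀ : L2R) ξ
      + (-2 * Real.pi * Complex.I * ξ) * (𝓕 B₁ : L2R) ξ
      + (-2 * Real.pi * Complex.I * ξ) ^ 2 * (𝓕 B₂ : L2R) ξ := by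
  have hS : ∀ ψ : 𝓢(ℝ, ℂ), ∫ y, A y * ψ y
      = (∫ y, B₀ y * ψ y) + (∫ y, B₁ y * deriv ψ y) + ∫ y, B₂ y * deriv (deriv ψ) y := by
    intro ψ
    obtain ⟨ψn, hψn, hlim⟩ := exists_tendsto_lineTest ψ
    refine tendsto_nhds_unique (hlim A (Lp.memLp A)).1 ?_
    simp only [fun n => h (ψn n) (hψn n)]
    exact ((hlim B₀ (Lp.memLp B₀)).1.add (hlim B₁ (Lp.memLp B₁)).2.1).add
      (hlim B₂ (Lp.memLp B₂)).2.2
  have hloc : ∀ F : L2R, LocallyIntegrable F volume := fun F =>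
    (Lp.memLp F).locallyIntegrable one_le_two
  refine ae_eq_of_integral_contDiff_smul_eq (hloc _)
    (((hloc _).add ?_).add ?_) fun g hg hgc => ?_
  · exact (hloc (𝓕 B₁)).continuous_smul
      (g := fun ξ : ℝ => -2 * Real.pi * Complex.I * (ξ : ℂ)) (by fun_prop)
  · exact (hloc (𝓕 B₂)).continuous_smul
      (g := fun ξ : ℝ => (-2 * Real.pi * Complex.I * (ξ : ℂ)) ^ 2) (by fun_prop)
  set φ : ℝ → ℂ := fun x => (g x : ℂ) with hφ
  have h0 : IsLineTest φ :=
    ⟨Complex.ofRealCLM.contDiff.comp hg, hgc.comp_left Complex.ofReal_zero⟩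
  have h1 := h0.id_mul.const_mul (-2 * Real.pi * Complex.I)
  have h2 := h1.id_mul.const_mul (-2 * Real.pi * Complex.I)
  have key := hS (𝓕 h0.toSchwartz)
  have e0 : ((𝓕 h0.toSchwartz : 𝓢(ℝ, ℂ)) : ℝ → ℂ) = 𝓕 φ := SchwartzMap.fourier_coe _
  rw [e0, deriv_fourier_lineTest h0, deriv_fourier_lineTest h1] at key
  have f0 : ∀ F : L2R, ∫ y, F y * 𝓕 φ y = ∫ ξ, (𝓕 F : L2R) ξ * φ ξ := fun F =>
    (integral_fourier_mul F h0.toSchwartz).symm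
  have f1 := (integral_fourier_mul B₁ h1.toSchwartz).symm
  have f2 := (integral_fourier_mul B₂ h2.toSchwartz).symm
  simp only [IsLineTest.toSchwartz_apply] at f1 f2
  have f1' : ((h1.toSchwartz : 𝓢(ℝ, ℂ)) : ℝ → ℂ)
    = fun x : ℝ => (-2 * Real.pi * Complex.I) * (x * φ x) := rfl
  have f2' : ((h2.toSchwartz : 𝓢(ℝ, ℂ)) : ℝ → ℂ)
    = fun x : ℝ =>
      (-2 * Real.pi * Complex.I) * (x * ((-2 * Real.pi * Complex.I) * (x * φ x))) := rfl
  rw [f1'] at f1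
  rw [f2'] at f2
  rw [f0, f0, f1, f2] at key
  have i0 := integrable_mul_of_memLp (Lp.memLp (𝓕 B₀ : L2R)) h0.memLp
  have i1 := integrable_mul_of_memLp (Lp.memLp (𝓕 B₁ : L2R)) h1.memLp
  have i2 := integrable_mul_of_memLp (Lp.memLp (𝓕 B₂ : L2R)) h2.memLp
  have i01 : Integrable (fun ξ => (𝓕 B₀ : L2R) ξ * φ ξ
    + (𝓕 B₁ : L2R) ξ * ((-2 * Real.pi * Complex.I) * (ξ * φ ξ))) := i0.add i1
  rw [← integral_add i0 i1, ← integral_add i01 i2] at key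
  convert key using 2
  · funext ξ
    rw [Complex.real_smul, mul_comm]
  · funext ξ
    rw [Complex.real_smul]
    simp only [hφ]
    ring

end Couette

/-! ### Modulations in `L²(ℝ)` -/

namespace Couette

open Filter Topology FourierTransform
open Complex (I)
open scoped BoundedContinuousFunction

theorem norm_sq_eq_integral {α : Type*} [MeasurableSpace α] {μ : Measure α} (f : Lp ℂ 2 μ) :
    ‖f‖ ^ 2 = ∫ x, ‖f x‖ ^ 2 ∂μ := by
  have h := L2.inner_def (𝕜 := ℂ) f f
  rw [inner_self_eq_norm_sq_to_K] at h
  simp only [inner_self_eq_norm_sq_to_K] at h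
  have h2 : ((‖f‖ ^ 2 : ℝ) : ℂ) = ((∫ x, ‖f x‖ ^ 2 ∂μ : ℝ) : ℂ) := by
    rw [← integral_complex_ofReal]
    push_cast
    exact h
  exact_mod_cast h2

/-- The oscillation `e^{i a y}`. -/
def osc (a y : ℝ) : ℂ := Complex.exp (I * (a * y : ℝ))

theorem norm_osc (a y : ℝ) : ‖osc a y‖ = 1 := by
  rw [osc, mul_comm]; exact Complex.norm_exp_ofReal_mul_I _

theorem contDiff_osc (a : ℝ) : ContDiff ℝ ∞ (osc a) :=
  (contDiff_const.mul (Complex.ofRealCLM.contDiff.comp (contDiff_const.mul contDiff_id))).cexp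

theorem hasDerivAt_osc (a y : ℝ) : HasDerivAt (osc a) (I * a * osc a y) y := by
  have h := (((hasDerivAt_id y).const_mul a).ofReal_comp.const_mul I).cexp
  simp only [id, mul_one] at h
  exact h.congr_deriv (by rw [osc]; ring)

theorem continuous_osc_left (y : ℝ) : Continuous fun a => osc a y := by
  unfold osc; fun_prop

theorem memLp_osc_mul (a : ℝ) (F : L2R) : MemLp (fun y => osc a y * F y) 2 volume :=
  (Lp.memLp F).congr_norm ((contDiff_osc a).continuous.aestronglyMeasurable.mul
    (Lp.aestronglyMeasurable F)) (Eventually.of_forall fun y => by simp [norm_osc])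

/-- Multiplication by `e^{i a y}` on `L²(ℝ)`. -/
def modul (a : ℝ) : L2R →ₗᵢ[ℂ] L2R where
  toFun F := (memLp_osc_mul a F).toLp _
  map_add' F G := by
    apply Lp.ext
    filter_upwards [(memLp_osc_mul a F).coeFn_toLp, (memLp_osc_mul a G).coeFn_toLp,
      (memLp_osc_mul a (F + G)).coeFn_toLp, Lp.coeFn_add F G,
      Lp.coeFn_add ((memLp_osc_mul a F).toLp _) ((memLp_osc_mul a G).toLp _)] with y h1 h2 h3 h4 h5
    rw [h3, h5, Pi.add_apply, h1, h2, h4, Pi.add_apply, mul_add]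
  map_smul' c F := by
    apply Lp.ext
    filter_upwards [(memLp_osc_mul a F).coeFn_toLp, (memLp_osc_mul a (c • F)).coeFn_toLp,
      Lp.coeFn_smul c F, Lp.coeFn_smul c ((memLp_osc_mul a F).toLp _)] with y h1 h2 h3 h4
    rw [h2, RingHom.id_apply, h4, Pi.smul_apply, h1, h3, Pi.smul_apply, smul_eq_mul, smul_eq_mul]
    ring
  norm_map' F := by
    change ‖(memLp_osc_mul a F).toLp _‖ = ‖F‖
    rw [Lp.norm_def, Lp.norm_def, eLpNorm_congr_ae (memLp_osc_mul a F).coeFn_toLp]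
    congr 1
    exact eLpNorm_congr_norm_ae (Eventually.of_forall fun y => by simp [norm_osc])

theorem coeFn_modul (a : ℝ) (F : L2R) : modul a F =ᵐ[volume] fun y => osc a y * F y :=
  (memLp_osc_mul a F).coeFn_toLp

theorem modul_zero (F : L2R) : modul 0 F = F := by
  apply Lp.ext
  filter_upwards [coeFn_modul 0 F] with y hy
  simp [hy, osc]

theorem integral_modul_mul (a : ℝ) (F : L2R) (ψ : ℝ → ℂ) :
    ∫ y, modul a F y * ψ y = ∫ y, F y * (osc a y * ψ y) := by
  refine integral_congr_ae ?_
  filter_upwards [coeFn_modul a F] with y hy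
  rw [hy]; ring

theorem continuous_modul_left (F : L2R) : Continuous fun a => modul a F := by
  refine continuous_iff_continuousAt.2 fun a₀ => ?_
  rw [ContinuousAt, tendsto_iff_norm_sub_tendsto_zero]
  have key : Tendsto (fun a => ‖modul a F - modul a₀ F‖ ^ 2) (𝓝 a₀) (𝓝 0) := by
    have h1 : ∀ a, ‖modul a F - modul a₀ F‖ ^ 2
        = ∫ y, ‖(osc a y - osc a₀ y) * F y‖ ^ 2 := by
      intro a
      rw [norm_sq_eq_integral]
      refine integral_congr_ae ?_
      filter_upwards [coeFn_modul a F, coeFn_modul a₀ F, Lp.coeFn_sub (modul a F) (modul a₀ F)]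
        with y h1 h2 h3
      rw [h3, Pi.sub_apply, h1, h2, sub_mul]
    simp only [h1]
    have h2 : (0 : ℝ) = ∫ y : ℝ, ‖(osc a₀ y - osc a₀ y) * F y‖ ^ 2 := by simp
    rw [h2]
    have hF : Integrable (fun y => 4 * ‖F y‖ ^ 2) volume :=
      ((memLp_two_iff_integrable_sq_norm (Lp.aestronglyMeasurable F)).1 (Lp.memLp F)).const_mul 4
    refine tendsto_integral_filter_of_dominated_convergence (fun y => 4 * ‖F y‖ ^ 2)
      (Eventually.of_forall fun a => ?_) (Eventually.of_forall fun a => Eventually.of_forall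
        fun y => ?_) hF (Eventually.of_forall fun y => ?_)
    · exact ((((contDiff_osc a).continuous.sub
        (contDiff_osc a₀).continuous).aestronglyMeasurable.mul (Lp.aestronglyMeasurable F)).norm.pow
          2)
    · rw [Real.norm_of_nonneg (by positivity), norm_mul, mul_pow]
      have h3 : ‖osc a y - osc a₀ y‖ ≤ 2 :=
        (norm_sub_le _ _).trans (by rw [norm_osc, norm_osc]; norm_num)
      have h4 : ‖osc a y - osc a₀ y‖ ^ 2 ≤ 4 := by
        nlinarith [norm_nonneg (osc a y - osc a₀ y)]
      exact mul_le_mul_of_nonneg_right h4 (by positivity)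
    · have := continuous_osc_left y
      exact Continuous.tendsto (by fun_prop) a₀
  have h5 := key.sqrt
  simpa [Real.sqrt_sq (norm_nonneg _)] using h5

theorem continuous_modul : Continuous fun p : ℝ × L2R => modul p.1 p.2 := by
  refine continuous_iff_continuousAt.2 fun p => ?_
  rw [ContinuousAt, tendsto_iff_norm_sub_tendsto_zero]
  have h1 : Tendsto (fun q : ℝ × L2R => ‖q.2 - p.2‖ + ‖modul q.1 p.2 - modul p.1 p.2‖) (𝓝 p)
      (𝓝 (‖p.2 - p.2‖ + ‖modul p.1 p.2 - modul p.1 p.2‖)) := by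
    have h2 : Continuous fun q : ℝ × L2R => modul q.1 p.2 :=
      (continuous_modul_left p.2).comp continuous_fst
    exact Continuous.tendsto (by fun_prop) p
  rw [sub_self, sub_self, norm_zero, add_zero] at h1
  refine squeeze_zero (fun _ => norm_nonneg _) (fun q => ?_) h1
  calc ‖modul q.1 q.2 - modul p.1 p.2‖
      = ‖modul q.1 (q.2 - p.2) + (modul q.1 p.2 - modul p.1 p.2)‖ := by
        rw [map_sub]; congr 1; abel
    _ ≤ ‖modul q.1 (q.2 - p.2)‖ + ‖modul q.1 p.2 - modul p.1 p.2‖ := norm_add_le _ _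
    _ = _ := by rw [LinearIsometry.norm_map]

/-- The bilinear pairing `∫ F G` on `L²(ℝ)`. -/
def linePairing : L2R →L[ℂ] L2R →L[ℂ] ℂ := (ContinuousLinearMap.mul ℂ ℂ).lpPairing volume 2 2

theorem linePairing_toLp (F : L2R) {ψ : ℝ → ℂ} (hψ : MemLp ψ 2 volume) :
    linePairing F (hψ.toLp ψ) = ∫ y, F y * ψ y := by
  rw [linePairing, ContinuousLinearMap.lpPairing_eq_integral]
  refine integral_congr_ae ?_
  filter_upwards [hψ.coeFn_toLp] with y hy
  simp [hy]

theorem norm_exp_I_mul_sub_le (x : ℝ) : ‖Complex.exp (I * x) - 1 - I * x‖ ≤ 3 * x ^ 2 := by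
  have hx : ‖I * (x : ℂ)‖ = |x| := by simp
  rcases le_total |x| 1 with h | h
  · have := Complex.norm_exp_sub_one_sub_id_le (x := I * x) (by rwa [hx])
    rw [hx, sq_abs] at this
    nlinarith [sq_nonneg x]
  · have h1 : ‖Complex.exp (I * x)‖ = 1 := by rw [mul_comm]; exact Complex.norm_exp_ofReal_mul_I _
    calc ‖Complex.exp (I * x) - 1 - I * x‖
        ≤ ‖Complex.exp (I * x)‖ + ‖(1 : ℂ)‖ + ‖I * (x : ℂ)‖ :=
          (norm_sub_le _ _).trans (by gcongr; exact norm_sub_le _ _)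
      _ = 2 + |x| := by rw [h1, hx, norm_one]; ring
      _ ≤ 3 * x ^ 2 := by rw [← sq_abs]; nlinarith

theorem hasDerivAt_of_norm_sub_le {E : Type*} [NormedAddCommGroup E] [NormedSpace ℝ E]
    {f : ℝ → E} {f' : E} {x C : ℝ}
    (h : ∀ y, ‖f y - f x - (y - x) • f'‖ ≤ C * (y - x) ^ 2) : HasDerivAt f f' x := by
  rw [hasDerivAt_iff_isLittleO]
  refine Asymptotics.IsBigO.trans_isLittleO (g := fun y => ‖y - x‖ ^ 2)
    (Asymptotics.IsBigO.of_bound C (Eventually.of_forall fun y => ?_))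
    (Asymptotics.isLittleO_pow_sub_sub x one_lt_two)
  rw [norm_pow, norm_norm, Real.norm_eq_abs, sq_abs]
  exact h y

theorem IsLineTest.osc_mul {ψ : ℝ → ℂ} (h : IsLineTest ψ) (a : ℝ) :
    IsLineTest fun y => osc a y * ψ y :=
  h.smooth_mul (contDiff_osc a)

/-- The modulated test function is differentiable in the modulation, as a curve in `L²(ℝ)`. -/
theorem hasDerivAt_toLp_osc_mul {ψ : ℝ → ℂ} (h : IsLineTest ψ) (k s : ℝ) :
    HasDerivAt (fun r => ((h.osc_mul (k * r)).memLp.toLp _ : L2R))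
      (((h.osc_mul (k * s)).id_mul.const_mul (I * k)).memLp.toLp _) s := by
  have hq : IsLineTest fun y : ℝ => (3 * k ^ 2 : ℂ) * (y * (y * ψ y)) :=
    h.id_mul.id_mul.const_mul _
  refine hasDerivAt_of_norm_sub_le (C := ‖(hq.memLp.toLp _ : L2R)‖) fun r => ?_
  have h0 : ‖(hq.memLp.toLp _ : L2R)‖ * (r - s) ^ 2
      = ‖(((r - s) ^ 2 : ℝ)) • (hq.memLp.toLp _ : L2R)‖ := by
    rw [norm_smul, Real.norm_of_nonneg (sq_nonneg _), mul_comm]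
  rw [h0]
  refine Lp.norm_le_norm_of_ae_le ?_
  set A : L2R := (h.osc_mul (k * r)).memLp.toLp _ with hA
  set B : L2R := (h.osc_mul (k * s)).memLp.toLp _ with hB
  set D : L2R := ((h.osc_mul (k * s)).id_mul.const_mul (I * k)).memLp.toLp _ with hD
  set Q : L2R := hq.memLp.toLp _ with hQ
  filter_upwards [(h.osc_mul (k * r)).memLp.coeFn_toLp, (h.osc_mul (k * s)).memLp.coeFn_toLp,
    ((h.osc_mul (k * s)).id_mul.const_mul (I * k)).memLp.coeFn_toLp, hq.memLp.coeFn_toLp,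
    Lp.coeFn_sub (A - B) ((r - s) • D), Lp.coeFn_sub A B, Lp.coeFn_smul (r - s) D,
    Lp.coeFn_smul ((r - s) ^ 2) Q] with y h1 h2 h3 h4 h5 h6 h7 h8
  rw [h5, Pi.sub_apply, h6, h7, h8, Pi.sub_apply, Pi.smul_apply, Pi.smul_apply, hA, hB, hD, hQ,
    h1, h2, h3, h4, Complex.real_smul, Complex.real_smul]
  have e1 : osc (k * r) y = osc (k * s) y * Complex.exp (I * ((k * (r - s) * y : ℝ) : ℂ)) := by
    rw [osc, osc, ← Complex.exp_add]
    congr 1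
    push_cast
    ring
  have e2 : osc (k * r) y * ψ y - osc (k * s) y * ψ y
      - ((r - s : ℝ) : ℂ) * (I * k * (y * (osc (k * s) y * ψ y)))
      = osc (k * s) y * ψ y * (Complex.exp (I * ((k * (r - s) * y : ℝ) : ℂ)) - 1
        - I * ((k * (r - s) * y : ℝ) : ℂ)) := by
    rw [e1]; push_cast; ring
  rw [e2, norm_mul, norm_mul, norm_osc, one_mul]
  calc ‖ψ y‖ * ‖Complex.exp (I * ((k * (r - s) * y : ℝ) : ℂ)) - 1
        - I * ((k * (r - s) * y : ℝ) : ℂ)‖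
      ≤ ‖ψ y‖ * (3 * (k * (r - s) * y) ^ 2) :=
        mul_le_mul_of_nonneg_left (norm_exp_I_mul_sub_le _) (norm_nonneg _)
    _ = _ := by
      simp only [norm_mul, norm_pow, Complex.norm_real, Complex.norm_ofNat, Real.norm_eq_abs,
        sq_abs]
      rw [mul_pow, mul_pow, ← sq_abs y]
      ring

/-- A product rule for a bilinear pairing in which the first factor is only weakly
differentiable. -/
theorem hasDerivWithinAt_bilin {X Y : Type*} [NormedAddCommGroup X] [NormedSpace ℂ X]
    [NormedAddCommGroup Y] [NormedSpace ℂ Y] (B : X →L[ℂ] Y →L[ℂ] ℂ) {F : ℝ → X} {u : ℝ → Y}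
    {a : ℂ} {u' : Y} {S : Set ℝ} {s : ℝ} (hF : ContinuousWithinAt F S s)
    (hFu : HasDerivWithinAt (fun r => B (F r) (u s)) a S s) (hu : HasDerivAt u u' s) :
    HasDerivWithinAt (fun r => B (F r) (u r)) (a + B (F s) u') S s := by
  have h2 : HasDerivWithinAt (fun r => B (F r) (u r - u s)) (B (F s) u') S s := by
    rw [hasDerivWithinAt_iff_tendsto_slope]
    have h3 : Tendsto (fun r => B (F r) (slope u s r)) (𝓝[S \ {s}] s) (𝓝 (B (F s) u')) := by
      have hFt : Tendsto F (𝓝[S \ {s}] s) (𝓝 (F s)) := hF.mono sdiff_subset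
      have hut : Tendsto (slope u s) (𝓝[S \ {s}] s) (𝓝 u') :=
        (hasDerivWithinAt_iff_tendsto_slope.1 hu.hasDerivWithinAt)
      exact (B.isBoundedBilinearMap.continuous.tendsto (F s, u')).comp (hFt.prodMk_nhds hut)
    refine h3.congr fun r => ?_
    simp only [slope_def_module, sub_self, map_zero, sub_zero]
    rw [← Complex.coe_smul, map_smul, Complex.coe_smul]
  refine (hFu.add h2).congr_of_eventuallyEq (Eventually.of_forall fun r => ?_) ?_
  · simp [map_sub]
  · simp

end Couette

/-! ### Transport-diffusion systems on the line in the moving frame -/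

namespace Couette

open Filter Topology FourierTransform
open Complex (I)
open scoped BoundedContinuousFunction

variable {ι : Type*}

/-- A weak solution `F` on `[0, ∞)`, with values in `L²(ℝ)`, of the system
`∂ₜ Fᵢ + i k y Fᵢ = ∑ₘ (c_{im0} - c_{im1} ∂ᵧ + c_{im2} ∂ᵧ²) Fₘ` on the line. -/
structure IsLineSol [Fintype ι] (k : ℝ) (c : ι → ι → Fin 3 → ℂ) (F : ℝ → ι → L2R) : Prop where
  cont : ContinuousOn F (Ici 0)
  weak : ∀ ψ : ℝ → ℂ, IsLineTest ψ → ∀ i, ∀ t, 0 ≤ t →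
    HasDerivWithinAt (fun s => ∫ y, F s i y * ψ y)
      (-(I * k * ∫ y, F t i y * (y * ψ y)) + ∑ m, (c i m 0 * (∫ y, F t m y * ψ y)
        + c i m 1 * (∫ y, F t m y * deriv ψ y) + c i m 2 * ∫ y, F t m y * deriv (deriv ψ) y))
      (Ici 0) t

theorem deriv_osc_mul {ψ : ℝ → ℂ} (h : IsLineTest ψ) (a : ℝ) :
    deriv (fun y => osc a y * ψ y) = fun y => osc a y * (deriv ψ y + I * a * ψ y) := by
  funext y
  rw [((hasDerivAt_osc a y).fun_mul (h.hasDerivAt y)).deriv]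
  ring

theorem integrable_modul_mul (a : ℝ) (F : L2R) {ψ : ℝ → ℂ} (h : IsLineTest ψ) :
    Integrable fun y => F y * (osc a y * ψ y) :=
  integrable_mul_of_memLp (Lp.memLp F) (h.osc_mul a).memLp

theorem integral_mul_deriv_osc (a : ℝ) (F : L2R) {ψ : ℝ → ℂ} (h : IsLineTest ψ) :
    ∫ y, F y * deriv (fun y => osc a y * ψ y) y
      = (∫ y, modul a F y * deriv ψ y) + I * a * ∫ y, modul a F y * ψ y := by
  rw [deriv_osc_mul h, integral_modul_mul, integral_modul_mul, ← integral_const_mul,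
    ← integral_add (integrable_modul_mul a F h.deriv)
      ((integrable_modul_mul a F h).const_mul (I * a))]
  refine integral_congr_ae (Eventually.of_forall fun y => ?_)
  simp only
  ring

theorem IsLineTest.add {ψ φ : ℝ → ℂ} (h : IsLineTest ψ) (h' : IsLineTest φ) :
    IsLineTest fun y => ψ y + φ y :=
  ⟨h.smooth.add h'.smooth, h.compact.add h'.compact⟩

theorem integral_mul_deriv_deriv_osc (a : ℝ) (F : L2R) {ψ : ℝ → ℂ} (h : IsLineTest ψ) :
    ∫ y, F y * deriv (deriv (fun y => osc a y * ψ y)) y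
      = (∫ y, modul a F y * deriv (deriv ψ) y) + 2 * (I * a) * (∫ y, modul a F y * deriv ψ y)
        + (I * a) ^ 2 * ∫ y, modul a F y * ψ y := by
  have hφ : IsLineTest fun y => deriv ψ y + I * a * ψ y := h.deriv.add (h.const_mul (I * a))
  have hd : deriv (fun y => deriv ψ y + I * a * ψ y)
      = fun y => deriv (deriv ψ) y + I * a * deriv ψ y := by
    funext y
    exact ((h.deriv.hasDerivAt y).add ((h.hasDerivAt y).const_mul (I * a))).deriv
  have hi : ∀ {φ : ℝ → ℂ}, IsLineTest φ → Integrable fun y => modul a F y * φ y := fun hφ =>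
    integrable_mul_of_memLp (Lp.memLp _) hφ.memLp
  rw [deriv_osc_mul h, integral_mul_deriv_osc a F hφ, hd]
  simp only [mul_add]
  rw [integral_add (hi h.deriv.deriv) (hi (h.deriv.const_mul (I * a))),
    integral_add (hi h.deriv) (hi (h.const_mul (I * a)))]
  have e : ∀ φ : ℝ → ℂ, ∫ y, modul a F y * (I * a * φ y) = I * a * ∫ y, modul a F y * φ y := by
    intro φ
    rw [← integral_const_mul]
    refine integral_congr_ae (Eventually.of_forall fun y => ?_)
    simp only
    ring
  rw [e, e]
  ring

/-- The solution in the moving frame, `e^{i k s y} F(s)`. -/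
def frame (k : ℝ) (F : ℝ → ι → L2R) (s : ℝ) (i : ι) : L2R := modul (k * s) (F s i)

/-- The coefficients of the system in the moving frame, where `∂ᵧ` becomes `∂ᵧ - i k s`. -/
def frameCoef (k : ℝ) (c : ι → ι → Fin 3 → ℂ) (s : ℝ) (i m : ι) : Fin 3 → ℂ :=
  ![c i m 0 + I * (k * s : ℝ) * c i m 1 + (I * (k * s : ℝ)) ^ 2 * c i m 2,
    c i m 1 + 2 * (I * (k * s : ℝ)) * c i m 2, c i m 2]

variable {k : ℝ} {c : ι → ι → Fin 3 → ℂ} {F : ℝ → ι → L2R}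

/-- In the moving frame the unbounded coefficient `y` disappears. -/
theorem IsLineSol.hasDerivWithinAt_frame [Fintype ι] (hF : IsLineSol k c F) {ψ : ℝ → ℂ}
    (h : IsLineTest ψ) (i : ι) {t : ℝ} (ht : 0 ≤ t) :
    HasDerivWithinAt (fun s => ∫ y, frame k F s i y * ψ y)
      (∑ m, (frameCoef k c t i m 0 * (∫ y, frame k F t m y * ψ y)
        + frameCoef k c t i m 1 * (∫ y, frame k F t m y * deriv ψ y)
        + frameCoef k c t i m 2 * ∫ y, frame k F t m y * deriv (deriv ψ) y)) (Ici 0) t := by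
  have h1 := hF.weak _ (h.osc_mul (k * t)) i t ht
  have hc : ContinuousWithinAt (fun s => F s i) (Ici 0) t :=
    ((continuous_apply i).continuousAt.comp_continuousWithinAt (hF.cont t ht))
  have h2 := hasDerivWithinAt_bilin linePairing (F := fun s => F s i)
    (u := fun r => ((h.osc_mul (k * r)).memLp.toLp _ : L2R)) hc
    (h1.congr_of_eventuallyEq (Eventually.of_forall fun s => linePairing_toLp _ _)
      (linePairing_toLp _ _)) (hasDerivAt_toLp_osc_mul h k t)
  simp only [linePairing_toLp] at h2
  refine (h2.congr_of_eventuallyEq (Eventually.of_forall fun s => ?_) ?_).congr_deriv ?_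
  · exact integral_modul_mul _ _ _
  · exact integral_modul_mul _ _ _
  · have e1 : ∫ y, F t i y * (I * k * (y * (osc (k * t) y * ψ y)))
        = I * k * ∫ y, F t i y * (y * (osc (k * t) y * ψ y)) := by
      rw [← integral_const_mul]
      refine integral_congr_ae (Eventually.of_forall fun y => ?_)
      simp only
      ring
    rw [e1, add_right_comm, neg_add_cancel, zero_add]
    refine Finset.sum_congr rfl fun m _ => ?_
    rw [integral_mul_deriv_osc _ _ h, integral_mul_deriv_deriv_osc _ _ h, ← integral_modul_mul]
    simp only [frameCoef, frame, Matrix.cons_val_zero, Matrix.cons_val_one, Matrix.cons_val]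
    ring

theorem IsLineSol.continuous_frame [Fintype ι] (hF : IsLineSol k c F) (i : ι) :
    Continuous fun s => frame k F (max s 0) i := by
  have h1 : Continuous fun s : ℝ => F (max s 0) i :=
    (continuous_apply i).comp
      (hF.cont.comp_continuous (continuous_id.max continuous_const)
        fun s => mem_Ici.2 (le_max_right _ _))
  exact continuous_modul.comp
    ((continuous_const.mul (continuous_id.max continuous_const)).prodMk h1)

theorem continuous_frameCoef (i m : ι) (j : Fin 3) : Continuous fun s => frameCoef k c s i m j := by
  fin_cases j <;> simp only [frameCoef, Matrix.cons_val_zero, Matrix.cons_val_one,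
    Matrix.cons_val, Fin.zero_eta, Fin.mk_one, Fin.reduceFinMk] <;> fun_prop

/-- The part of the right-hand side of the system in the moving frame with `j` derivatives,
integrated in time. The solution is extended to negative times as a constant. -/
def frameInt [Fintype ι] (k : ℝ) (c : ι → ι → Fin 3 → ℂ) (F : ℝ → ι → L2R) (t : ℝ) (i : ι)
    (j : Fin 3) : L2R :=
  ∫ s in (0 : ℝ)..t, ∑ m, frameCoef k c s i m j • frame k F (max s 0) m

theorem IsLineSol.continuous_sum_frame [Fintype ι] (hF : IsLineSol k c F) (i : ι) (j : Fin 3) :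
    Continuous fun s => ∑ m, frameCoef k c s i m j • frame k F (max s 0) m :=
  continuous_finsetSum _ fun m _ => (continuous_frameCoef i m j).smul (hF.continuous_frame m)

theorem IsLineSol.linePairing_frameInt [Fintype ι] (hF : IsLineSol k c F) (t : ℝ) (i : ι)
    (j : Fin 3) {ψ : ℝ → ℂ} (h : IsLineTest ψ) :
    ∫ y, frameInt k c F t i j y * ψ y = ∫ s in (0 : ℝ)..t,
      ∑ m, frameCoef k c s i m j * ∫ y, frame k F (max s 0) m y * ψ y := by
  set L : L2R →L[ℂ] ℂ := linePairing.flip (h.memLp.toLp ψ) with hL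
  have hLa : ∀ G : L2R, L G = ∫ y, G y * ψ y := fun G => linePairing_toLp G h.memLp
  rw [← hLa, frameInt, ← L.intervalIntegral_comp_comm
    ((hF.continuous_sum_frame i j).intervalIntegrable _ _)]
  refine intervalIntegral.integral_congr fun s _ => ?_
  rw [map_sum]
  exact Finset.sum_congr rfl fun m _ => by rw [map_smul, smul_eq_mul, hLa]

/-- The system in the moving frame, integrated in time. -/
theorem IsLineSol.frame_sub_weak [Fintype ι] (hF : IsLineSol k c F) {t : ℝ} (ht : 0 ≤ t) (i : ι)
    (ψ : ℝ → ℂ) (h : IsLineTest ψ) :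
    ∫ y, (frame k F t i - frame k F 0 i : L2R) y * ψ y
      = (∫ y, frameInt k c F t i 0 y * ψ y) + (∫ y, frameInt k c F t i 1 y * deriv ψ y)
        + ∫ y, frameInt k c F t i 2 y * deriv (deriv ψ) y := by
  have hLa : ∀ {φ : ℝ → ℂ} (h : IsLineTest φ) (G : L2R),
      linePairing.flip (h.memLp.toLp φ) G = ∫ y, G y * φ y := fun h G => linePairing_toLp G h.memLp
  have hcont : ∀ {φ : ℝ → ℂ}, IsLineTest φ → ∀ m,
      Continuous fun s => ∫ y, frame k F (max s 0) m y * φ y := by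
    intro φ h m
    simp only [← hLa h]
    exact (ContinuousLinearMap.continuous _).comp (hF.continuous_frame m)
  have hci : ∀ {φ : ℝ → ℂ}, IsLineTest φ → ∀ j, Continuous fun s =>
      ∑ m, frameCoef k c s i m j * ∫ y, frame k F (max s 0) m y * φ y := fun h j =>
    continuous_finsetSum _ fun m _ => (continuous_frameCoef i m j).mul (hcont h m)
  rw [hF.linePairing_frameInt t i 0 h, hF.linePairing_frameInt t i 1 h.deriv,
    hF.linePairing_frameInt t i 2 h.deriv.deriv,
    ← intervalIntegral.integral_add ((hci h 0).intervalIntegrable _ _)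
      ((hci h.deriv 1).intervalIntegrable _ _),
    ← intervalIntegral.integral_add (((hci h 0).fun_add (hci h.deriv 1)).intervalIntegrable _ _)
      ((hci h.deriv.deriv 2).intervalIntegrable _ _)]
  rw [intervalIntegral.integral_eq_sub_of_hasDeriv_right_of_le ht
    (f := fun s => ∫ y, frame k F (max s 0) i y * ψ y) (hcont h i).continuousOn ?_
    (((hci h 0).fun_add (hci h.deriv 1)).fun_add (hci h.deriv.deriv 2) |>.intervalIntegrable _ _)]
  · simp only [max_eq_left ht, max_self, ← hLa h, map_sub]
  · intro s hs
    have h1 := (hF.hasDerivWithinAt_frame h i hs.1.le).mono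
      (Ioi_subset_Ici hs.1.le : Ioi s ⊆ Ici 0)
    refine (h1.congr (fun r hr => ?_) ?_).congr_deriv ?_
    · rw [max_eq_left (hs.1.le.trans (le_of_lt hr))]
    · rw [max_eq_left hs.1.le]
    · rw [max_eq_left hs.1.le, ← Finset.sum_add_distrib, ← Finset.sum_add_distrib]

/-- The identity function, truncated to `[-N, N]` and multiplied by `-2 π i`: the symbol of the
transposed derivative. -/
def truncSymb (N : ℕ) : ℝ →ᵇ ℂ :=
  BoundedContinuousFunction.ofNormedAddCommGroup
    (fun ξ => -2 * Real.pi * I * (max (-N : ℝ) (min ξ N) : ℝ)) (by fun_prop) (2 * Real.pi * N)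
    (fun ξ => by
      have h : |max (-N : ℝ) (min ξ N)| ≤ N := by
        rw [abs_le]
        exact ⟨le_max_left _ _,
          max_le (by linarith [Nat.cast_nonneg (α := ℝ) N]) (min_le_right _ _)⟩
      simp only [norm_mul, norm_neg, Complex.norm_ofNat, Complex.norm_real, Complex.norm_I, mul_one,
        Real.norm_eq_abs, abs_of_pos Real.pi_pos]
      exact mul_le_mul_of_nonneg_left h (by positivity))

theorem truncSymb_apply {N : ℕ} {ξ : ℝ} (h : ξ ∈ Ioo (-N : ℝ) N) :
    truncSymb N ξ = -2 * Real.pi * I * ξ := by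
  change -2 * Real.pi * I * ((max (-N : ℝ) (min ξ N) : ℝ) : ℂ) = _
  rw [min_eq_left h.2.le, max_eq_right h.1.le]

/-- The coefficients of the system in frequency, truncated to bounded frequencies. -/
def freqCoef (k : ℝ) (c : ι → ι → Fin 3 → ℂ) (N : ℕ) (s : ℝ) (i m : ι) : ℝ →ᵇ ℂ :=
  frameCoef k c s i m 0 • 1 + frameCoef k c s i m 1 • truncSymb N
    + frameCoef k c s i m 2 • (truncSymb N * truncSymb N)

theorem freqCoef_apply {N : ℕ} {ξ : ℝ} (h : ξ ∈ Ioo (-N : ℝ) N) (s : ℝ) (i m : ι) :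
    freqCoef k c N s i m ξ = c i m 0 + -(I * (2 * Real.pi * ξ - k * s : ℝ)) * c i m 1
      + (-(I * (2 * Real.pi * ξ - k * s : ℝ))) ^ 2 * c i m 2 := by
  simp only [freqCoef, BoundedContinuousFunction.coe_add, BoundedContinuousFunction.coe_smul,
    BoundedContinuousFunction.coe_mul, BoundedContinuousFunction.coe_one, Pi.add_apply,
    Pi.mul_apply, Pi.one_apply, truncSymb_apply h, frameCoef, Matrix.cons_val_zero,
    Matrix.cons_val_one, Matrix.cons_val, smul_eq_mul]
  push_cast
  ring

theorem mulOp_smul_left (ν : Measure ℝ) [IsFiniteMeasure ν] (a : ℂ) (φ : ℝ →ᵇ ℂ) (f : Lp ℂ 2 ν) :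
    mulOp ν (a • φ) f = a • mulOp ν φ f := by
  apply Lp.ext
  filter_upwards [coeFn_mulOp ν (a • φ) f, coeFn_mulOp ν φ f, Lp.coeFn_smul a (mulOp ν φ f)]
    with ξ h1 h2 h3
  rw [h1, h3, Pi.smul_apply, h2]
  simp [mul_assoc]

theorem mulOp_smul_right (ν : Measure ℝ) [IsFiniteMeasure ν] (a : ℂ) (φ : ℝ →ᵇ ℂ) (f : Lp ℂ 2 ν) :
    mulOp ν φ (a • f) = a • mulOp ν φ f := by
  apply Lp.ext
  filter_upwards [coeFn_mulOp ν φ (a • f), coeFn_mulOp ν φ f, Lp.coeFn_smul a (mulOp ν φ f),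
    Lp.coeFn_smul a f] with ξ h1 h2 h3 h4
  rw [h1, h3, Pi.smul_apply, h2, h4, Pi.smul_apply, smul_eq_mul, smul_eq_mul]
  ring

/-- The Fourier transform followed by the restriction to the frequencies in `(-N, N)`. -/
def fourierRestrict (N : ℕ) : L2R →L[ℂ] Lp ℂ 2 (volume.restrict (Ioo (-N : ℝ) N)) :=
  (LpToLpRestrictCLM ℝ ℂ ℂ volume 2 (Ioo (-N : ℝ) N)).comp
    (Lp.fourierTransformₗᵢ ℝ ℂ).toContinuousLinearEquiv.toContinuousLinearMap

theorem coeFn_fourierRestrict (N : ℕ) (F : L2R) :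
    fourierRestrict N F =ᵐ[volume.restrict (Ioo (-N : ℝ) N)] (𝓕 F : L2R) :=
  LpToLpRestrictCLM_coeFn ℂ (Ioo (-N : ℝ) N) (𝓕 F : L2R)

/-- A weak solution on the line is, for almost every frequency, a classical solution of the ordinary
differential equation in which `∂ᵧ` is replaced by `i (2 π ξ - k s)`. The frequencies are first
restricted to `(-N, N)`, where the multipliers are bounded. -/
theorem IsLineSol.ae_exists_mode [Fintype ι] [DecidableEq ι] (hF : IsLineSol k c F) {T : ℝ}
    (hT : 0 ≤ T) :
    ∀ᵐ ξ : ℝ, ∃ w : ℝ → ι → ℂ,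
      (∀ s i, HasDerivAt (fun r => w r i) (∑ m, (c i m 0
        + -(I * (2 * Real.pi * ξ - k * s : ℝ)) * c i m 1
        + (-(I * (2 * Real.pi * ξ - k * s : ℝ))) ^ 2 * c i m 2) * w s m) s) ∧
      (∀ i, w 0 i = (𝓕 (F 0 i) : L2R) ξ) ∧
      ∀ i, w T i = (𝓕 (modul (k * T) (F T i)) : L2R) ξ := by
  have main : ∀ N : ℕ, ∀ᵐ ξ : ℝ, ξ ∈ Ioo (-N : ℝ) N → ∃ w : ℝ → ι → ℂ,
      (∀ s i, HasDerivAt (fun r => w r i) (∑ m, (c i m 0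
        + -(I * (2 * Real.pi * ξ - k * s : ℝ)) * c i m 1
        + (-(I * (2 * Real.pi * ξ - k * s : ℝ))) ^ 2 * c i m 2) * w s m) s) ∧
      (∀ i, w 0 i = (𝓕 (F 0 i) : L2R) ξ) ∧
      ∀ i, w T i = (𝓕 (modul (k * T) (F T i)) : L2R) ξ := by
    intro N
    set ν : Measure ℝ := volume.restrict (Ioo (-N : ℝ) N) with hν
    set W : ℝ → ι → Lp ℂ 2 ν := fun s i => fourierRestrict N (frame k F (max s 0) i) with hW
    have hWi : ∀ i, Continuous fun s => W s i := fun i =>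
      (fourierRestrict N).continuous.comp (hF.continuous_frame i)
    have hWc : Continuous W := continuous_pi hWi
    have ha : Continuous fun s => freqCoef k c N s :=
      continuous_pi fun i => continuous_pi fun m =>
        (((continuous_frameCoef i m 0).smul continuous_const).add
          ((continuous_frameCoef i m 1).smul continuous_const)).add
          ((continuous_frameCoef i m 2).smul continuous_const)
    have hR : Continuous fun s => matOp (mulOp ν) (freqCoef k c N s) (W s) :=
      (continuous_matOp (mulOp ν) ha).clm_apply hWc
    -- The equation holds weakly in `y`, so it is integrated in time before the Fourier transform is
    -- applied; boundedness of the truncated symbol then allows to differentiate in `L²`.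
    have hint : ∀ t, 0 ≤ t → ∀ i, W t i = W 0 i
        + ∫ s in (0 : ℝ)..t, matOp (mulOp ν) (freqCoef k c N s) (W s) i := by
      intro t ht i
      have h1 := fourier_ae_eq_of_weak (hF.frame_sub_weak ht i)
      have h2 : fourierRestrict N (frame k F t i - frame k F 0 i)
          = fourierRestrict N (frameInt k c F t i 0)
            + mulOp ν (truncSymb N) (fourierRestrict N (frameInt k c F t i 1))
            + mulOp ν (truncSymb N * truncSymb N) (fourierRestrict N (frameInt k c F t i 2)) := by
        apply Lp.ext
        set B₀ := fourierRestrict N (frameInt k c F t i 0)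
        set B₁ := mulOp ν (truncSymb N) (fourierRestrict N (frameInt k c F t i 1))
        set B₂ := mulOp ν (truncSymb N * truncSymb N) (fourierRestrict N (frameInt k c F t i 2))
        filter_upwards [coeFn_fourierRestrict N (frame k F t i - frame k F 0 i),
          coeFn_fourierRestrict N (frameInt k c F t i 0),
          coeFn_fourierRestrict N (frameInt k c F t i 1),
          coeFn_fourierRestrict N (frameInt k c F t i 2),
          coeFn_mulOp ν (truncSymb N) (fourierRestrict N (frameInt k c F t i 1)),
          coeFn_mulOp ν (truncSymb N * truncSymb N) (fourierRestrict N (frameInt k c F t i 2)),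
          Lp.coeFn_add (B₀ + B₁) B₂, Lp.coeFn_add B₀ B₁, ae_restrict_of_ae h1,
          ae_restrict_mem measurableSet_Ioo] with ξ g1 g2 g3 g4 g5 g6 g7 g8 g9 g10
        rw [g7, Pi.add_apply, g8, Pi.add_apply, g5, g6, g2, g3, g4, g1, g9,
          BoundedContinuousFunction.coe_mul, Pi.mul_apply, truncSymb_apply g10, sq]
      have h3 : ∀ j, fourierRestrict N (frameInt k c F t i j)
          = ∫ s in (0 : ℝ)..t, ∑ m, frameCoef k c s i m j • W s m := by
        intro j
        rw [frameInt, ← (fourierRestrict N).intervalIntegral_comp_comm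
          ((hF.continuous_sum_frame i j).intervalIntegrable _ _)]
        refine intervalIntegral.integral_congr fun s _ => ?_
        simp only [map_sum, map_smul, hW]
      have hci : ∀ j, Continuous fun s => ∑ m, frameCoef k c s i m j • W s m := fun j =>
        continuous_finsetSum _ fun m _ => (continuous_frameCoef i m j).smul (hWi m)
      have hci' : ∀ (φ : ℝ →ᵇ ℂ) j,
          Continuous fun s => mulOp ν φ (∑ m, frameCoef k c s i m j • W s m) := fun φ j =>
        (mulOp ν φ).continuous.comp (hci j)
      have h4 : W t i = W 0 i + fourierRestrict N (frame k F t i - frame k F 0 i) := by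
        simp only [hW, max_eq_left ht, max_self, map_sub]
        abel
      rw [h4, h2, h3, h3, h3, ← (mulOp ν (truncSymb N)).intervalIntegral_comp_comm
          ((hci 1).intervalIntegrable _ _),
        ← (mulOp ν (truncSymb N * truncSymb N)).intervalIntegral_comp_comm
          ((hci 2).intervalIntegrable _ _),
        ← intervalIntegral.integral_add ((hci 0).intervalIntegrable _ _)
          ((hci' _ 1).intervalIntegrable _ _),
        ← intervalIntegral.integral_add
          (((hci 0).fun_add (hci' _ 1)).intervalIntegrable _ _)
          ((hci' _ 2).intervalIntegrable _ _)]
      congr 1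
      refine intervalIntegral.integral_congr fun s _ => ?_
      simp only [matOp_apply, freqCoef, map_add, add_apply, map_sum, mulOp_smul_left,
        mulOp_smul_right, mulOp_one, Finset.sum_add_distrib]
    have hderiv : ∀ s, 0 ≤ s →
        HasDerivWithinAt W (matOp (mulOp ν) (freqCoef k c N s) (W s)) (Ici s) s := by
      intro s hs
      refine hasDerivWithinAt_pi.2 fun i => ?_
      have hRi : Continuous fun s => matOp (mulOp ν) (freqCoef k c N s) (W s) i :=
        (continuous_apply i).comp hR
      have h5 := ((intervalIntegral.integral_hasDerivAt_right (hRi.intervalIntegrable 0 s)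
        (hRi.stronglyMeasurableAtFilter _ _) hRi.continuousAt).const_add (W 0 i)).hasDerivWithinAt
        (s := Ici s)
      exact h5.congr (fun r hr => hint r (hs.trans hr) i) (hint s hs i)
    have hfib := exists_fibre_solution ν ha hT hWc.continuousOn fun s hs => hderiv s hs.1
    rw [← ae_restrict_iff' measurableSet_Ioo]
    have e0 := ae_all_iff.2 fun i => coeFn_fourierRestrict N (frame k F 0 i)
    have eT := ae_all_iff.2 fun i => coeFn_fourierRestrict N (frame k F T i)
    filter_upwards [hfib, e0, eT, ae_restrict_mem measurableSet_Ioo]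
      with ξ ⟨w, hw, hw0, hwT⟩ e0 eT hξ
    refine ⟨w, fun s i => ?_, fun i => ?_, fun i => ?_⟩
    · have := hw s i
      simp only [freqCoef_apply hξ] at this
      exact this
    · rw [hw0, hW]
      simp only [max_self]
      rw [e0, frame, mul_zero, modul_zero]
    · rw [hwT, hW]
      simp only [max_eq_left hT]
      rw [eT, frame]
  filter_upwards [ae_all_iff.2 main] with ξ hξ
  obtain ⟨N, hN⟩ := exists_nat_gt |ξ|
  exact hξ N (abs_lt.1 hN)

end Couette

/-! ### Fourier coefficients in the periodic directions -/

namespace Couette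

open Filter Topology FourierTransform AddCircle
open Complex (I)

theorem eLpNorm_two_sq {α : Type*} [MeasurableSpace α] {μ : Measure α} {E : Type*}
    [NormedAddCommGroup E] (f : α → E) : eLpNorm f 2 μ ^ 2 = ∫⁻ x, ‖f x‖ₑ ^ 2 ∂μ := by
  have h := eLpNorm_nnreal_pow_eq_lintegral (f := f) (μ := μ) (p := 2) two_ne_zero
  have e : ((2 : NNReal) : ℝ) = 2 := rfl
  simp only [e, ENNReal.rpow_two] at h
  exact h

theorem memLp_two_iff_lintegral {α : Type*} [MeasurableSpace α] {μ : Measure α} {E : Type*}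
    [NormedAddCommGroup E] {f : α → E} (hf : AEStronglyMeasurable f μ) :
    MemLp f 2 μ ↔ ∫⁻ x, ‖f x‖ₑ ^ 2 ∂μ < ⊤ := by
  rw [← eLpNorm_two_sq, ENNReal.pow_lt_top_iff]
  simp [MemLp, hf]

/-- The total mass `2π` of the circle. -/
def circleMass : ℝ≥0∞ := ENNReal.ofReal (2 * Real.pi)

theorem circleMass_ne_zero : circleMass ≠ 0 := by
  simp [circleMass, Real.pi_pos]

theorem circleMass_ne_top : circleMass ≠ ⊤ := ENNReal.ofReal_ne_top

theorem tsum_enorm_fourierCoeff {g : Torus → ℂ} (hg : MemLp g 2 volume) :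
    ∑' k, ‖fourierCoeff g k‖ₑ ^ 2 = circleMass⁻¹ * ∫⁻ x, ‖g x‖ₑ ^ 2 := by
  have hg' : MemLp g 2 haarAddCircle := memLp_haarAddCircle_iff.2 hg
  have h := hasSum_sq_fourierCoeff (hg'.toLp g)
  have e1 : ∀ k, fourierCoeff (hg'.toLp g) k = fourierCoeff g k := fun k =>
    congrFun (fourierCoeff_congr_ae hg'.coeFn_toLp) k
  simp only [e1] at h
  have e2 : ∫ t, ‖hg'.toLp g t‖ ^ 2 ∂haarAddCircle = ∫ t, ‖g t‖ ^ 2 ∂haarAddCircle := by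
    refine integral_congr_ae ?_
    filter_upwards [hg'.coeFn_toLp] with t ht
    rw [ht]
  rw [e2] at h
  have e3 : ∀ z : ℂ, ‖z‖ₑ ^ 2 = ENNReal.ofReal (‖z‖ ^ 2) := fun z => by
    rw [ENNReal.ofReal_pow (norm_nonneg _), ofReal_norm]
  simp only [e3]
  rw [← ENNReal.ofReal_tsum_of_nonneg (fun _ => by positivity) h.summable, h.tsum_eq,
    ofReal_integral_eq_lintegral_ofReal
      ((memLp_two_iff_integrable_sq_norm hg'.1).1 hg')
        (Eventually.of_forall fun _ => by positivity),
    volume_eq_smul_haarAddCircle, lintegral_smul_measure, smul_eq_mul, ← mul_assoc]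
  change _ = circleMass⁻¹ * circleMass * ∫⁻ t, _ ∂haarAddCircle
  rw [ENNReal.inv_mul_cancel circleMass_ne_zero circleMass_ne_top, one_mul]

theorem norm_fourier_apply (n : ℤ) (x : Torus) : ‖fourier n x‖ = 1 := by
  rw [fourier_apply]
  exact Circle.norm_coe _

section Product

variable {Y : Type*} [MeasurableSpace Y] {ν : Measure Y} [SFinite ν]

/-- The Fourier coefficient in the first, periodic variable. -/
def xCoef (k : ℤ) (f : Torus × Y → ℂ) (y : Y) : ℂ := fourierCoeff (fun x => f (x, y)) k

theorem aestronglyMeasurable_xCoef (k : ℤ) {f : Torus × Y → ℂ}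
    (hf : AEStronglyMeasurable f ((volume : Measure Torus).prod ν)) :
    AEStronglyMeasurable (xCoef k f) ν := by
  have h1 : AEStronglyMeasurable (fun p : Torus × Y => fourier (-k) p.1 • f p)
      ((volume : Measure Torus).prod ν) :=
    ((fourier (-k)).continuous.aestronglyMeasurable (μ := volume)).comp_fst.smul hf
  have h2 := h1.prod_swap.integral_prod_right'
  have h3 : xCoef k f = fun y => (2 * Real.pi)⁻¹ • ∫ x : Torus, fourier (-k) x • f (x, y) := by
    funext y
    rw [xCoef, fourierCoeff, integral_haarAddCircle]
  rw [h3]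
  exact h2.const_smul (2 * Real.pi)⁻¹

theorem ae_memLp_slice {f : Torus × Y → ℂ} (hf : MemLp f 2 ((volume : Measure Torus).prod ν)) :
    ∀ᵐ y ∂ν, MemLp (fun x => f (x, y)) 2 (volume : Measure Torus) := by
  have h1 := hf.aestronglyMeasurable.prod_swap.prodMk_left
  have h2 := (memLp_two_iff_lintegral hf.1).1 hf
  rw [lintegral_prod_symm _ (hf.1.enorm.pow_const 2)] at h2
  have h3 := ae_lt_top' (hf.1.enorm.pow_const 2).lintegral_prod_left' h2.ne
  filter_upwards [h1, h3] with y hy1 hy2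
  exact (memLp_two_iff_lintegral hy1).2 hy2

theorem tsum_lintegral_xCoef {f : Torus × Y → ℂ}
    (hf : MemLp f 2 ((volume : Measure Torus).prod ν)) :
    ∑' k, ∫⁻ y, ‖xCoef k f y‖ₑ ^ 2 ∂ν
      = circleMass⁻¹ * ∫⁻ p, ‖f p‖ₑ ^ 2 ∂((volume : Measure Torus).prod ν) := by
  rw [← lintegral_tsum fun k => (aestronglyMeasurable_xCoef k hf.1).enorm.pow_const 2,
    lintegral_prod_symm _ (hf.1.enorm.pow_const 2),
    ← lintegral_const_mul' _ _ (ENNReal.inv_ne_top.2 circleMass_ne_zero)]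
  refine lintegral_congr_ae ?_
  filter_upwards [ae_memLp_slice hf] with y hy
  exact tsum_enorm_fourierCoeff hy

theorem memLp_xCoef (k : ℤ) {f : Torus × Y → ℂ}
    (hf : MemLp f 2 ((volume : Measure Torus).prod ν)) : MemLp (xCoef k f) 2 ν := by
  rw [memLp_two_iff_lintegral (aestronglyMeasurable_xCoef k hf.1)]
  refine lt_of_le_of_lt
    (ENNReal.le_tsum (f := fun k => ∫⁻ y, ‖xCoef k f y‖ₑ ^ 2 ∂ν) k) ?_
  rw [tsum_lintegral_xCoef hf]
  exact ENNReal.mul_lt_top (ENNReal.inv_lt_top.2 (pos_iff_ne_zero.2 circleMass_ne_zero))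
    ((memLp_two_iff_lintegral hf.1).1 hf)

theorem integral_xCoef_mul (k : ℤ) {f : Torus × Y → ℂ} {G : Y → ℂ}
    (hf : MemLp f 2 ((volume : Measure Torus).prod ν)) (hG : MemLp G 2 ν) :
    ∫ y, xCoef k f y * G y ∂ν = (2 * Real.pi)⁻¹ *
      ∫ p, f p * (fourier (-k) p.1 * G p.2) ∂((volume : Measure Torus).prod ν) := by
  have h1 : MemLp (fun p : Torus × Y => fourier (-k) p.1 * G p.2) 2
      ((volume : Measure Torus).prod ν) := by
    refine (hG.comp_snd (volume : Measure Torus)).congr_norm ?_ (Eventually.of_forall fun p => ?_)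
    · exact ((fourier (-k)).continuous.aestronglyMeasurable (μ := volume)).comp_fst.mul
        (hG.comp_snd (volume : Measure Torus)).1
    · rw [norm_mul, norm_fourier_apply, one_mul]
  rw [integral_prod_symm _ (integrable_mul_of_memLp hf h1), ← integral_const_mul]
  refine integral_congr_ae (Eventually.of_forall fun y => ?_)
  simp only
  rw [xCoef, fourierCoeff, integral_haarAddCircle, Complex.real_smul, mul_assoc,
    ← integral_mul_const]
  push_cast
  congr 2
  funext x
  rw [smul_eq_mul]; ring

end Product

/-- The Fourier coefficient in `x` and `z`, as a function of `y`. -/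
def lineCoef (k l : ℤ) (f : Dom → ℂ) : ℝ → ℂ :=
  xCoef l fun q : Torus × ℝ => xCoef k f (q.2, q.1)

theorem memLp_swap_xCoef (k : ℤ) {f : Dom → ℂ} (hf : MemLp f 2 volume) :
    MemLp (fun q : Torus × ℝ => xCoef k f (q.2, q.1)) 2
      ((volume : Measure Torus).prod (volume : Measure ℝ)) :=
  (memLp_xCoef k (ν := (volume : Measure (ℝ × Torus))) hf).comp_measurePreserving
    Measure.measurePreserving_swap

theorem memLp_lineCoef (k l : ℤ) {f : Dom → ℂ} (hf : MemLp f 2 volume) :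
    MemLp (lineCoef k l f) 2 volume :=
  memLp_xCoef l (memLp_swap_xCoef k hf)

theorem tsum_lintegral_lineCoef {f : Dom → ℂ} (hf : MemLp f 2 volume) :
    ∑' p : ℤ × ℤ, ∫⁻ y, ‖lineCoef p.1 p.2 f y‖ₑ ^ 2
      = circleMass⁻¹ * (circleMass⁻¹ * ∫⁻ p, ‖f p‖ₑ ^ 2) := by
  rw [ENNReal.tsum_prod (f := fun k l => ∫⁻ y, ‖lineCoef k l f y‖ₑ ^ 2)]
  have h1 := tsum_lintegral_xCoef (ν := (volume : Measure (ℝ × Torus))) hf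
  change _ = circleMass⁻¹ * (circleMass⁻¹ *
    ∫⁻ p, ‖f p‖ₑ ^ 2 ∂((volume : Measure Torus).prod (volume : Measure (ℝ × Torus))))
  rw [← h1, ← ENNReal.tsum_mul_left]
  refine tsum_congr fun k => ?_
  change ∑' l, ∫⁻ y, ‖xCoef l (fun q : Torus × ℝ => xCoef k f (q.2, q.1)) y‖ₑ ^ 2 = _
  rw [tsum_lintegral_xCoef (memLp_swap_xCoef k hf)]
  congr 1
  exact (Measure.measurePreserving_swap (μ := (volume : Measure Torus))
    (ν := (volume : Measure ℝ))).lintegral_comp_emb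
      MeasurableEquiv.prodComm.measurableEmbedding (fun q => ‖xCoef k f q‖ₑ ^ 2)

/-- The function `e^{-i k x} e^{-i l z} ψ(y)`. -/
def wave (k l : ℤ) (ψ : ℝ → ℂ) (p : Dom) : ℂ :=
  fourier (-k) p.1 * (fourier (-l) p.2.2 * ψ p.2.1)

theorem integral_lineCoef_mul (k l : ℤ) {f : Dom → ℂ} (hf : MemLp f 2 volume) {ψ : ℝ → ℂ}
    (hψ : MemLp ψ 2 volume) :
    ∫ y, lineCoef k l f y * ψ y = (2 * Real.pi : ℂ)⁻¹ ^ 2 * ∫ p, f p * wave k l ψ p := by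
  rw [lineCoef, integral_xCoef_mul l (memLp_swap_xCoef k hf) hψ]
  have h1 : MemLp (fun q : ℝ × Torus => fourier (-l) q.2 * ψ q.1) 2 volume := by
    refine (hψ.comp_fst (volume : Measure Torus)).congr_norm ?_ (Eventually.of_forall fun p => ?_)
    · exact ((fourier (-l)).continuous.comp continuous_snd).aestronglyMeasurable.mul
        (hψ.comp_fst (volume : Measure Torus)).1
    · rw [norm_mul, norm_fourier_apply, one_mul]
  have h2 := integral_xCoef_mul k (ν := (volume : Measure (ℝ × Torus))) hf h1
  have h3 := (Measure.measurePreserving_swap (μ := (volume : Measure Torus))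
    (ν := (volume : Measure ℝ))).integral_comp MeasurableEquiv.prodComm.measurableEmbedding
      (fun q : ℝ × Torus => xCoef k f q * (fourier (-l) q.2 * ψ q.1))
  have h4 : ∫ p, xCoef k f (p.2, p.1) * (fourier (-l) p.1 * ψ p.2)
      ∂((volume : Measure Torus).prod (volume : Measure ℝ))
      = (2 * Real.pi)⁻¹ * ∫ p, f p * wave k l ψ p := h3.trans h2
  rw [h4, sq, mul_assoc]
  push_cast
  rfl

end Couette

/-! ### Square integrable functions and their Fourier coefficients -/

namespace Couette

open Filter Topology FourierTransform AddCircle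
open Complex (I)

theorem L2R_ext {F G : L2R} (h : ∀ ψ : ℝ → ℂ, IsLineTest ψ → ∫ y, F y * ψ y = ∫ y, G y * ψ y) :
    F = G := by
  apply Lp.ext
  refine ae_eq_of_integral_contDiff_smul_eq ((Lp.memLp F).locallyIntegrable one_le_two)
    ((Lp.memLp G).locallyIntegrable one_le_two) fun g hg hgc => ?_
  have := h (fun x => (g x : ℂ))
    ⟨Complex.ofRealCLM.contDiff.comp hg, hgc.comp_left Complex.ofReal_zero⟩
  simpa [Complex.real_smul, mul_comm] using this

theorem linePairing_test (F : L2R) {ψ : ℝ → ℂ} (h : IsLineTest ψ) :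
    linePairing.flip (h.memLp.toLp ψ) F = ∫ y, F y * ψ y :=
  linePairing_toLp F h.memLp

theorem integral_add_mul (F G : L2R) {ψ : ℝ → ℂ} (h : IsLineTest ψ) :
    ∫ y, (F + G : L2R) y * ψ y = (∫ y, F y * ψ y) + ∫ y, G y * ψ y := by
  simp only [← linePairing_test _ h, map_add]

theorem integral_smul_mul (c : ℂ) (F : L2R) {ψ : ℝ → ℂ} (h : IsLineTest ψ) :
    ∫ y, (c • F : L2R) y * ψ y = c * ∫ y, F y * ψ y := by
  simp only [← linePairing_test _ h, map_smul, smul_eq_mul]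

theorem memLp_ofReal (f : L2) : MemLp (fun p => (f p : ℂ)) 2 volume := (Lp.memLp f).ofReal

/-- The Fourier coefficient in `x` and `z` of a function in `L²(𝕋 × ℝ × 𝕋)`. -/
def coef (k l : ℤ) (f : L2) : L2R := (memLp_lineCoef k l (memLp_ofReal f)).toLp _

theorem integral_coef_mul (k l : ℤ) (f : L2) {ψ : ℝ → ℂ} (hψ : MemLp ψ 2 volume) :
    ∫ y, coef k l f y * ψ y = (2 * Real.pi : ℂ)⁻¹ ^ 2 * ∫ p, (f p : ℂ) * wave k l ψ p := by
  rw [← integral_lineCoef_mul k l (memLp_ofReal f) hψ]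
  refine integral_congr_ae ?_
  filter_upwards [(memLp_lineCoef k l (memLp_ofReal f)).coeFn_toLp] with y hy
  rw [coef, hy]

theorem memLp_wave (k l : ℤ) {ψ : ℝ → ℂ} (hψ : MemLp ψ 2 volume) :
    MemLp (wave k l ψ) 2 volume := by
  have h0 : AEStronglyMeasurable (fun q : ℝ × Torus => fourier (-l) q.2 * ψ q.1) volume :=
    ((fourier (-l)).continuous.aestronglyMeasurable (μ := volume)).comp_snd.mul
      (hψ.comp_fst (volume : Measure Torus)).1
  have h1 : MemLp (fun p : Torus × ℝ × Torus => ψ p.2.1) 2 volume :=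
    (hψ.comp_fst (volume : Measure Torus)).comp_snd (volume : Measure Torus)
  refine h1.congr_norm ?_ (Eventually.of_forall fun p => ?_)
  · exact ((fourier (-k)).continuous.aestronglyMeasurable (μ := volume)).comp_fst.mul h0.comp_snd
  · rw [wave, norm_mul, norm_mul, norm_fourier_apply, norm_fourier_apply, one_mul, one_mul]

theorem integrable_mul_wave (f : L2) (k l : ℤ) {ψ : ℝ → ℂ} (hψ : IsLineTest ψ) :
    Integrable fun p => (f p : ℂ) * wave k l ψ p :=
  integrable_mul_of_memLp (memLp_ofReal f) (memLp_wave k l hψ.memLp)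

theorem norm_sq_eq_toReal {α E : Type*} [MeasurableSpace α] {μ : Measure α}
    [NormedAddCommGroup E] (f : Lp E 2 μ) : ‖f‖ ^ 2 = (∫⁻ x, ‖f x‖ₑ ^ 2 ∂μ).toReal := by
  rw [← eLpNorm_two_sq, ENNReal.toReal_pow, Lp.norm_def]

/-- Parseval's identity for the Fourier series in `x` and `z`. -/
theorem hasSum_norm_coef (f : L2) :
    HasSum (fun p : ℤ × ℤ => ‖coef p.1 p.2 f‖ ^ 2) ((2 * Real.pi)⁻¹ ^ 2 * ‖f‖ ^ 2) := by
  have h1 : ∀ p : ℤ × ℤ, ‖coef p.1 p.2 f‖ ^ 2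
      = (∫⁻ y, ‖lineCoef p.1 p.2 (fun p => (f p : ℂ)) y‖ₑ ^ 2).toReal := by
    intro p
    rw [norm_sq_eq_toReal]
    congr 1
    refine lintegral_congr_ae ?_
    filter_upwards [(memLp_lineCoef p.1 p.2 (memLp_ofReal f)).coeFn_toLp] with y hy
    rw [coef, hy]
  have h2 := tsum_lintegral_lineCoef (memLp_ofReal f)
  have h3 : ∫⁻ p, ‖(f p : ℂ)‖ₑ ^ 2 = ∫⁻ p, ‖f p‖ₑ ^ 2 := by
    refine lintegral_congr fun p => ?_
    rw [← ofReal_norm, Complex.norm_real, ofReal_norm]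
  have hfin : ∫⁻ p, ‖f p‖ₑ ^ 2 < ⊤ := (memLp_two_iff_lintegral (Lp.memLp f).1).1 (Lp.memLp f)
  have hc : circleMass⁻¹ < ⊤ := ENNReal.inv_lt_top.2 (pos_iff_ne_zero.2 circleMass_ne_zero)
  have hne : ∑' p : ℤ × ℤ, ∫⁻ y, ‖lineCoef p.1 p.2 (fun p => (f p : ℂ)) y‖ₑ ^ 2 ≠ ⊤ := by
    rw [h2, h3]
    exact (ENNReal.mul_lt_top hc (ENNReal.mul_lt_top hc hfin)).ne
  have h4 := ENNReal.hasSum_toReal hne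
  rw [← ENNReal.tsum_toReal_eq fun p => ENNReal.ne_top_of_tsum_ne_top hne p, h2, h3] at h4
  simp only [h1]
  convert h4 using 1
  rw [ENNReal.toReal_mul, ENNReal.toReal_mul, ENNReal.toReal_inv, circleMass,
    ENNReal.toReal_ofReal Real.two_pi_pos.le, ← norm_sq_eq_toReal]
  ring

theorem norm_coef_le (k l : ℤ) (f : L2) : ‖coef k l f‖ ≤ 1 * ‖f‖ := by
  have h1 := le_hasSum (hasSum_norm_coef f) (k, l) fun _ _ => by positivity
  simp only at h1
  have h2 : (2 * Real.pi)⁻¹ ^ 2 ≤ 1 := by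
    refine pow_le_one₀ (by positivity) (inv_le_one_of_one_le₀ ?_)
    linarith [Real.pi_gt_three]
  rw [one_mul]
  refine (sq_le_sq₀ (norm_nonneg _) (norm_nonneg _)).1 (h1.trans ?_)
  exact mul_le_of_le_one_left (by positivity) h2

/-- The Fourier coefficient as a continuous linear map. -/
def coefL (k l : ℤ) : L2 →L[ℝ] L2R :=
  LinearMap.mkContinuous
    { toFun := coef k l
      map_add' := fun f g => by
        refine L2R_ext fun ψ h => ?_
        rw [integral_add_mul _ _ h, integral_coef_mul _ _ _ h.memLp,
          integral_coef_mul _ _ _ h.memLp,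
          integral_coef_mul _ _ _ h.memLp, ← mul_add,
          ← integral_add (integrable_mul_wave f k l h) (integrable_mul_wave g k l h)]
        congr 1
        refine integral_congr_ae ?_
        filter_upwards [Lp.coeFn_add f g] with p hp
        rw [hp, Pi.add_apply]; push_cast; ring
      map_smul' := fun c f => by
        refine L2R_ext fun ψ h => ?_
        have e : (c • coef k l f : L2R) = (c : ℂ) • coef k l f := by
          apply Lp.ext
          filter_upwards [Lp.coeFn_smul c (coef k l f), Lp.coeFn_smul (c : ℂ) (coef k l f)]
            with y h1 h2
          rw [h1, h2, Pi.smul_apply, Pi.smul_apply, Complex.real_smul, smul_eq_mul]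
        rw [RingHom.id_apply, e, integral_smul_mul _ _ h,
          integral_coef_mul _ _ _ h.memLp, integral_coef_mul _ _ _ h.memLp, mul_left_comm,
          ← integral_const_mul (c : ℂ)]
        congr 1
        refine integral_congr_ae ?_
        filter_upwards [Lp.coeFn_smul c f] with p hp
        rw [hp, Pi.smul_apply, smul_eq_mul]; push_cast; ring } 1 (norm_coef_le k l)

theorem coefL_apply (k l : ℤ) (f : L2) : coefL k l f = coef k l f := rfl

theorem coef_add (k l : ℤ) (f g : L2) : coef k l (f + g) = coef k l f + coef k l g :=
  map_add (coefL k l) f g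

theorem coef_sub (k l : ℤ) (f g : L2) : coef k l (f - g) = coef k l f - coef k l g :=
  map_sub (coefL k l) f g

theorem coef_sum (k l : ℤ) {ι : Type*} (s : Finset ι) (f : ι → L2) :
    coef k l (∑ i ∈ s, f i) = ∑ i ∈ s, coef k l (f i) :=
  map_sum (coefL k l) f s

/-! ### Weak derivatives under the Fourier transform -/

theorem fourier_add_apply (n : ℤ) (x y : Torus) :
    fourier n (x + y) = fourier n x * fourier n y := by
  simp only [fourier_apply, smul_add, toCircle_add, Circle.coe_mul]

theorem hasDerivAt_fourier_translate (n : ℤ) (x : Torus) :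
    HasDerivAt (fun s : ℝ => fourier n (x + (s : Torus))) (I * n * fourier n x) 0 := by
  have h := (hasDerivAt_fourier (2 * Real.pi) n 0).const_mul (fourier n x)
  simp only [fourier_add_apply]
  refine h.congr_deriv ?_
  have hpi : (Real.pi : ℂ) ≠ 0 := by exact_mod_cast Real.pi_ne_zero
  have h0 : fourier n (((0 : ℝ)) : Torus) = 1 := by
    rw [AddCircle.coe_zero]; exact fourier_eval_zero n
  rw [h0]
  push_cast
  field_simp

theorem contDiff_fourier_coe (n : ℤ) : ContDiff ℝ ∞ fun x : ℝ => fourier n (x : Torus) := by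
  simp only [fourier_coe_apply]
  exact ((contDiff_const.mul Complex.ofRealCLM.contDiff).div_const _).cexp

theorem contDiff_wave_lift (k l : ℤ) {ψ : ℝ → ℂ} (h : IsLineTest ψ) :
    ContDiff ℝ ∞ fun q : ℝ × ℝ × ℝ => wave k l ψ ((q.1 : Torus), q.2.1, (q.2.2 : Torus)) := by
  have h1 : ContDiff ℝ ∞ fun q : ℝ × ℝ × ℝ => q.2.1 := contDiff_fst.comp contDiff_snd
  have h2 : ContDiff ℝ ∞ fun q : ℝ × ℝ × ℝ => q.2.2 := contDiff_snd.comp contDiff_snd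
  exact ((contDiff_fourier_coe (-k)).comp contDiff_fst).mul
    (((contDiff_fourier_coe (-l)).comp h2).mul (h.smooth.comp h1))

theorem hasCompactSupport_wave (k l : ℤ) {ψ : ℝ → ℂ} (h : IsLineTest ψ) :
    HasCompactSupport (wave k l ψ) := by
  refine HasCompactSupport.intro (K := univ ×ˢ (tsupport ψ ×ˢ univ))
    (isCompact_univ.prod (h.compact.isCompact.prod isCompact_univ)) fun p hp => ?_
  have h1 : p.2.1 ∉ tsupport ψ := fun h1 => hp ⟨mem_univ _, h1, mem_univ _⟩
  rw [wave, image_eq_zero_of_notMem_tsupport h1, mul_zero, mul_zero]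

theorem isTest_wave_re (k l : ℤ) {ψ : ℝ → ℂ} (h : IsLineTest ψ) :
    IsTest fun p => (wave k l ψ p).re :=
  ⟨Complex.reCLM.contDiff.comp (contDiff_wave_lift k l h),
    (hasCompactSupport_wave k l h).comp_left Complex.zero_re⟩

theorem isTest_wave_im (k l : ℤ) {ψ : ℝ → ℂ} (h : IsLineTest ψ) :
    IsTest fun p => (wave k l ψ p).im :=
  ⟨Complex.imCLM.contDiff.comp (contDiff_wave_lift k l h),
    (hasCompactSupport_wave k l h).comp_left Complex.zero_im⟩

/-- The transpose of `∂ᵢ`, acting on the profile `ψ` of a plane wave, up to sign: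
`∂ᵢ (e^{-i k x} e^{-i l z} ψ) = -e^{-i k x} e^{-i l z} (dualD k l i ψ)`. -/
def dualD (k l : ℤ) (i : Fin 3) (ψ : ℝ → ℂ) : ℝ → ℂ :=
  ![fun y => I * k * ψ y, fun y => -1 * deriv ψ y, fun y => I * l * ψ y] i

theorem IsLineTest.dualD (k l : ℤ) (i : Fin 3) {ψ : ℝ → ℂ} (h : IsLineTest ψ) :
    IsLineTest (dualD k l i ψ) := by
  fin_cases i
  · exact h.const_mul (I * k)
  · exact h.deriv.const_mul (-1)
  · exact h.const_mul (I * l)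

theorem hasDerivAt_wave (k l : ℤ) (i : Fin 3) {ψ : ℝ → ℂ} (h : IsLineTest ψ) (p : Dom) :
    HasDerivAt (fun s : ℝ => wave k l ψ (p + shift i s)) (-wave k l (dualD k l i ψ) p) 0 := by
  fin_cases i
  · have h1 := (hasDerivAt_fourier_translate (-k) p.1).mul_const (fourier (-l) p.2.2 * ψ p.2.1)
    simp only [Fin.zero_eta, shift, wave, Couette.dualD, Matrix.cons_val_zero, Prod.fst_add,
      Prod.snd_add, add_zero] at h1 ⊢
    refine h1.congr_deriv ?_
    push_cast
    ring
  · have h1 : HasDerivAt (fun s : ℝ => ψ (p.2.1 + s)) (deriv ψ p.2.1) 0 := by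
      have := h.hasDerivAt (p.2.1 + 0)
      rw [add_zero] at this
      simpa using (HasDerivAt.comp_const_add p.2.1 0 (by rwa [add_zero]))
    have h2 := (h1.const_mul (fourier (-l) p.2.2)).const_mul (fourier (-k) p.1)
    simp only [Fin.mk_one, shift, wave, Couette.dualD, Matrix.cons_val_one, Matrix.cons_val_zero,
      Prod.fst_add, Prod.snd_add, add_zero] at h2 ⊢
    refine h2.congr_deriv ?_
    ring
  · have h1 := ((hasDerivAt_fourier_translate (-l) p.2.2).mul_const (ψ p.2.1)).const_mul
      (fourier (-k) p.1)
    simp only [Fin.reduceFinMk, shift, wave, Couette.dualD, Matrix.cons_val, Prod.fst_add,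
      Prod.snd_add, add_zero] at h1 ⊢
    refine h1.congr_deriv ?_
    push_cast
    ring

/-- Splitting the pairing of a real function with a complex one. -/
theorem integral_ofReal_mul (f : L2) {Ψ : Dom → ℂ} (hΨ : MemLp Ψ 2 volume) :
    ∫ p, (f p : ℂ) * Ψ p
      = ((∫ p, f p * (Ψ p).re : ℝ) : ℂ) + ((∫ p, f p * (Ψ p).im : ℝ) : ℂ) * I := by
  have h := integral_re_add_im (integrable_mul_of_memLp (memLp_ofReal f) hΨ)
  simp only [RCLike.re_to_complex, RCLike.im_to_complex, Complex.re_ofReal_mul,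
    Complex.im_ofReal_mul, RCLike.I_to_complex] at h
  exact h.symm

theorem HasWeakDeriv.integral_wave {i : Fin 3} {f g : L2} (h : HasWeakDeriv i f g) (k l : ℤ)
    {ψ : ℝ → ℂ} (hψ : IsLineTest ψ) :
    ∫ p, (g p : ℂ) * wave k l ψ p = ∫ p, (f p : ℂ) * wave k l (dualD k l i ψ) p := by
  rw [integral_ofReal_mul g (memLp_wave k l hψ.memLp),
    integral_ofReal_mul f (memLp_wave k l (hψ.dualD k l i).memLp)]
  have h1 := h _ (isTest_wave_re k l hψ)
  have h2 := h _ (isTest_wave_im k l hψ)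
  have e1 : ∀ p, partialD i (fun p => (wave k l ψ p).re) p
      = -(wave k l (dualD k l i ψ) p).re := fun p =>
    (Complex.reCLM.hasFDerivAt.comp_hasDerivAt _ (hasDerivAt_wave k l i hψ p)).deriv
  have e2 : ∀ p, partialD i (fun p => (wave k l ψ p).im) p
      = -(wave k l (dualD k l i ψ) p).im := fun p =>
    (Complex.imCLM.hasFDerivAt.comp_hasDerivAt _ (hasDerivAt_wave k l i hψ p)).deriv
  simp only [e1, e2, mul_neg, integral_neg, neg_inj] at h1 h2
  rw [h1, h2]

/-- Weak derivatives, which are tested with real functions, become weak derivatives of the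
coefficients, which are tested with complex ones. -/
theorem HasWeakDeriv.integral_coef {i : Fin 3} {f g : L2} (h : HasWeakDeriv i f g) (k l : ℤ)
    {ψ : ℝ → ℂ} (hψ : IsLineTest ψ) :
    ∫ y, coef k l g y * ψ y = ∫ y, coef k l f y * dualD k l i ψ y := by
  rw [integral_coef_mul _ _ _ hψ.memLp, integral_coef_mul _ _ _ (hψ.dualD k l i).memLp,
    h.integral_wave k l hψ]

/-- The Fourier transform of a function at the frequency `(k, ξ, l)`, in the frame that has moved
by the shear for the time `a / k`. The shift of `ξ` by `a / 2π` is carried out as a multiplication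
by `e^{i a y}`. -/
def freqT (k l : ℤ) (a : ℝ) (f : L2) : L2R := 𝓕 (modul a (coef k l f))

/-- The symbol of `∂ᵢ` in the moving frame. -/
def derivSymb (k l : ℤ) (a : ℝ) (i : Fin 3) (ξ : ℝ) : ℂ :=
  I * (![(k : ℝ), 2 * Real.pi * ξ - a, (l : ℝ)] i : ℝ)

theorem HasWeakDeriv.freqT_ae_eq {i : Fin 3} {f g : L2} (h : HasWeakDeriv i f g) (k l : ℤ) (a : ℝ) :
    freqT k l a g =ᵐ[volume] fun ξ => derivSymb k l a i ξ * freqT k l a f ξ := by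
  set A : L2R := modul a (coef k l g) with hA
  set G : L2R := modul a (coef k l f) with hG
  obtain ⟨c₀, c₁, hc, hw⟩ : ∃ c₀ c₁ : ℂ, (∀ ξ : ℝ, derivSymb k l a i ξ
      = c₀ + (-2 * Real.pi * I * ξ) * c₁) ∧ ∀ ψ : ℝ → ℂ, IsLineTest ψ →
      ∫ y, A y * ψ y = c₀ * (∫ y, G y * ψ y) + c₁ * ∫ y, G y * deriv ψ y := by
    have h1 : ∀ ψ : ℝ → ℂ, IsLineTest ψ →
        ∫ y, A y * ψ y = ∫ y, coef k l f y * dualD k l i (fun y => osc a y * ψ y) y :=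
      fun ψ hψ => by rw [hA, integral_modul_mul, h.integral_coef k l (hψ.osc_mul a)]
    have h2 : ∀ (c : ℂ) (φ : ℝ → ℂ), ∫ y, coef k l f y * (c * φ y)
        = c * ∫ y, coef k l f y * φ y := by
      intro c φ
      rw [← integral_const_mul]
      congr 1
      funext y
      ring
    fin_cases i
    · refine ⟨I * k, 0, fun ξ => by simp [derivSymb], fun ψ hψ => ?_⟩
      rw [h1 ψ hψ, zero_mul, add_zero, hG, integral_modul_mul, ← h2]
      rfl
    · refine ⟨-(I * a), -1, fun ξ => by simp [derivSymb]; ring, fun ψ hψ => ?_⟩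
      have h3 : ∫ y, coef k l f y * dualD k l 1 (fun y => osc a y * ψ y) y
          = -1 * ∫ y, coef k l f y * deriv (fun y => osc a y * ψ y) y := (h2 _ _)
      rw [h1 ψ hψ]
      change ∫ y, coef k l f y * dualD k l 1 (fun y => osc a y * ψ y) y = _
      rw [h3, integral_mul_deriv_osc _ _ hψ]
      ring
    · refine ⟨I * l, 0, fun ξ => by simp [derivSymb], fun ψ hψ => ?_⟩
      rw [h1 ψ hψ, zero_mul, add_zero, hG, integral_modul_mul, ← h2]
      rfl
  have h3 := fourier_ae_eq_of_weak (A := A) (B₀ := c₀ • G) (B₁ := c₁ • G) (B₂ := 0) fun ψ hψ => by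
    have h0 : ∫ y, (0 : L2R) y * deriv (deriv ψ) y = 0 := by
      rw [← linePairing_test _ hψ.deriv.deriv, map_zero]
    rw [hw ψ hψ, integral_smul_mul _ _ hψ, integral_smul_mul _ _ hψ.deriv, h0, add_zero]
  have h4 : (𝓕 (0 : L2R) : L2R) = 0 := (Lp.fourierTransformₗᵢ ℝ ℂ).map_zero
  have h5 : ∀ c : ℂ, (𝓕 (c • G) : L2R) = c • (𝓕 G : L2R) := fun c =>
    (Lp.fourierTransformₗᵢ ℝ ℂ).map_smul c G
  rw [h4, h5, h5] at h3
  filter_upwards [h3, Lp.coeFn_smul c₀ (𝓕 G : L2R), Lp.coeFn_smul c₁ (𝓕 G : L2R),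
    Lp.coeFn_zero ℂ 2 (volume : Measure ℝ)] with ξ h3 h6 h7 h8
  rw [freqT, freqT, h3, h6, h7, h8, Pi.smul_apply, Pi.smul_apply, hc, smul_eq_mul, smul_eq_mul,
    Pi.zero_apply]
  ring

end Couette

/-! ### The zero mode -/

namespace Couette

open Filter Topology FourierTransform AddCircle
open Complex (I)

/-- The covering `ℝ³ → 𝕋 × ℝ × 𝕋`. -/
def cover (q : ℝ × ℝ × ℝ) : Dom := ((q.1 : Torus), q.2.1, (q.2.2 : Torus))

theorem isOpenQuotientMap_cover : IsOpenQuotientMap cover :=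
  QuotientAddGroup.isOpenQuotientMap_mk.prodMap
    (IsOpenQuotientMap.id.prodMap QuotientAddGroup.isOpenQuotientMap_mk)

theorem IsTest.continuous {φ : Dom → ℝ} (h : IsTest φ) : Continuous φ :=
  isOpenQuotientMap_cover.isQuotientMap.continuous_iff.2 h.smooth.continuous

/-- The unit vectors of `ℝ³`, as directions in the cover. -/
def coverDir (i : Fin 3) : ℝ × ℝ × ℝ := ![(1, 0, 0), (0, 1, 0), (0, 0, 1)] i

theorem cover_add_smul (i : Fin 3) (q : ℝ × ℝ × ℝ) (s : ℝ) :
    cover (q + s • coverDir i) = cover q + shift i s := by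
  fin_cases i <;> simp [cover, coverDir, shift]

theorem IsTest.hasDerivAt {φ : Dom → ℝ} (h : IsTest φ) (i : Fin 3) (q : ℝ × ℝ × ℝ) :
    HasDerivAt (fun s : ℝ => φ (cover q + shift i s))
      (fderiv ℝ (fun q => φ (cover q)) q (coverDir i)) 0 := by
  have h1 : DifferentiableAt ℝ (fun q => φ (cover q)) q := h.smooth.differentiable (by simp) q
  have h2 : HasDerivAt (fun s : ℝ => q + s • coverDir i) (coverDir i) 0 := by
    simpa using ((hasDerivAt_id (0 : ℝ)).smul_const (coverDir i)).const_add q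
  have h3 : HasFDerivAt (fun q => φ (cover q)) (fderiv ℝ (fun q => φ (cover q)) q)
      (q + (0 : ℝ) • coverDir i) := by
    rw [zero_smul, add_zero]; exact h1.hasFDerivAt
  have h4 := h3.comp_hasDerivAt (0 : ℝ) h2
  simpa only [Function.comp_def, cover_add_smul] using h4

theorem IsTest.partialD {φ : Dom → ℝ} (h : IsTest φ) (i : Fin 3) : IsTest (partialD i φ) := by
  refine ⟨?_, ?_⟩
  · have h1 : (fun q : ℝ × ℝ × ℝ => Couette.partialD i φ ((q.1 : Torus), q.2.1, (q.2.2 : Torus)))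
        = fun q => fderiv ℝ (fun q => φ (cover q)) q (coverDir i) :=
      funext fun q => (h.hasDerivAt i q).deriv
    rw [h1]
    exact (h.smooth.fderiv_right (m := ∞) (by simp)).clm_apply contDiff_const
  · refine HasCompactSupport.intro h.compact.isCompact fun p hp => ?_
    have hsh : Continuous fun s : ℝ => p + shift i s := by
      obtain ⟨q, rfl⟩ := isOpenQuotientMap_cover.surjective p
      simp only [← cover_add_smul]
      exact isOpenQuotientMap_cover.continuous.comp (by fun_prop)
    have h0 : p + shift i 0 = p := by fin_cases i <;> simp [shift]
    have h1 : ∀ᶠ s : ℝ in 𝓝 0, φ (p + shift i s) = 0 := by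
      have h2 : (tsupport φ)ᶜ ∈ 𝓝 (p + shift i 0) := by
        rw [h0]; exact (isClosed_tsupport φ).isOpen_compl.mem_nhds hp
      filter_upwards [hsh.continuousAt.preimage_mem_nhds h2] with s hs
      exact image_eq_zero_of_notMem_tsupport hs
    have h3 : (fun s : ℝ => φ (p + shift i s)) =ᶠ[𝓝 0] fun _ => (0 : ℝ) := h1
    rw [Couette.partialD, h3.deriv_eq, deriv_const]

theorem IsTest.translate {φ : Dom → ℝ} (h : IsTest φ) (a : Dom) : IsTest fun p => φ (p + a) := by
  refine ⟨?_, h.compact.comp_homeomorph (Homeomorph.addRight a)⟩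
  obtain ⟨r, rfl⟩ := isOpenQuotientMap_cover.surjective a
  have h1 : (fun q : ℝ × ℝ × ℝ => φ (((q.1 : Torus), q.2.1, (q.2.2 : Torus)) + cover r))
      = fun q => (fun q : ℝ × ℝ × ℝ => φ ((q.1 : Torus), q.2.1, (q.2.2 : Torus))) (q + r) := by
    funext q
    simp [cover]
  rw [h1]
  exact h.smooth.comp (contDiff_id.add contDiff_const)

theorem partialD_translate (i : Fin 3) (φ : Dom → ℝ) (a p : Dom) :
    partialD i (fun p => φ (p + a)) p = partialD i φ (p + a) := by
  simp only [partialD, add_right_comm]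

/-- The averaging in `x` is self-adjoint, and it is a mean of translations. -/
theorem integral_zeroMode_mul {𝕜 : Type*} [RCLike 𝕜] (f : L2) {Ψ : Dom → 𝕜} (hc : Continuous Ψ)
    (hs : HasCompactSupport Ψ) :
    ∫ p, (zeroMode f p : 𝕜) * Ψ p = (((2 * Real.pi)⁻¹ : ℝ) : 𝕜) *
      ∫ s : Torus, ∫ p, (f p : 𝕜) * Ψ (p + (s, 0)) := by
  set A : ℝ × Torus → 𝕜 := fun q => ∫ x : Torus, (f (x, q) : 𝕜) with hA
  set Φ : ℝ × Torus → 𝕜 := fun q => ∫ x : Torus, Ψ (x, q) with hΦ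
  have hΨ : MemLp Ψ 2 volume := hc.memLp_of_hasCompactSupport hs
  have hz : zeroMode f =ᵐ[volume] avgFun f := (memLp_avgFun f).coeFn_toLp
  have havg : ∀ p, (avgFun f p : 𝕜) = (((2 * Real.pi)⁻¹ : ℝ) : 𝕜) * A p.2 := by
    intro p
    simp only [avgFun, hA]
    rw [RCLike.ofReal_mul, integral_ofReal]
  have hi1 : Integrable (fun p => (zeroMode f p : 𝕜) * Ψ p) volume :=
    memLp_one_iff_integrable.1 (MemLp.mul hΨ (Lp.memLp (zeroMode f)).ofReal)
  have hi1' : Integrable (fun p : Dom => ((((2 * Real.pi)⁻¹ : ℝ) : 𝕜) * A p.2) * Ψ p)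
      ((volume : Measure Torus).prod (volume : Measure (ℝ × Torus))) := by
    refine hi1.congr ?_
    filter_upwards [hz] with p hp
    rw [hp, havg]
  have hL : ∫ p, (zeroMode f p : 𝕜) * Ψ p
      = ∫ q : ℝ × Torus, (((2 * Real.pi)⁻¹ : ℝ) : 𝕜) * (A q * Φ q) := by
    have h1 : ∫ p, (zeroMode f p : 𝕜) * Ψ p
        = ∫ p : Dom, ((((2 * Real.pi)⁻¹ : ℝ) : 𝕜) * A p.2) * Ψ p := by
      refine integral_congr_ae ?_
      filter_upwards [hz] with p hp
      rw [hp, havg]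
    rw [h1]
    refine (integral_prod_symm _ hi1').trans ?_
    refine integral_congr_ae (Eventually.of_forall fun q => ?_)
    simp only [hΦ]
    rw [integral_const_mul, mul_assoc]
  -- the translates, as a function on the product with the circle
  set G : Dom × Torus → 𝕜 := fun r => Ψ (r.1 + (r.2, 0)) with hG
  have hGc : Continuous G :=
    hc.comp (continuous_fst.add (continuous_snd.prodMk continuous_const))
  have hGs : HasCompactSupport G := by
    have hK : IsCompact ((univ : Set Torus) ×ˢ (Prod.snd '' tsupport Ψ)) :=
      isCompact_univ.prod (hs.isCompact.image continuous_snd)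
    refine HasCompactSupport.intro (hK.prod (isCompact_univ (X := Torus))) fun r hr => ?_
    have h0 : Ψ (r.1 + (r.2, 0)) = 0 :=
      image_eq_zero_of_notMem_tsupport fun h =>
        hr ⟨⟨mem_univ _, ⟨_, h, by rw [Prod.snd_add, add_zero]⟩⟩, mem_univ _⟩
    exact h0
  have hGm : MemLp G 2 ((volume : Measure Dom).prod (volume : Measure Torus)) :=
    hGc.memLp_of_hasCompactSupport hGs
  have hfm : MemLp (fun r : Dom × Torus => (f r.1 : 𝕜)) 2
      ((volume : Measure Dom).prod (volume : Measure Torus)) :=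
    (Lp.memLp f).ofReal.comp_fst (volume : Measure Torus)
  have hi2 : Integrable (fun r : Dom × Torus => (f r.1 : 𝕜) * G r)
      ((volume : Measure Dom).prod (volume : Measure Torus)) :=
    memLp_one_iff_integrable.1 (MemLp.mul hGm hfm)
  have hin : ∀ p : Dom, ∫ s : Torus, (f p : 𝕜) * G (p, s) = (f p : 𝕜) * Φ p.2 := by
    intro p
    rw [integral_const_mul]
    congr 1
    have h1 : ∀ s : Torus, G (p, s) = Ψ (p.1 + s, p.2) := fun s => by
      change Ψ (p + (s, 0)) = _
      congr 1
      exact Prod.ext rfl (add_zero _)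
    simp only [h1, hΦ]
    exact integral_add_left_eq_self (fun s => Ψ (s, p.2)) p.1
  have hi3 : Integrable (fun p : Dom => (f p : 𝕜) * Φ p.2)
      ((volume : Measure Torus).prod (volume : Measure (ℝ × Torus))) :=
    hi2.integral_prod_left.congr (Eventually.of_forall hin)
  have hR : ∫ s : Torus, ∫ p, (f p : 𝕜) * Ψ (p + (s, 0)) = ∫ q : ℝ × Torus, A q * Φ q := by
    rw [← integral_integral_swap (f := fun p s => (f p : 𝕜) * Ψ (p + (s, 0))) hi2]
    have h1 : ∫ p, ∫ s : Torus, (f p : 𝕜) * Ψ (p + (s, 0)) = ∫ p : Dom, (f p : 𝕜) * Φ p.2 :=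
      integral_congr_ae (Eventually.of_forall hin)
    rw [h1]
    refine (integral_prod_symm _ hi3).trans ?_
    refine integral_congr_ae (Eventually.of_forall fun q => ?_)
    simp only [hA]
    rw [integral_mul_const]
  rw [hL, hR, integral_const_mul]

theorem HasWeakDeriv.zeroMode {i : Fin 3} {f g : L2} (h : HasWeakDeriv i f g) :
    HasWeakDeriv i (zeroMode f) (zeroMode g) := by
  intro φ hφ
  have h1 := integral_zeroMode_mul (𝕜 := ℝ) f (hφ.partialD i).continuous (hφ.partialD i).compact
  have h2 := integral_zeroMode_mul (𝕜 := ℝ) g hφ.continuous hφ.compact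
  simp only [RCLike.ofReal_real_eq_id, id_eq] at h1 h2
  rw [h1, h2, ← mul_neg, ← integral_neg]
  congr 1
  refine integral_congr_ae (Eventually.of_forall fun s => ?_)
  simp only [← h _ (hφ.translate (s, 0)), partialD_translate]

theorem integrable_mul_test (f : L2) {φ : Dom → ℝ} (h : IsTest φ) :
    Integrable fun p => f p * φ p :=
  memLp_one_iff_integrable.1
    (MemLp.mul (q := 2) (h.continuous.memLp_of_hasCompactSupport h.compact) (Lp.memLp f))

theorem HasWeakDeriv.add {i : Fin 3} {f g f' g' : L2} (h : HasWeakDeriv i f g)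
    (h' : HasWeakDeriv i f' g') : HasWeakDeriv i (f + f') (g + g') := by
  intro φ hφ
  have e : ∀ (f f' : L2) {φ : Dom → ℝ}, IsTest φ → ∫ p, (f + f' : L2) p * φ p
      = (∫ p, f p * φ p) + ∫ p, f' p * φ p := by
    intro f f' φ hφ
    rw [← integral_add (integrable_mul_test f hφ) (integrable_mul_test f' hφ)]
    refine integral_congr_ae ?_
    filter_upwards [Lp.coeFn_add f f'] with p hp
    rw [hp, Pi.add_apply, add_mul]
  rw [e f f' (hφ.partialD i), e g g' hφ, h φ hφ, h' φ hφ, neg_add]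

theorem HasWeakDeriv.neg {i : Fin 3} {f g : L2} (h : HasWeakDeriv i f g) :
    HasWeakDeriv i (-f) (-g) := by
  intro φ hφ
  have e : ∀ (f : L2) (φ : Dom → ℝ), ∫ p, (-f : L2) p * φ p = -∫ p, f p * φ p := by
    intro f φ
    rw [← integral_neg]
    refine integral_congr_ae ?_
    filter_upwards [Lp.coeFn_neg f] with p hp
    rw [hp, Pi.neg_apply, neg_mul]
  rw [e, e, h φ hφ]

theorem HasWeakDeriv.nz {i : Fin 3} {f g : L2} (h : HasWeakDeriv i f g) :
    HasWeakDeriv i (nz f) (nz g) := by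
  have := h.add h.zeroMode.neg
  rwa [← sub_eq_add_neg, ← sub_eq_add_neg] at this

theorem hasWeakDeriv_zero (i : Fin 3) : HasWeakDeriv i 0 0 := by
  intro φ _
  have e : ∀ φ : Dom → ℝ, ∫ p, (0 : L2) p * φ p = 0 := by
    intro φ
    rw [← integral_zero Dom ℝ]
    refine integral_congr_ae ?_
    filter_upwards [Lp.coeFn_zero ℝ 2 (volume : Measure Dom)] with p hp
    rw [hp, Pi.zero_apply, zero_mul]
  rw [e, e, neg_zero]

theorem HasWeakDeriv.sum {ι : Type*} (s : Finset ι) {i : Fin 3} {f g : ι → L2}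
    (h : ∀ j ∈ s, HasWeakDeriv i (f j) (g j)) :
    HasWeakDeriv i (∑ j ∈ s, f j) (∑ j ∈ s, g j) := by
  classical
  induction s using Finset.induction_on with
  | empty => exact hasWeakDeriv_zero i
  | insert a s ha ih =>
    rw [Finset.sum_insert ha, Finset.sum_insert ha]
    exact (h a (Finset.mem_insert_self a s)).add
      (ih fun j hj => h j (Finset.mem_insert_of_mem hj))

theorem integral_fourier_circle (k : ℤ) :
    ∫ s : Torus, fourier (-k) s = if k = 0 then 2 * (Real.pi : ℂ) else 0 := by
  have h1 := congrFun (fourierCoeff_fourier (T := 2 * Real.pi) 0) k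
  have h2 : fourierCoeff (fourier (0 : ℤ) : Torus → ℂ) k
      = ((2 * Real.pi)⁻¹ : ℝ) * ∫ s : Torus, fourier (-k) s := by
    rw [fourierCoeff, integral_haarAddCircle, Complex.real_smul]
    congr 2
    funext s
    rw [fourier_zero, smul_eq_mul, mul_one]
  rw [h2] at h1
  have hpi : (2 * Real.pi : ℂ) ≠ 0 := by exact_mod_cast Real.two_pi_pos.ne'
  split_ifs with hk
  · rw [hk, Pi.single_eq_same] at h1
    push_cast at h1
    rw [hk]
    field_simp at h1
    exact h1
  · rw [Pi.single_eq_of_ne hk, mul_eq_zero] at h1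
    refine h1.resolve_left ?_
    push_cast
    exact inv_ne_zero hpi

theorem continuous_wave (k l : ℤ) {ψ : ℝ → ℂ} (h : IsLineTest ψ) : Continuous (wave k l ψ) := by
  have := h.continuous
  unfold wave
  exact ((fourier (-k)).continuous.comp continuous_fst).mul
    (((fourier (-l)).continuous.comp continuous_snd.snd).mul (this.comp continuous_snd.fst))

theorem coef_zeroMode (k l : ℤ) (f : L2) :
    coef k l (zeroMode f) = if k = 0 then coef k l f else 0 := by
  refine L2R_ext fun ψ h => ?_
  have h1 := integral_zeroMode_mul (𝕜 := ℂ) f (continuous_wave k l h) (hasCompactSupport_wave k l h)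
  have h2 : ∀ (s : Torus) (p : Dom), wave k l ψ (p + (s, 0)) = wave k l ψ p * fourier (-k) s := by
    intro s p
    simp only [wave, Prod.fst_add, Prod.snd_add, add_zero,
      fourier_add_apply]
    ring
  simp only [h2, ← mul_assoc, integral_mul_const, integral_const_mul, integral_fourier_circle] at h1
  simp only [Complex.coe_algebraMap] at h1
  rw [integral_coef_mul _ _ _ h.memLp]
  have hpi : (Real.pi : ℂ) ≠ 0 := by exact_mod_cast Real.pi_ne_zero
  split_ifs with hk
  · rw [integral_coef_mul _ _ _ h.memLp]
    congr 1
    refine h1.trans ?_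
    rw [if_pos hk]
    push_cast
    field_simp
  · have h0 : ∫ y, (0 : L2R) y * ψ y = 0 := by
      rw [← linePairing_test _ h, map_zero]
    rw [h0]
    have h3 : ∫ p, (zeroMode f p : ℂ) * wave k l ψ p = 0 := by
      refine h1.trans ?_
      rw [if_neg hk]
      simp
    rw [h3, mul_zero]

theorem coef_nz (k l : ℤ) (f : L2) : coef k l (nz f) = if k = 0 then 0 else coef k l f := by
  rw [nz, coef_sub, coef_zeroMode]
  split_ifs <;> simp

end Couette

/-! ### The equations for the Fourier coefficients of a solution -/

namespace Couette

open Filter Topology FourierTransform AddCircle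
open Complex (I)

/-- Functions in `L²` are determined by their Fourier coefficients. -/
theorem L2_ext {f g : L2} (h : ∀ k l, coef k l f = coef k l g) : f = g := by
  have h1 := hasSum_norm_coef (f - g)
  simp only [coef_sub, h, sub_self, norm_zero, ne_eq, OfNat.ofNat_ne_zero, not_false_eq_true,
    zero_pow] at h1
  have h2 := h1.unique hasSum_zero
  have h3 : ‖f - g‖ = 0 := by
    rcases mul_eq_zero.1 h2 with h3 | h3
    · exact absurd h3 (by positivity)
    · exact pow_eq_zero_iff two_ne_zero |>.1 h3
  exact sub_eq_zero.1 (norm_eq_zero.1 h3)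

theorem HasWeakDeriv.unique {i : Fin 3} {f g g' : L2} (h : HasWeakDeriv i f g)
    (h' : HasWeakDeriv i f g') : g = g' :=
  L2_ext fun k l => L2R_ext fun ψ hψ => by rw [h.integral_coef k l hψ, h'.integral_coef k l hψ]

theorem hasWeakDeriv_weakD {i : Fin 3} {f : L2} (h : ∃ g : L2, HasWeakDeriv i f g) :
    HasWeakDeriv i f (weakD i f) := by
  rw [weakD, dif_pos h]
  exact h.choose_spec

theorem HasWeakDeriv.weakD_eq {i : Fin 3} {f g : L2} (h : HasWeakDeriv i f g) : weakD i f = g :=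
  (hasWeakDeriv_weakD ⟨g, h⟩).unique h

theorem MemH2.hasWeakDeriv {f : L2} (h : MemH2 f) (i : Fin 3) : HasWeakDeriv i f (weakD i f) :=
  hasWeakDeriv_weakD (h.1 i)

theorem MemH2.hasWeakDeriv_snd {f : L2} (h : MemH2 f) (i j : Fin 3) :
    HasWeakDeriv j (weakD i f) (weakD j (weakD i f)) :=
  hasWeakDeriv_weakD (h.2 i j)

theorem hasWeakDeriv_div {u : Fin 3 → L2} (h : ∀ i, MemH2 (u i)) (i : Fin 3) :
    HasWeakDeriv i (div u) (weakD i (div u)) :=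
  hasWeakDeriv_weakD ⟨_, HasWeakDeriv.sum Finset.univ fun j _ => (h j).hasWeakDeriv_snd j i⟩

/-- The coefficients of `1` and `∂ᵧ` in `dualD`. -/
def dualCoef (k l : ℤ) (i : Fin 3) : Fin 2 → ℂ :=
  ![![I * k, 0], ![0, -1], ![I * l, 0]] i

theorem integral_mul_dualD (k l : ℤ) (i : Fin 3) (F : L2R) {ψ : ℝ → ℂ} :
    ∫ y, F y * dualD k l i ψ y
      = dualCoef k l i 0 * (∫ y, F y * ψ y) + dualCoef k l i 1 * ∫ y, F y * deriv ψ y := by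
  have h2 : ∀ (c : ℂ) (φ : ℝ → ℂ), ∫ y, F y * (c * φ y) = c * ∫ y, F y * φ y := by
    intro c φ
    rw [← integral_const_mul]
    congr 1
    funext y
    ring
  fin_cases i
  · simp only [dualD, dualCoef, Fin.zero_eta, Matrix.cons_val_zero, Matrix.cons_val_one, h2]
    simp
  · simp only [dualD, dualCoef, Fin.mk_one, Matrix.cons_val_zero, Matrix.cons_val_one, h2]
    simp
  · simp only [dualD, dualCoef, Fin.reduceFinMk, Matrix.cons_val, h2]
    simp

theorem deriv_dualD (k l : ℤ) (i : Fin 3) {ψ : ℝ → ℂ} (h : IsLineTest ψ) :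
    deriv (dualD k l i ψ) = dualD k l i (deriv ψ) := by
  funext y
  fin_cases i
  · exact ((h.hasDerivAt y).const_mul (I * k)).deriv
  · exact ((h.deriv.hasDerivAt y).const_mul (-1)).deriv
  · exact ((h.hasDerivAt y).const_mul (I * l)).deriv

theorem integral_mul_dualD_dualD (k l : ℤ) (i j : Fin 3) (F : L2R) {ψ : ℝ → ℂ}
    (h : IsLineTest ψ) :
    ∫ y, F y * dualD k l j (dualD k l i ψ) y
      = dualCoef k l i 0 * dualCoef k l j 0 * (∫ y, F y * ψ y)
        + (dualCoef k l i 0 * dualCoef k l j 1 + dualCoef k l i 1 * dualCoef k l j 0)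
          * (∫ y, F y * deriv ψ y)
        + dualCoef k l i 1 * dualCoef k l j 1 * ∫ y, F y * deriv (deriv ψ) y := by
  rw [integral_mul_dualD, deriv_dualD k l i h, integral_mul_dualD, integral_mul_dualD]
  ring

/-- The Fourier coefficients of an evolution equation that is tested with real functions. -/
theorem hasDerivWithinAt_coef {f : ℝ → L2} {g₀ g₁ : L2} {R : Dom → ℝ} {S : Set ℝ} {t : ℝ}
    (h : ∀ φ : Dom → ℝ, IsTest φ → HasDerivWithinAt (fun s => ∫ p, f s p * φ p)
      (-∫ p, (p.2.1 * g₀ p + R p) * φ p) S t) (hR : R =ᵐ[volume] g₁) (k l : ℤ) {ψ : ℝ → ℂ}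
    (hψ : IsLineTest ψ) :
    HasDerivWithinAt (fun s => ∫ y, coef k l (f s) y * ψ y)
      (-((∫ y, coef k l g₀ y * (y * ψ y)) + ∫ y, coef k l g₁ y * ψ y)) S t := by
  have h1 := (h _ (isTest_wave_re k l hψ)).ofReal_comp
  have h2 := (h _ (isTest_wave_im k l hψ)).ofReal_comp
  have h3 := (h1.add (h2.mul_const I)).const_mul ((2 * Real.pi : ℂ)⁻¹ ^ 2)
  refine (h3.congr (fun s _ => ?_) ?_).congr_deriv ?_
  · rw [integral_coef_mul _ _ _ hψ.memLp, integral_ofReal_mul _ (memLp_wave k l hψ.memLp)]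
    rfl
  · rw [integral_coef_mul _ _ _ hψ.memLp, integral_ofReal_mul _ (memLp_wave k l hψ.memLp)]
    rfl
  · have e0 : ∀ᵐ p : Dom, (g₀ p : ℂ) * wave k l (fun y => y * ψ y) p + (g₁ p : ℂ) * wave k l ψ p
        = ((p.2.1 * g₀ p + R p : ℝ) : ℂ) * wave k l ψ p := by
      filter_upwards [hR] with p hp
      rw [hp, wave, wave]
      push_cast
      ring
    have i0 := integrable_mul_wave g₀ k l hψ.id_mul
    have i1 := integrable_mul_wave g₁ k l hψ
    have hint : Integrable (fun p : Dom => ((p.2.1 * g₀ p + R p : ℝ) : ℂ) * wave k l ψ p) :=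
      (i0.add i1).congr e0
    have e1 := integral_re_add_im hint
    simp only [RCLike.re_to_complex, RCLike.im_to_complex, Complex.re_ofReal_mul,
      Complex.im_ofReal_mul, RCLike.I_to_complex] at e1
    have e2 : ∫ p : Dom, ((p.2.1 * g₀ p + R p : ℝ) : ℂ) * wave k l ψ p
        = (∫ p, (g₀ p : ℂ) * wave k l (fun y => y * ψ y) p) + ∫ p, (g₁ p : ℂ) * wave k l ψ p := by
      rw [← integral_add i0 i1]
      exact (integral_congr_ae e0).symm
    rw [integral_coef_mul _ _ _ hψ.memLp, integral_coef_mul _ _ _ hψ.id_mul.memLp, ← mul_add, ← e2,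
      ← e1]
    simp only [RCLike.ofReal_eq_complex_ofReal]
    push_cast
    ring

theorem coef_smul_integral (k l : ℤ) (c : ℝ) (f : L2) {ψ : ℝ → ℂ} (hψ : IsLineTest ψ) :
    ∫ y, coef k l (c • f) y * ψ y = c * ∫ y, coef k l f y * ψ y := by
  rw [integral_coef_mul _ _ _ hψ.memLp, integral_coef_mul _ _ _ hψ.memLp, mul_left_comm,
    ← integral_const_mul (c : ℂ)]
  congr 1
  refine integral_congr_ae ?_
  filter_upwards [Lp.coeFn_smul c f] with p hp
  rw [hp, Pi.smul_apply, smul_eq_mul]; push_cast; ring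

theorem coef_sub_integral (k l : ℤ) (f g : L2) {ψ : ℝ → ℂ} (hψ : IsLineTest ψ) :
    ∫ y, coef k l (f - g) y * ψ y = (∫ y, coef k l f y * ψ y) - ∫ y, coef k l g y * ψ y := by
  simp only [coef_sub, ← linePairing_test _ hψ, map_sub]

theorem coef_sum_integral (k l : ℤ) {ι : Type*} (s : Finset ι) (f : ι → L2) {ψ : ℝ → ℂ}
    (hψ : IsLineTest ψ) :
    ∫ y, coef k l (∑ i ∈ s, f i) y * ψ y = ∑ i ∈ s, ∫ y, coef k l (f i) y * ψ y := by
  simp only [coef_sum, ← linePairing_test _ hψ, map_sum]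

theorem coef_add_integral (k l : ℤ) (f g : L2) {ψ : ℝ → ℂ} (hψ : IsLineTest ψ) :
    ∫ y, coef k l (f + g) y * ψ y = (∫ y, coef k l f y * ψ y) + ∫ y, coef k l g y * ψ y := by
  simp only [coef_add, ← linePairing_test _ hψ, map_add]

/-- The coefficients of the linearized system on the line, for the unknowns `b` (`none`) and the
components of the velocity (`some i`). They act on test functions, as in `IsLineSol`. -/
def couetteCoef (ε μ lam : ℝ) (k l : ℤ) : Option (Fin 3) → Option (Fin 3) → Fin 3 → ℂ
  | none, none => 0
  | none, some j => ![-dualCoef k l j 0, -dualCoef k l j 1, 0]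
  | some i, none => ![-(dualCoef k l i 0 / ε ^ 2), -(dualCoef k l i 1 / ε ^ 2), 0]
  | some i, some j =>
    ![(lam + μ) * (dualCoef k l i 0 * dualCoef k l j 0)
        - (if i = j then μ * ((k : ℂ) ^ 2 + (l : ℂ) ^ 2) else 0)
        - (if i = 0 then if j = 1 then 1 else 0 else 0),
      (lam + μ) * (dualCoef k l i 0 * dualCoef k l j 1 + dualCoef k l i 1 * dualCoef k l j 0),
      (lam + μ) * (dualCoef k l i 1 * dualCoef k l j 1) + if i = j then (μ : ℂ) else 0]

/-- The Fourier coefficients of the unknowns. -/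
def lineCurve (k l : ℤ) (b : ℝ → L2) (u : ℝ → Fin 3 → L2) (s : ℝ) : Option (Fin 3) → L2R
  | none => coef k l (b s)
  | some i => coef k l (u s i)

theorem integral_coef_lap (k l : ℤ) {f : L2} (hf : MemH2 f) {ψ : ℝ → ℂ} (hψ : IsLineTest ψ) :
    ∫ y, coef k l (lap f) y * ψ y = -((k : ℂ) ^ 2 + (l : ℂ) ^ 2) * (∫ y, coef k l f y * ψ y)
      + ∫ y, coef k l f y * deriv (deriv ψ) y := by
  rw [lap, coef_sum_integral _ _ _ _ hψ]
  simp only [fun i => (hf.hasWeakDeriv_snd i i).integral_coef k l hψ,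
    fun i => (hf.hasWeakDeriv i).integral_coef k l (hψ.dualD k l i),
    fun i => integral_mul_dualD_dualD k l i i (coef k l f) hψ, Fin.sum_univ_three, dualCoef,
    Matrix.cons_val_zero, Matrix.cons_val_one, Matrix.cons_val]
  linear_combination ((k : ℂ) ^ 2 + (l : ℂ) ^ 2) * (∫ y, coef k l f y * ψ y) * Complex.I_sq

theorem integral_coef_div (k l : ℤ) {u : Fin 3 → L2} (hu : ∀ i, MemH2 (u i)) {ψ : ℝ → ℂ}
    (hψ : IsLineTest ψ) :
    ∫ y, coef k l (div u) y * ψ y = ∑ j, ∫ y, coef k l (u j) y * dualD k l j ψ y := by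
  rw [div, coef_sum_integral _ _ _ _ hψ]
  exact Finset.sum_congr rfl fun j _ => ((hu j).hasWeakDeriv j).integral_coef k l hψ

/-- The Fourier coefficients of a solution in `x` and `z` solve a transport-diffusion system on the
line. -/
theorem IsSolution.isLineSol {ε μ lam : ℝ} {bin : L2} {uin : Fin 3 → L2} {b : ℝ → L2}
    {u : ℝ → Fin 3 → L2} (h : IsSolution ε μ lam bin uin b u) (k l : ℤ) :
    IsLineSol k (couetteCoef ε μ lam k l) (lineCurve k l b u) := by
  refine ⟨?_, fun ψ hψ i t ht => ?_⟩
  · refine continuousOn_pi.2 fun i => ?_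
    cases i with
    | none => exact (coefL k l).continuous.comp_continuousOn h.continuous_b
    | some i =>
      exact (coefL k l).continuous.comp_continuousOn
        ((continuous_apply i).comp_continuousOn h.continuous_u)
  have hu := h.memH2_u t ht
  have hb := h.memH2_b t ht
  cases i with
  | none =>
    have h1 := hasDerivWithinAt_coef (R := div (u t)) (fun φ hφ => h.mass φ hφ t ht)
      EventuallyEq.rfl k l hψ
    refine h1.congr_deriv ?_
    rw [(hb.hasWeakDeriv 0).integral_coef k l hψ.id_mul, integral_mul_dualD,
      integral_coef_div k l hu hψ, Fintype.sum_option]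
    simp only [integral_mul_dualD, couetteCoef, lineCurve, Pi.zero_apply, Matrix.cons_val_zero,
      Matrix.cons_val_one, Matrix.cons_val, Fin.sum_univ_three]
    simp only [dualCoef, Matrix.cons_val_zero, Matrix.cons_val_one, Matrix.cons_val]
    push_cast
    ring
  | some i =>
    set g₁ : L2 := (if i = 0 then u t 1 else 0) + (ε ^ 2)⁻¹ • weakD i (b t) - μ • lap (u t i)
      - (lam + μ) • weakD i (div (u t)) with hg₁
    have hR : (fun p => (if i = 0 then u t 1 p else 0) + weakD i (b t) p / ε ^ 2
        - μ * lap (u t i) p - (lam + μ) * weakD i (div (u t)) p) =ᵐ[volume] g₁ := by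
      set a₀ : L2 := if i = 0 then u t 1 else 0 with ha₀
      have ha : ∀ᵐ p, a₀ p = if i = 0 then u t 1 p else 0 := by
        rw [ha₀]
        split_ifs
        · exact Eventually.of_forall fun _ => rfl
        · exact Lp.coeFn_zero ℝ 2 volume
      filter_upwards [ha, Lp.coeFn_sub (a₀ + (ε ^ 2)⁻¹ • weakD i (b t) - μ • lap (u t i))
          ((lam + μ) • weakD i (div (u t))),
        Lp.coeFn_sub (a₀ + (ε ^ 2)⁻¹ • weakD i (b t)) (μ • lap (u t i)),
        Lp.coeFn_add a₀ ((ε ^ 2)⁻¹ • weakD i (b t)), Lp.coeFn_smul (ε ^ 2)⁻¹ (weakD i (b t)),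
        Lp.coeFn_smul μ (lap (u t i)), Lp.coeFn_smul (lam + μ) (weakD i (div (u t)))]
        with p h0 h1 h2 h3 h4 h5 h6
      rw [h1, Pi.sub_apply, h2, Pi.sub_apply, h3, Pi.add_apply, h4, h5, h6, h0, Pi.smul_apply,
        Pi.smul_apply, Pi.smul_apply]
      simp only [smul_eq_mul]
      ring
    have h1 := hasDerivWithinAt_coef (f := fun s => u s i) (g₀ := weakD 0 (u t i)) (fun φ hφ => by
      refine (h.momentum i φ hφ t ht).congr_deriv ?_
      congr 2
      funext p
      ring) hR k l hψ
    refine h1.congr_deriv ?_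
    have ha : ∫ y, coef k l (if i = 0 then u t 1 else 0) y * ψ y
        = if i = 0 then ∫ y, coef k l (u t 1) y * ψ y else 0 := by
      split_ifs
      · rfl
      · rw [← coefL_apply, map_zero, ← linePairing_test _ hψ, map_zero]
    rw [((hu i).hasWeakDeriv 0).integral_coef k l hψ.id_mul, integral_mul_dualD, hg₁,
      coef_sub_integral _ _ _ _ hψ, coef_sub_integral _ _ _ _ hψ, coef_add_integral _ _ _ _ hψ,
      coef_smul_integral _ _ _ _ hψ, coef_smul_integral _ _ _ _ hψ, coef_smul_integral _ _ _ _ hψ,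
      ha, (hb.hasWeakDeriv i).integral_coef k l hψ, integral_mul_dualD,
      integral_coef_lap k l (hu i) hψ, (hasWeakDeriv_div hu i).integral_coef k l hψ,
      integral_coef_div k l hu (hψ.dualD k l i), Fintype.sum_option]
    simp only [fun j => integral_mul_dualD_dualD k l i j (coef k l (u t j)) hψ, couetteCoef,
      lineCurve, Matrix.cons_val_zero, Matrix.cons_val_one, Matrix.cons_val, Fin.sum_univ_three]
    fin_cases i <;> simp [dualCoef] <;> ring

end Couette

/-! ### Passage to the frequency side -/

namespace Couette

open Filter Topology FourierTransform AddCircle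
open Complex (I)

theorem freqT_sub (k l : ℤ) (a : ℝ) (f g : L2) :
    freqT k l a (f - g) =ᵐ[volume] fun ξ => freqT k l a f ξ - freqT k l a g ξ := by
  have h : freqT k l a (f - g) = freqT k l a f - freqT k l a g := by
    rw [freqT, coef_sub, map_sub]
    exact map_sub (Lp.fourierTransformₗᵢ ℝ ℂ) _ _
  rw [h]
  exact Lp.coeFn_sub _ _

theorem freqT_sum (k l : ℤ) (a : ℝ) (f : Fin 3 → L2) :
    freqT k l a (∑ i, f i) =ᵐ[volume] fun ξ => ∑ i, freqT k l a (f i) ξ := by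
  have h : freqT k l a (∑ i, f i) = ∑ i, freqT k l a (f i) := by
    rw [freqT, coef_sum, map_sum, FourierTransform.fourier_sum]
    rfl
  rw [h]
  exact Lp.coeFn_finsetSum _ _

theorem freqT_weakD_weakD (k l : ℤ) (a : ℝ) {f : L2} (hf : MemH2 f) (i j : Fin 3) :
    freqT k l a (weakD j (weakD i f)) =ᵐ[volume]
      fun ξ => derivSymb k l a j ξ * (derivSymb k l a i ξ * freqT k l a f ξ) := by
  filter_upwards [(hf.hasWeakDeriv_snd i j).freqT_ae_eq k l a,
    (hf.hasWeakDeriv i).freqT_ae_eq k l a] with ξ h1 h2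
  rw [h1, h2]

theorem freqT_lap (k l : ℤ) (a : ℝ) {f : L2} (hf : MemH2 f) :
    freqT k l a (lap f) =ᵐ[volume]
      fun ξ => ∑ i, derivSymb k l a i ξ * (derivSymb k l a i ξ * freqT k l a f ξ) := by
  have h := ae_all_iff.2 fun i => freqT_weakD_weakD k l a hf i i
  filter_upwards [freqT_sum k l a fun i => weakD i (weakD i f), h] with ξ h1 h2
  rw [lap, h1]
  exact Finset.sum_congr rfl fun i _ => h2 i

theorem freqT_div (k l : ℤ) (a : ℝ) {u : Fin 3 → L2} (hu : ∀ i, MemH2 (u i)) :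
    freqT k l a (div u) =ᵐ[volume]
      fun ξ => ∑ i, derivSymb k l a i ξ * freqT k l a (u i) ξ := by
  have h := ae_all_iff.2 fun i => ((hu i).hasWeakDeriv i).freqT_ae_eq k l a
  filter_upwards [freqT_sum k l a fun i => weakD i (u i), h] with ξ h1 h2
  rw [div, h1]
  exact Finset.sum_congr rfl fun i _ => h2 i

theorem freqT_weakD_div (k l : ℤ) (a : ℝ) {u : Fin 3 → L2} (hu : ∀ i, MemH2 (u i)) (i : Fin 3) :
    freqT k l a (weakD i (div u)) =ᵐ[volume]
      fun ξ => derivSymb k l a i ξ * ∑ j, derivSymb k l a j ξ * freqT k l a (u j) ξ := by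
  filter_upwards [(hasWeakDeriv_div hu i).freqT_ae_eq k l a, freqT_div k l a hu] with ξ h1 h2
  rw [h1, h2]

theorem freqT_lap_sub_weakD_div (k l : ℤ) (a : ℝ) {u : Fin 3 → L2} (hu : ∀ i, MemH2 (u i))
    (i : Fin 3) :
    freqT k l a (lap (u i) - weakD i (div u)) =ᵐ[volume]
      fun ξ => (∑ j, derivSymb k l a j ξ * (derivSymb k l a j ξ * freqT k l a (u i) ξ))
        - derivSymb k l a i ξ * ∑ j, derivSymb k l a j ξ * freqT k l a (u j) ξ := by
  filter_upwards [freqT_sub k l a (lap (u i)) (weakD i (div u)), freqT_lap k l a (hu i),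
    freqT_weakD_div k l a hu i] with ξ h1 h2 h3
  rw [h1, h2, h3]

/-- In the moving frame the symbol of `∂ᵢ` at time `s` is `i k`, `i (η - k s)`, `i l`. -/
theorem derivSymb_eq {k : ℤ} (hk : k ≠ 0) (l : ℤ) (s : ℝ) (i : Fin 3) (ξ : ℝ) :
    derivSymb k l (k * s) i ξ
      = I * (![(k : ℝ), freqY k (2 * Real.pi * ξ / k) s, (l : ℝ)] i : ℝ) := by
  have hk' : (k : ℝ) ≠ 0 := Int.cast_ne_zero.2 hk
  have h : freqY k (2 * Real.pi * ξ / k) s = 2 * Real.pi * ξ - k * s := by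
    rw [freqY]; field_simp; ring
  rw [h, derivSymb]

theorem norm_derivSymb_mul_sq {k : ℤ} (hk : k ≠ 0) (l : ℤ) (s : ℝ) (i : Fin 3) (ξ : ℝ) (z : ℂ) :
    ‖derivSymb k l (k * s) i ξ * z‖ ^ 2
      = ![(k : ℝ), freqY k (2 * Real.pi * ξ / k) s, (l : ℝ)] i ^ 2 * ‖z‖ ^ 2 := by
  rw [derivSymb_eq hk, norm_mul, norm_mul, Complex.norm_I, one_mul, mul_pow, Complex.norm_real,
    Real.norm_eq_abs, sq_abs]

theorem sum_derivSymb_mul {k : ℤ} (hk : k ≠ 0) (l : ℤ) (s ξ : ℝ) (U : Fin 3 → ℝ → ℂ) :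
    ∑ i, derivSymb k l (k * s) i ξ * U i s
      = divC k l (2 * Real.pi * ξ / k) (U 0) (U 1) (U 2) s := by
  simp only [derivSymb_eq hk, Fin.sum_univ_three, divC, Matrix.cons_val_zero, Matrix.cons_val_one,
    Matrix.cons_val]
  ring

theorem sum_derivSymb_mul_mul {k : ℤ} (hk : k ≠ 0) (l : ℤ) (s ξ : ℝ) (z : ℂ) :
    ∑ i, derivSymb k l (k * s) i ξ * (derivSymb k l (k * s) i ξ * z)
      = -(symb k l (2 * Real.pi * ξ / k) s * z) := by
  simp only [derivSymb_eq hk, Fin.sum_univ_three, symb, Matrix.cons_val_zero, Matrix.cons_val_one,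
    Matrix.cons_val]
  push_cast
  ring_nf
  rw [Complex.I_sq]
  ring

theorem norm_neg_ofReal_mul_sq (r : ℝ) (z : ℂ) : ‖-((r : ℂ) * z)‖ ^ 2 = r ^ 2 * ‖z‖ ^ 2 := by
  rw [norm_neg, norm_mul, mul_pow, Complex.norm_real, Real.norm_eq_abs, sq_abs]

theorem norm_coef_sq (k l : ℤ) (a : ℝ) (f : L2) :
    ‖coef k l f‖ ^ 2 = ∫ ξ, ‖freqT k l a f ξ‖ ^ 2 := by
  rw [← norm_sq_eq_integral, freqT, Lp.norm_fourier_eq, LinearIsometry.norm_map]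

theorem integrable_norm_freqT_sq (k l : ℤ) (a : ℝ) (f : L2) :
    Integrable fun ξ => ‖freqT k l a f ξ‖ ^ 2 :=
  (Lp.memLp (freqT k l a f)).integrable_norm_pow two_ne_zero

/-- A weighted sum of squared norms. -/
def quadSum {E : Type*} [Norm E] (L : List (ℝ × E)) : ℝ := (L.map fun p => p.1 * ‖p.2‖ ^ 2).sum

theorem hasSum_quadSum_nz (L : List (ℝ × L2)) :
    HasSum (fun p : ℤ × ℤ => quadSum (L.map fun q => (q.1, coef p.1 p.2 (nz q.2))))
      ((2 * Real.pi)⁻¹ ^ 2 * quadSum (L.map fun q => (q.1, nz q.2))) := by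
  induction L with
  | nil => simp [quadSum]
  | cons q L ih =>
    have h := ((hasSum_norm_coef (nz q.2)).mul_left q.1).add ih
    simp only [quadSum, List.map_cons, List.sum_cons] at h ⊢
    rw [mul_add, mul_left_comm]
    exact h

/-- Plancherel for a weighted sum; the modulation by `a` does not change the norms. -/
theorem quadSum_coef (L : List (ℝ × L2)) (k l : ℤ) (a : ℝ) :
    Integrable (fun ξ => quadSum (L.map fun q => (q.1, freqT k l a q.2 ξ))) ∧
    quadSum (L.map fun q => (q.1, coef k l q.2))
      = ∫ ξ, quadSum (L.map fun q => (q.1, freqT k l a q.2 ξ)) := by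
  induction L with
  | nil => simp [quadSum]
  | cons q L ih =>
    simp only [quadSum, List.map_cons, List.sum_cons] at ih ⊢
    have h := (integrable_norm_freqT_sq k l a q.2).const_mul q.1
    refine ⟨h.add ih.1, ?_⟩
    rw [integral_add h ih.1, ih.2, norm_coef_sq k l a, integral_const_mul]

/-- An inequality between quadratic expressions that holds at almost every frequency with `k ≠ 0`
holds for the norms of the non-zero modes, by Plancherel. The two sides may be taken in the moving
frames of different times. -/
theorem quadSum_nz_le {L L' : List (ℝ × L2)} {t t' : ℝ}
    (h : ∀ k l : ℤ, k ≠ 0 → ∀ᵐ ξ : ℝ,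
      quadSum (L.map fun q => (q.1, freqT k l (k * t) q.2 ξ))
        ≤ quadSum (L'.map fun q => (q.1, freqT k l (k * t') q.2 ξ))) :
    quadSum (L.map fun q => (q.1, nz q.2)) ≤ quadSum (L'.map fun q => (q.1, nz q.2)) := by
  refine le_of_mul_le_mul_left (hasSum_le (fun p => ?_) (hasSum_quadSum_nz L)
    (hasSum_quadSum_nz L')) (by positivity : (0 : ℝ) < (2 * Real.pi)⁻¹ ^ 2)
  obtain ⟨k, l⟩ := p
  simp only [coef_nz]
  split_ifs with hk
  · simp [quadSum, Function.comp_def]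
  · rw [(quadSum_coef L k l (k * t)).2, (quadSum_coef L' k l (k * t')).2]
    exact integral_mono_ae (quadSum_coef L k l (k * t)).1 (quadSum_coef L' k l (k * t')).1
      (h k l hk)

/-- Almost every frequency of a solution solves the ordinary differential equation, with the
critical time `2 π ξ / k`. -/
theorem IsSolution.ae_exists_isModeSol {ε μ lam : ℝ} {bin : L2} {uin : Fin 3 → L2} {b : ℝ → L2}
    {u : ℝ → Fin 3 → L2} (h : IsSolution ε μ lam bin uin b u) {t : ℝ} (ht : 0 ≤ t) {k : ℤ}
    (hk : k ≠ 0) (l : ℤ) :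
    ∀ᵐ ξ : ℝ, ∃ (B : ℝ → ℂ) (U : Fin 3 → ℝ → ℂ),
      IsModeSol ε μ lam k l (2 * Real.pi * ξ / k) t B (U 0) (U 1) (U 2) ∧
      B 0 = freqT k l (k * 0) bin ξ ∧ (∀ i, U i 0 = freqT k l (k * 0) (uin i) ξ) ∧
      B t = freqT k l (k * t) (b t) ξ ∧ ∀ i, U i t = freqT k l (k * t) (u t i) ξ := by
  filter_upwards [(h.isLineSol k l).ae_exists_mode ht] with ξ ⟨w, hw, h0, hT⟩
  have hk' : (k : ℝ) ≠ 0 := Int.cast_ne_zero.2 hk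
  have hY : ∀ s, freqY k (2 * Real.pi * ξ / k) s = 2 * Real.pi * ξ - k * s := by
    intro s
    rw [freqY]; field_simp; ring
  refine ⟨fun s => w s none, fun i s => w s (some i), ⟨?_, ?_, ?_, ?_⟩, ?_, ?_, hT none,
    fun i => hT (some i)⟩
  · intro s _
    refine (hw s none).congr_deriv ?_
    rw [← hY]
    simp only [Fintype.sum_option, Fin.sum_univ_three, couetteCoef, dualCoef, divC, Pi.zero_apply,
      Matrix.cons_val_zero, Matrix.cons_val_one, Matrix.cons_val]
    push_cast
    ring
  · intro s _
    refine (hw s (some 0)).congr_deriv ?_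
    rw [← hY]
    simp [Fintype.sum_option, Fin.sum_univ_three, couetteCoef, dualCoef, divC, symb]
    ring_nf
    simp only [Complex.I_sq]
    ring
  · intro s _
    refine (hw s (some 1)).congr_deriv ?_
    rw [← hY]
    simp [Fintype.sum_option, Fin.sum_univ_three, couetteCoef, dualCoef, divC, symb]
    ring_nf
    simp only [Complex.I_sq]
    ring
  · intro s _
    refine (hw s (some 2)).congr_deriv ?_
    rw [← hY]
    simp [Fintype.sum_option, Fin.sum_univ_three, couetteCoef, dualCoef, divC, symb]
    ring_nf
    simp only [Complex.I_sq]
    ring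
  · beta_reduce
    rw [h0 none, freqT, mul_zero, modul_zero, ← h.init_b]
    rfl
  · intro i
    beta_reduce
    rw [h0 (some i), freqT, mul_zero, modul_zero, ← h.init_u]
    rfl

end Couette

/-! ### The non-zero modes and the estimates in `L²` -/

namespace Couette

open Filter Topology

theorem nz_sub (f g : L2) : nz (f - g) = nz f - nz g := by
  refine L2_ext fun k l => ?_
  rw [coef_sub, coef_nz, coef_nz, coef_nz, coef_sub]
  split_ifs
  · rw [sub_zero]
  · rfl

theorem nz_sum (f : Fin 3 → L2) : nz (∑ i, f i) = ∑ i, nz (f i) := by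
  refine L2_ext fun k l => ?_
  rw [coef_sum, coef_nz, coef_sum]
  simp only [coef_nz]
  split_ifs
  · simp
  · rfl

theorem weakD_nz {i : Fin 3} {f g : L2} (h : HasWeakDeriv i f g) :
    weakD i (nz f) = nz (weakD i f) := by
  rw [h.nz.weakD_eq, h.weakD_eq]

theorem MemH2.weakD_weakD_nz {f : L2} (hf : MemH2 f) (i j : Fin 3) :
    weakD j (weakD i (nz f)) = nz (weakD j (weakD i f)) := by
  rw [weakD_nz (hf.hasWeakDeriv i), weakD_nz (hf.hasWeakDeriv_snd i j)]

theorem MemH2.lap_nz {f : L2} (hf : MemH2 f) : lap (nz f) = nz (lap f) := by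
  simp only [lap, nz_sum, hf.weakD_weakD_nz]

theorem div_nzV {u : Fin 3 → L2} (hu : ∀ i, MemH2 (u i)) : div (nzV u) = nz (div u) := by
  simp only [div, nzV, nz_sum, fun i => weakD_nz ((hu i).hasWeakDeriv i)]

theorem weakD_div_nzV {u : Fin 3 → L2} (hu : ∀ i, MemH2 (u i)) (i : Fin 3) :
    weakD i (div (nzV u)) = nz (weakD i (div u)) := by
  rw [div_nzV hu, weakD_nz (hasWeakDeriv_div hu i)]

/-- A derivative in `x` has no zero mode. -/
theorem nz_eq_self {f g : L2} (h : HasWeakDeriv 0 f g) : nz g = g := by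
  refine L2_ext fun k l => ?_
  rw [coef_nz]
  split_ifs with hk
  · have h0 : coef k l g = 0 := L2R_ext fun ψ hψ => by
      rw [h.integral_coef k l hψ, integral_mul_dualD]
      have : ∫ y, (0 : L2R) y * ψ y = 0 := by
        rw [← linePairing_test _ hψ, map_zero]
      rw [this]
      simp [dualCoef, hk]
    rw [h0]
  · rfl

/-- The parameters of the system, in terms of `σ = μ ^ (1 / 3)`. -/
theorem admissible_of_viscosity {ε μ lam : ℝ} (hε : 0 < ε) (hμ : 0 < μ) (h : 0 ≤ 2 * μ + 3 * lam)
    (h1 : lam + 2 * μ ≤ 1) (h2 : μ ^ (1 / 3 : ℝ) * ε ≤ 1 / 4)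
    (h3 : μ ^ (1 / 3 : ℝ) * (lam + 2 * μ) * ε ^ 2 ≤ 1) :
    Admissible ε μ lam (μ ^ (1 / 3 : ℝ)) where
  hε := hε
  hσ := Real.rpow_pos_of_pos hμ _
  hμ := by
    rw [← Real.rpow_natCast, ← Real.rpow_mul hμ.le]
    norm_num
  hν := by linarith
  hν1 := h1
  hσε := h2
  hσν := h3


theorem one_le_intCast_sq {k : ℤ} (hk : k ≠ 0) : (1 : ℝ) ≤ (k : ℝ) ^ 2 := by
  exact_mod_cast (one_le_sq_iff_one_le_abs k).2 (Int.one_le_abs hk)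

/-- The first inequality, with `σ = μ ^ (1 / 3)` and the projections onto the non-zero modes taken
last. -/
theorem IsSolution.exists_estimate_xz (ε : ℝ) :
    ∃ C : ℝ, 0 < C ∧ ∀ (μ lam σ t : ℝ) (bin : L2) (uin : Fin 3 → L2) (b : ℝ → L2)
      (u : ℝ → Fin 3 → L2), Admissible ε μ lam σ → MemH2 bin → (∀ i, MemH2 (uin i)) → 0 ≤ t →
      IsSolution ε μ lam bin uin b u →
      μ * ((∑ i : Fin 3, (‖nz (weakD i (weakD 0 (b t)))‖ ^ 2 + ‖nz (weakD i (weakD 2 (b t)))‖ ^ 2))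
            / ε ^ 2
          + (‖nz (weakD 0 (div (u t)))‖ ^ 2 + ‖nz (weakD 2 (div (u t)))‖ ^ 2)
          + ‖nz (lap (u t 1) - weakD 1 (div (u t)))‖ ^ 2)
        + σ ^ 4 * ‖nz (lap (u t 2) - weakD 2 (div (u t)))‖ ^ 2
      ≤ C * Real.exp (-(σ * t / 22)) *
        ((∑ i : Fin 3, (‖nz (weakD i (weakD 0 bin))‖ ^ 2 + ‖nz (weakD i (weakD 2 bin))‖ ^ 2))
            / ε ^ 2
          + (∑ i : Fin 3, ‖nz (weakD i (div uin))‖ ^ 2)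
          + ‖nz (lap (uin 1))‖ ^ 2 + ‖nz (lap (uin 2))‖ ^ 2) := by
  obtain ⟨C, hC, hmain⟩ := exists_mode_estimate_xz ε
  refine ⟨C, hC, fun μ lam σ t bin uin b u had hbin huin ht hsol => ?_⟩
  set K : ℝ := C * Real.exp (-(σ * t / 22)) with hK
  have hb := hsol.memH2_b t ht
  have hu := hsol.memH2_u t ht
  have key := quadSum_nz_le (t := t) (t' := 0)
    (L := [(μ / ε ^ 2, weakD 0 (weakD 0 (b t))), (μ / ε ^ 2, weakD 1 (weakD 0 (b t))),
      (μ / ε ^ 2, weakD 2 (weakD 0 (b t))), (μ / ε ^ 2, weakD 0 (weakD 2 (b t))),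
      (μ / ε ^ 2, weakD 1 (weakD 2 (b t))), (μ / ε ^ 2, weakD 2 (weakD 2 (b t))),
      (μ, weakD 0 (div (u t))), (μ, weakD 2 (div (u t))),
      (μ, lap (u t 1) - weakD 1 (div (u t))), (σ ^ 4, lap (u t 2) - weakD 2 (div (u t)))])
    (L' := [(K / ε ^ 2, weakD 0 (weakD 0 bin)), (K / ε ^ 2, weakD 1 (weakD 0 bin)),
      (K / ε ^ 2, weakD 2 (weakD 0 bin)), (K / ε ^ 2, weakD 0 (weakD 2 bin)),
      (K / ε ^ 2, weakD 1 (weakD 2 bin)), (K / ε ^ 2, weakD 2 (weakD 2 bin)),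
      (K, weakD 0 (div uin)), (K, weakD 1 (div uin)), (K, weakD 2 (div uin)),
      (K, lap (uin 1)), (K, lap (uin 2))]) ?_
  · simp only [quadSum, List.map_cons, List.map_nil, List.sum_cons, List.sum_nil] at key
    simp only [Fin.sum_univ_three]
    refine le_trans (le_of_eq ?_) (key.trans (le_of_eq ?_)) <;> ring
  intro k l hk
  filter_upwards [hsol.ae_exists_isModeSol ht hk l,
    ae_all_iff.2 fun i => ae_all_iff.2 fun j => freqT_weakD_weakD k l (k * t) hb i j,
    ae_all_iff.2 fun i => freqT_weakD_div k l (k * t) hu i,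
    ae_all_iff.2 fun i => freqT_lap_sub_weakD_div k l (k * t) hu i,
    ae_all_iff.2 fun i => ae_all_iff.2 fun j => freqT_weakD_weakD k l (k * 0) hbin i j,
    ae_all_iff.2 fun i => freqT_weakD_div k l (k * 0) huin i,
    ae_all_iff.2 fun i => freqT_lap k l (k * 0) (huin i)]
    with ξ ⟨B, U, hmode, hB0, hU0, hBt, hUt⟩ h1 h2 h3 h4 h5 h6
  have h := hmain μ lam σ k l (2 * Real.pi * ξ / k) t B (U 0) (U 1) (U 2) had
    (one_le_intCast_sq hk) ht hmode
  simp only [quadSum, List.map_cons, List.map_nil, List.sum_cons, List.sum_nil]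
  simp only [h1, h2, h3, h4, h5, h6, ← hB0, ← hBt, ← hU0, ← hUt, sum_derivSymb_mul hk,
    sum_derivSymb_mul_mul hk, norm_derivSymb_mul_sq hk, norm_neg_ofReal_mul_sq]
  simp only [derivSymb_eq hk, Matrix.cons_val_zero, Matrix.cons_val_one, Matrix.cons_val]
  simp only [vortY, vortZ, ← had.hμ, ← hK] at h ⊢
  refine le_trans (le_of_eq ?_) (h.trans (le_of_eq ?_))
  · simp only [symb]
    ring
  · simp only [symb]
    ring

/-- The second inequality, in the same form. -/
theorem IsSolution.exists_estimate_y (ε : ℝ) :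
    ∃ C : ℝ, 0 < C ∧ ∀ (μ lam σ t : ℝ) (bin : L2) (uin : Fin 3 → L2) (b : ℝ → L2)
      (u : ℝ → Fin 3 → L2), Admissible ε μ lam σ → MemH2 bin → (∀ i, MemH2 (uin i)) → 0 ≤ t →
      IsSolution ε μ lam bin uin b u →
      μ * ((∑ i : Fin 3, ‖nz (weakD i (weakD 1 (b t)))‖ ^ 2) / ε ^ 2
          + ‖nz (weakD 1 (div (u t)))‖ ^ 2)
        + σ ^ 4 * ‖nz (lap (u t 0) - weakD 0 (div (u t)))‖ ^ 2
      ≤ C * Real.exp (-(σ * t / 44)) *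
        ((σ ^ 2)⁻¹ *
            ((∑ i : Fin 3, ‖nz (weakD i (weakD 0 bin))‖ ^ 2) / ε ^ 2
              + (‖nz (weakD 0 (div uin))‖ ^ 2 + ‖nz (weakD 1 (div uin))‖ ^ 2)
              + ‖nz (lap (uin 1))‖ ^ 2)
          + (∑ i : Fin 3, ‖nz (weakD i (weakD 1 bin))‖ ^ 2) / ε ^ 2
          + ‖nz (lap (uin 0))‖ ^ 2) := by
  obtain ⟨C, hC, hmain⟩ := exists_mode_estimate_y ε
  refine ⟨C, hC, fun μ lam σ t bin uin b u had hbin huin ht hsol => ?_⟩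
  set K : ℝ := C * Real.exp (-(σ * t / 44)) with hK
  set M : ℝ := K * (σ ^ 2)⁻¹ with hM
  have hb := hsol.memH2_b t ht
  have hu := hsol.memH2_u t ht
  have key := quadSum_nz_le (t := t) (t' := 0)
    (L := [(μ / ε ^ 2, weakD 0 (weakD 1 (b t))), (μ / ε ^ 2, weakD 1 (weakD 1 (b t))),
      (μ / ε ^ 2, weakD 2 (weakD 1 (b t))), (μ, weakD 1 (div (u t))),
      (σ ^ 4, lap (u t 0) - weakD 0 (div (u t)))])
    (L' := [(M / ε ^ 2, weakD 0 (weakD 0 bin)), (M / ε ^ 2, weakD 1 (weakD 0 bin)),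
      (M / ε ^ 2, weakD 2 (weakD 0 bin)), (M, weakD 0 (div uin)), (M, weakD 1 (div uin)),
      (M, lap (uin 1)), (K / ε ^ 2, weakD 0 (weakD 1 bin)), (K / ε ^ 2, weakD 1 (weakD 1 bin)),
      (K / ε ^ 2, weakD 2 (weakD 1 bin)), (K, lap (uin 0))]) ?_
  · simp only [quadSum, List.map_cons, List.map_nil, List.sum_cons, List.sum_nil] at key
    simp only [Fin.sum_univ_three]
    refine le_trans (le_of_eq ?_) (key.trans (le_of_eq ?_)) <;> ring
  intro k l hk
  filter_upwards [hsol.ae_exists_isModeSol ht hk l,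
    ae_all_iff.2 fun i => ae_all_iff.2 fun j => freqT_weakD_weakD k l (k * t) hb i j,
    ae_all_iff.2 fun i => freqT_weakD_div k l (k * t) hu i,
    ae_all_iff.2 fun i => freqT_lap_sub_weakD_div k l (k * t) hu i,
    ae_all_iff.2 fun i => ae_all_iff.2 fun j => freqT_weakD_weakD k l (k * 0) hbin i j,
    ae_all_iff.2 fun i => freqT_weakD_div k l (k * 0) huin i,
    ae_all_iff.2 fun i => freqT_lap k l (k * 0) (huin i)]
    with ξ ⟨B, U, hmode, hB0, hU0, hBt, hUt⟩ h1 h2 h3 h4 h5 h6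
  have h := hmain μ lam σ k l (2 * Real.pi * ξ / k) t B (U 0) (U 1) (U 2) had
    (one_le_intCast_sq hk) ht hmode
  simp only [quadSum, List.map_cons, List.map_nil, List.sum_cons, List.sum_nil]
  simp only [h1, h2, h3, h4, h5, h6, ← hB0, ← hBt, ← hU0, ← hUt, sum_derivSymb_mul hk,
    sum_derivSymb_mul_mul hk, norm_derivSymb_mul_sq hk, norm_neg_ofReal_mul_sq]
  simp only [derivSymb_eq hk, Matrix.cons_val_zero, Matrix.cons_val_one, Matrix.cons_val]
  simp only [vortX', dataX, dataY, ← had.hμ, ← hK] at h ⊢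
  refine le_trans (le_of_eq ?_) (h.trans (le_of_eq ?_))
  · simp only [symb]
    ring
  · simp only [symb, hM]
    ring

end Couette

end

theorem theorem1p2 (ε : ℝ) (hε : 0 < ε) :
    ∃ C₂ : ℝ, 0 < C₂ ∧ ∀ μ lam : ℝ,
      0 < μ → 0 ≤ 2 * μ + 3 * lam →
      lam + 2 * μ ≤ 1 → μ ^ (1 / 3 : ℝ) * ε ≤ 1 / 4 →
      μ ^ (1 / 3 : ℝ) * (lam + 2 * μ) * ε ^ 2 ≤ 1 →
      ∀ (bin : Couette.L2) (uin : Fin 3 → Couette.L2),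
      Couette.MemH2 bin → (∀ i, Couette.MemH2 (uin i)) →
      ∀ (b : ℝ → Couette.L2) (u : ℝ → Fin 3 → Couette.L2),
      Couette.IsSolution ε μ lam bin uin b u →
      ∀ t : ℝ, 0 ≤ t →
        (μ * ((∑ i : Fin 3, (‖Couette.weakD i (Couette.weakD 0 (Couette.nz (b t)))‖ ^ 2
                + ‖Couette.weakD i (Couette.weakD 2 (Couette.nz (b t)))‖ ^ 2)) / ε ^ 2
            + (‖Couette.weakD 0 (Couette.div (Couette.nzV (u t)))‖ ^ 2
                + ‖Couette.weakD 2 (Couette.div (Couette.nzV (u t)))‖ ^ 2)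
            + ‖Couette.lap (Couette.nz (u t 1))
                - Couette.weakD 1 (Couette.div (Couette.nzV (u t)))‖ ^ 2)
          + μ ^ (4 / 3 : ℝ) * ‖Couette.lap (Couette.nz (u t 2))
                - Couette.weakD 2 (Couette.div (Couette.nzV (u t)))‖ ^ 2
          ≤ C₂ * Real.exp (-(μ ^ (1 / 3 : ℝ) * t / 22)) *
            ((∑ i : Fin 3, (‖Couette.nz (Couette.weakD i (Couette.weakD 0 bin))‖ ^ 2
                + ‖Couette.nz (Couette.weakD i (Couette.weakD 2 bin))‖ ^ 2)) / ε ^ 2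
              + (∑ i : Fin 3, ‖Couette.nz (Couette.weakD i (Couette.div uin))‖ ^ 2)
              + ‖Couette.nz (Couette.lap (uin 1))‖ ^ 2
              + ‖Couette.nz (Couette.lap (uin 2))‖ ^ 2))
        ∧
        (μ * ((∑ i : Fin 3, ‖Couette.weakD i (Couette.weakD 1 (Couette.nz (b t)))‖ ^ 2) / ε ^ 2
            + ‖Couette.weakD 1 (Couette.div (Couette.nzV (u t)))‖ ^ 2)
          + μ ^ (4 / 3 : ℝ) * ‖Couette.lap (Couette.nz (u t 0))
                - Couette.weakD 0 (Couette.div (u t))‖ ^ 2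
          ≤ C₂ * Real.exp (-(μ ^ (1 / 3 : ℝ) * t / 44)) *
            (μ ^ (-(2 / 3) : ℝ) *
                ((∑ i : Fin 3, ‖Couette.nz (Couette.weakD i (Couette.weakD 0 bin))‖ ^ 2) / ε ^ 2
                  + (‖Couette.nz (Couette.weakD 0 (Couette.div uin))‖ ^ 2
                    + ‖Couette.nz (Couette.weakD 1 (Couette.div uin))‖ ^ 2)
                  + ‖Couette.nz (Couette.lap (uin 1))‖ ^ 2)
              + (∑ i : Fin 3, ‖Couette.nz (Couette.weakD i (Couette.weakD 1 bin))‖ ^ 2) / ε ^ 2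
              + ‖Couette.nz (Couette.lap (uin 0))‖ ^ 2)) := by
  obtain ⟨C, hC, hxz⟩ := Couette.IsSolution.exists_estimate_xz ε
  obtain ⟨C', hC', hy⟩ := Couette.IsSolution.exists_estimate_y ε
  refine ⟨max C C', lt_max_of_lt_left hC,
    fun μ lam hμ h1 h2 h3 h4 bin uin hbin huin b u hsol t ht => ?_⟩
  have had := Couette.admissible_of_viscosity hε hμ h1 h2 h3 h4
  have hb := hsol.memH2_b t ht
  have hu := hsol.memH2_u t ht
  have e4 : (μ ^ (1 / 3 : ℝ)) ^ 4 = μ ^ (4 / 3 : ℝ) := by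
    rw [← Real.rpow_natCast, ← Real.rpow_mul hμ.le]
    norm_num
  have e2 : ((μ ^ (1 / 3 : ℝ)) ^ 2)⁻¹ = μ ^ (-(2 / 3) : ℝ) := by
    rw [← Real.rpow_natCast, ← Real.rpow_mul hμ.le, ← Real.rpow_neg hμ.le]
    norm_num
  have hdiv := Couette.hasWeakDeriv_div hu
  have hxz' := hxz μ lam _ t bin uin b u had hbin huin ht hsol
  have hy' := hy μ lam _ t bin uin b u had hbin huin ht hsol
  rw [e4] at hxz' hy'
  rw [e2] at hy'
  simp only [Couette.nz_sub] at hxz' hy'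
  rw [Couette.nz_eq_self (hdiv 0)] at hy'
  simp only [hb.weakD_weakD_nz, Couette.weakD_div_nzV hu, (hu _).lap_nz]
  refine ⟨hxz'.trans ?_, hy'.trans ?_⟩
  · gcongr
    exact le_max_left C C'
  · gcongr
    exact le_max_right C C'
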